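/- **Setting.** There are one target task ($k=0$, sample size $n_T$) and $K\ge 1$ source tasks ($k=1,\dots,K$, sample size $n_S$ each); $N=Kn_S+n_T$. The observations follow the linear models $y^{(k)}_i=(X^{(k)}_{i\cdot})^\top\beta^{(k)}+\epsilon^{(k)}_i$ with $\beta^{(k)}\in\mathbb R^p$, where $\|\beta^{(0)}\|_0\le s$ with $s\ge1$, and $\|\beta^{(k)}-\beta^{(0)}\|_1\le h_k$ with $h_k\ge0$. Put $\bar h=\frac{n_S}{N}\sum_{k=1}^K h_k$ and let $\varepsilon_D$ satisfy $\big\|\frac{n_S}{N}\sum_{k=1}^K(\beta^{(k)}-\beta^{(0)})\big\|_1\le\varepsilon_D$. *Assumptions on the data.* The vectors $X^{(k)}_{i\cdot}$ are independent, centred and sub-Gaussian with a uniformly bounded sub-Gaussian parameter, with covariance matrix $\Sigma^{(k)}$ for task $k$, and all eigenvalues of $\Sigma^{(0)},\dots,\Sigma^{(K)}$ lie in $[1/c,c]$ for a constant $c$. The errors $\epsilon^{(k)}_i$ are independent centred Gaussian variables with uniformly bounded variances, independent of the designs. *Estimator.* With $\hat\Sigma^{(k)}=\frac1{n_S}(X^{(k)})^\top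 X^{(k)}$ and $\tilde\lambda_k=\mu_k=c_1\sqrt{\log p/n_S}$, source node $k$ computes the debiased Lasso $$\tilde\beta^{(k)}=\hat\beta^{(k)}_L+\tfrac1{n_S}\hat\Theta^{(k)}(X^{(k)})^\top\big(y^{(k)}-X^{(k)}\hat\beta^{(k)}_L\big),\qquad \hat\beta^{(k)}_L\in\arg\min_{\beta}\Big\{\tfrac1{2n_S}\|y^{(k)}-X^{(k)}\beta\|_2^2+\tilde\lambda_k\|\beta\|_1\Big\},$$ where the $j$-th row of $\hat\Theta^{(k)}$ minimizes $\theta^\top\hat\Sigma^{(k)}\theta$ subject to $\|\hat\Sigma^{(k)}\theta-e_j\|_\infty\le\mu_k$. The target node takes $$(\hat\beta^{(0)}_C,\dots,\hat\beta^{(K)}_C)\in\arg\min_{\beta}\Big\{\tfrac1{2N}\sum_{k=1}^K\|\sqrt{n_S}(\tilde\beta^{(k)}-\beta^{(k)})\|_2^2+\tfrac1{2N}\|y^{(0)}-X^{(0)}\beta^{(0)}\|_2^2+\lambda_0\Big(\|\beta^{(0)}\|_1+\sum_{k=1}^Ka_k\|\beta^{(k)}-\beta^{(0)}\|_1\Big)\Big\}$$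 and outputs $\hat w_C=\frac{n_S}{N}\sum_{k=1}^K\hat\beta^{(k)}_C+\frac{n_T}{N}\hat\beta^{(0)}_C$. The tuning parameters are, with $\delta_k=\frac{s\log p}{N}+\frac{n_S}{N}\sqrt{\frac{\log p}{n_S}}\,h_k$ and $\delta_0=\frac{Ks\log p}{N}+\sqrt{\frac{\log p}{n_S}}\,\bar h$, $$\lambda_0=c_0\Big(\sqrt{\tfrac{\log p}{N}}+\delta_0\Big),\qquad a_k\lambda_0=c_0\Big(8\vee\frac{\bar h}{h_k}\Big)\Big(\sqrt{\tfrac{n_S}{N}\tfrac{\log p}{N}}+\delta_k\Big),$$ where $0/0$ is read as $0$ in case all $h_k$ vanish. **Theorem.** Assume $n_S\gg Ks^2\log p$, $n_S\gtrsim(\bar h^2\vee K^2)\,s\log p$ and $h_k\asymp\bar h$ uniformly in $k$. There are constants $c_0,c_1>0$ depending only on the constants in the assumptions on the data such that, with probability at least $1-c_2\exp(-c_3n_T)-c_4\exp(-c_5\log p)$, the estimator exists and every choice of the minimizers in its construction satisfies $$\|\hat w_C-\beta^{(0)}\|_2^2\lesssim\frac{s\log p}{N}+\sqrt{\frac{\log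 p}{n_S}}\,\bar h+\varepsilon_D^2+s\delta_0^2+\sum_{k=1}^K\delta_kh_k .$$ If in addition $\bar h=O(1)$, then also $$\|\hat w_C-\beta^{(0)}\|_2^2\lesssim\frac{s\log p}{N}+\sqrt{\frac{\log p}{n_S}}\,\bar h+\varepsilon_D^2 .$$ Here $n_S\gg Ks^2\log p$ means $n_S\ge M K s^2\log p$ for a sufficiently large constant $M$. The constants $M$, $c_2,\dots,c_5$ and the one in the first bound depend only on the constants in the assumptions on the data and on those implicit in $n_S\gtrsim(\bar h^2\vee K^2)s\log p$ and $h_k\asymp\bar h$; the one in the second bound depends moreover on the bound for $\bar h$. None of them depends on $n_S,n_T,p,K,s$, the $h_k$, $\varepsilon_D$ or the distributions of the data. -/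

import Mathlib

open MeasureTheory ProbabilityTheory
open scoped NNReal ENNReal Matrix

noncomputable section

namespace TransFusion

/-! ## Norms -/

/-- The `ℓ₁` norm. -/
def l1 {p : ℕ} (v : Fin p → ℝ) : ℝ := ∑ j, |v j|

/-- The squared Euclidean norm. -/
def sqNorm {n : ℕ} (v : Fin n → ℝ) : ℝ := ∑ i, v i ^ 2

/-- The number of nonzero entries. -/
def l0 {p : ℕ} (v : Fin p → ℝ) : ℕ := {j : Fin p | v j ≠ 0}.ncard

/-! ## The samples

There are `K` source tasks with `nS` observations each and one target task with `nT` observations.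
Tasks are numbered by `Fin (K + 1)`: task `0` is the target and task `k.succ` is the source
`k : Fin K`. -/

/-- The index set of all observations. -/
abbrev Obs (K nS nT : ℕ) : Type := Fin nT ⊕ (Fin K × Fin nS)

/-- The task to which an observation belongs. -/
def task {K nS nT : ℕ} : Obs K nS nT → Fin (K + 1)
  | Sum.inl _ => 0
  | Sum.inr (k, _) => k.succ

/-- Sub-Gaussian designs: the covariate vectors `x o` are independent, centred and sub-Gaussian
with parameter `κ` (every one-dimensional unit marginal has a moment generating function bounded
by `exp (κ t² / 2)`), and those of task `k` have covariance matrix `Sig k`, all of whose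
eigenvalues lie in `[1 / cL, cL]`. -/
structure SubGaussianDesigns {Ω : Type*} [MeasurableSpace Ω] (P : Measure Ω) {p K nS nT : ℕ}
    (x : Obs K nS nT → Ω → Fin p → ℝ) (Sig : Fin (K + 1) → Matrix (Fin p) (Fin p) ℝ)
    (cL : ℝ) (κ : ℝ≥0) : Prop where
  measurable : ∀ o, Measurable (x o)
  indep : iIndepFun x P
  subgaussian : ∀ o, ∀ u : Fin p → ℝ, sqNorm u = 1 →
    HasSubgaussianMGF (fun ω => u ⬝ᵥ x o ω) κ P
  mean : ∀ o j, ∫ ω, x o ω j ∂P = 0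
  cov : ∀ o i j, ∫ ω, x o ω i * x o ω j ∂P = Sig (task o) i j
  eigenvalues : ∀ k, spectrum ℝ (Sig k) ⊆ Set.Icc (1 / cL) cL

/-- Gaussian errors: the errors are independent centred Gaussian variables with variances at most
`σ2`, and they are independent of the covariates. -/
structure GaussianErrors {Ω : Type*} [MeasurableSpace Ω] (P : Measure Ω) {p K nS nT : ℕ}
    (x : Obs K nS nT → Ω → Fin p → ℝ) (e : Obs K nS nT → Ω → ℝ) (σ2 : ℝ≥0) : Prop where
  measurable : ∀ o, Measurable (e o)
  indep : iIndepFun e P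
  gaussian : ∀ o, ∃ v : ℝ≥0, v ≤ σ2 ∧ HasLaw (e o) (gaussianReal 0 v) P
  indep_design : IndepFun (fun ω o => x o ω) (fun ω o => e o ω) P

/-- The responses: `y = xᵀ β⁽ᵏ⁾ + e` for the observations of task `k`. -/
def response {Ω : Type*} {p K nS nT : ℕ} (x : Obs K nS nT → Ω → Fin p → ℝ)
    (e : Obs K nS nT → Ω → ℝ) (β : Fin (K + 1) → Fin p → ℝ) (o : Obs K nS nT) (ω : Ω) : ℝ :=
  x o ω ⬝ᵥ β (task o) + e o ω

/-- The design matrix of the target sample, from the covariates of all observations. -/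
def targetX {p K nS nT : ℕ} (x : Obs K nS nT → Fin p → ℝ) : Matrix (Fin nT) (Fin p) ℝ :=
  Matrix.of fun i => x (Sum.inl i)

/-- The response vector of the target sample. -/
def targetY {K nS nT : ℕ} (y : Obs K nS nT → ℝ) : Fin nT → ℝ := fun i => y (Sum.inl i)

/-- The design matrix of source sample `k`. -/
def sourceX {p K nS nT : ℕ} (x : Obs K nS nT → Fin p → ℝ) (k : Fin K) :
    Matrix (Fin nS) (Fin p) ℝ :=
  Matrix.of fun i => x (Sum.inr (k, i))

/-- The response vector of source sample `k`. -/
def sourceY {K nS nT : ℕ} (y : Obs K nS nT → ℝ) (k : Fin K) : Fin nS → ℝ :=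
  fun i => y (Sum.inr (k, i))

/-! ## The parameter space -/

/-- `β` lies in `Θ(s, h)`: the target parameter has at most `s` nonzero entries and the contrast of
source `k` has `ℓ₁` norm at most `h k`. -/
def InParameterSpace {p K : ℕ} (s : ℕ) (h : Fin K → ℝ) (β : Fin (K + 1) → Fin p → ℝ) : Prop :=
  l0 (β 0) ≤ s ∧ ∀ k : Fin K, l1 (β k.succ - β 0) ≤ h k

/-- The total sample size `N = K nS + nT`. -/
def totalSize (K nS nT : ℕ) : ℝ := (K : ℝ) * nS + nT

/-- Task diversity: `‖(nS / N) ∑ₖ (β⁽ᵏ⁾ - β⁽⁰⁾)‖₁ ≤ εD`. -/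
def TaskDiversity {p K : ℕ} (nS nT : ℕ) (β : Fin (K + 1) → Fin p → ℝ) (εD : ℝ) : Prop :=
  l1 (((nS : ℝ) / totalSize K nS nT) • ∑ k : Fin K, (β k.succ - β 0)) ≤ εD

/-- The average model shift `h̄ = (nS / N) ∑ₖ hₖ`. -/
def hbar {K : ℕ} (nS nT : ℕ) (h : Fin K → ℝ) : ℝ :=
  (nS : ℝ) / totalSize K nS nT * ∑ k, h k

/-! ## The local debiased Lasso estimators -/

/-- `b` minimizes the Lasso objective `‖y - X b‖₂² / (2 n) + lam ‖b‖₁`. -/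
def IsLasso {n p : ℕ} (X : Matrix (Fin n) (Fin p) ℝ) (y : Fin n → ℝ) (lam : ℝ)
    (b : Fin p → ℝ) : Prop :=
  IsMinOn (fun b' : Fin p → ℝ => 1 / (2 * (n : ℝ)) * sqNorm (y - X *ᵥ b') + lam * l1 b')
    Set.univ b

/-- The sample covariance matrix `Xᵀ X / n`. -/
def gram {n p : ℕ} (X : Matrix (Fin n) (Fin p) ℝ) : Matrix (Fin p) (Fin p) ℝ :=
  (1 / (n : ℝ)) • (Xᵀ * X)

/-- The constraint set `‖Σ̂ θ - eⱼ‖_∞ ≤ μ`. -/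
def debiasFeasible {n p : ℕ} (X : Matrix (Fin n) (Fin p) ℝ) (μ : ℝ) (j : Fin p) :
    Set (Fin p → ℝ) :=
  {θ | ∀ i, |(gram X *ᵥ θ) i - (Pi.single j 1 : Fin p → ℝ) i| ≤ μ}

/-- Every row `j` of `Th` solves: minimize `θᵀ Σ̂ θ` subject to `‖Σ̂ θ - eⱼ‖_∞ ≤ μ`. -/
def IsDebiasMatrix {n p : ℕ} (X : Matrix (Fin n) (Fin p) ℝ) (μ : ℝ)
    (Th : Matrix (Fin p) (Fin p) ℝ) : Prop :=
  ∀ j, Th j ∈ debiasFeasible X μ j ∧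
    IsMinOn (fun θ : Fin p → ℝ => θ ⬝ᵥ (gram X *ᵥ θ)) (debiasFeasible X μ j) (Th j)

/-- `bt` is a debiased Lasso estimator with Lasso parameter `lam` and constraint parameter `μ`:
`bt = b + Th Xᵀ (y - X b) / n`. -/
def IsDebiasedLasso {n p : ℕ} (X : Matrix (Fin n) (Fin p) ℝ) (y : Fin n → ℝ) (lam μ : ℝ)
    (bt : Fin p → ℝ) : Prop :=
  ∃ (b : Fin p → ℝ) (Th : Matrix (Fin p) (Fin p) ℝ), IsLasso X y lam b ∧ IsDebiasMatrix X μ Th ∧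
    bt = b + (1 / (n : ℝ)) • (Th *ᵥ (Xᵀ *ᵥ (y - X *ᵥ b)))

/-! ## Aggregation at the target node -/

/-- The fused-penalized least squares objective of the target node. -/
def aggObjective {p K nS nT : ℕ} (bt : Fin K → Fin p → ℝ) (X0 : Matrix (Fin nT) (Fin p) ℝ)
    (y0 : Fin nT → ℝ) (lam0 : ℝ) (a : Fin K → ℝ) (b : Fin (K + 1) → Fin p → ℝ) : ℝ :=
  1 / (2 * totalSize K nS nT) * ∑ k : Fin K, sqNorm (√(nS : ℝ) • (bt k - b k.succ))
    + 1 / (2 * totalSize K nS nT) * sqNorm (y0 - X0 *ᵥ b 0)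
    + lam0 * (l1 (b 0) + ∑ k : Fin K, a k * l1 (b k.succ - b 0))

/-- `w` is a one-step D-TransFusion estimator computed from the data `(x, y)`: the sources send
debiased Lasso estimators with parameters `lamS` and `μS`, the target node minimizes the aggregated
objective with parameters `lam0` and `a`, and `w` is the weighted average of the minimizer. -/
def IsOneStepDTransFusion {p K nS nT : ℕ} (x : Obs K nS nT → Fin p → ℝ) (y : Obs K nS nT → ℝ)
    (lamS μS lam0 : ℝ) (a : Fin K → ℝ) (w : Fin p → ℝ) : Prop :=
  ∃ (bt : Fin K → Fin p → ℝ) (b : Fin (K + 1) → Fin p → ℝ),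
    (∀ k, IsDebiasedLasso (sourceX x k) (sourceY y k) lamS μS (bt k)) ∧
    IsMinOn (aggObjective (nS := nS) bt (targetX x) (targetY y) lam0 a) Set.univ b ∧
    w = ((nS : ℝ) / totalSize K nS nT) • ∑ k : Fin K, b k.succ
      + ((nT : ℝ) / totalSize K nS nT) • b 0

/-! ## Tuning parameters and rates -/

/-- `δₖ = s log p / N + (nS / N) √(log p / nS) hₖ`. -/
def delta {K : ℕ} (p nS nT s : ℕ) (h : Fin K → ℝ) (k : Fin K) : ℝ :=
  s * Real.log p / totalSize K nS nT
    + (nS : ℝ) / totalSize K nS nT * √(Real.log p / nS) * h k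

/-- `δ₀ = K s log p / N + √(log p / nS) h̄`. -/
def delta0 {K : ℕ} (p nS nT s : ℕ) (h : Fin K → ℝ) : ℝ :=
  K * s * Real.log p / totalSize K nS nT + √(Real.log p / nS) * hbar nS nT h

/-- `λ₀ = c₀ (√(log p / N) + δ₀)`. -/
def lambda0 {K : ℕ} (c0 : ℝ) (p nS nT s : ℕ) (h : Fin K → ℝ) : ℝ :=
  c0 * (√(Real.log p / totalSize K nS nT) + delta0 p nS nT s h)

/-- The weights `aₖ`, determined by
`aₖ λ₀ = c₀ (8 ∨ h̄ / hₖ) (√((nS / N) (log p / N)) + δₖ)`. -/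
def weight {K : ℕ} (c0 : ℝ) (p nS nT s : ℕ) (h : Fin K → ℝ) (k : Fin K) : ℝ :=
  c0 * max 8 (hbar nS nT h / h k)
      * (√((nS : ℝ) / totalSize K nS nT * (Real.log p / totalSize K nS nT)) + delta p nS nT s h k)
    / lambda0 c0 p nS nT s h

/-- `s log p / N + √(log p / nS) h̄ + εD²`. -/
def centralRate {K : ℕ} (p nS nT s : ℕ) (h : Fin K → ℝ) (εD : ℝ) : ℝ :=
  s * Real.log p / totalSize K nS nT + √(Real.log p / nS) * hbar nS nT h + εD ^ 2

/-- `s log p / N + √(log p / nS) h̄ + εD² + s δ₀² + ∑ₖ δₖ hₖ`. -/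
def distributedRate {K : ℕ} (p nS nT s : ℕ) (h : Fin K → ℝ) (εD : ℝ) : ℝ :=
  centralRate p nS nT s h εD + s * delta0 p nS nT s h ^ 2 + ∑ k, delta p nS nT s h k * h k

end TransFusion

end

namespace TransFusion

/-! ## Elementary facts on the norms -/

section Norms

variable {p n : ℕ}

/-! Write `N` for the total sample size, `ω = nS / N`, `τ = nT / N`. The debiased estimator of
source `k` is `β k.succ` plus a linear form in the errors (`score`) plus a bias. By Hölder's
inequality (`debiased_error`) and the ℓ₁ bound for the Lasso at an approximately sparse vector
(`lasso_l1_error`), each entry of the bias, multiplied by `ω`, is at most a constant times `delta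
k`. Given the designs, the linear forms of different sources are independent and symmetric with
variance proxy of order `1 / nS`, so their weighted sum is as small as the noise of one sample of
size `N`.

The aggregation step is deterministic (`agg_error`). The weights `a k` dominate the noise of single
sources, whereas `lambda0` only has to dominate the averaged noise and bias. The target sample alone
may be too small to control `u = b 0 - β 0`. Therefore `fused_cone_bound` writes `u` as a weighted
average of source errors and of `u` itself, up to fused differences and contrasts that the fusion
penalties pay for; the ℓ₁ mass of `u` on the support is then bounded by the joint quadratic form.
`quadratic_error_bound` turns this into `s * lambda0 ^ 2` plus the penalty at the contrasts. The
output averages all blocks, so the contrasts enter it directly only through their average, which is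
what `εD` bounds.

The obstacle is uniformity over the sources: `K` may exceed every power of `p`, while the failure
probability is a power of `1 / p`, and a maximum over `K` sources would cost `log K`. Two devices
avoid it.

Clipping: the noise of source `k` is clipped at the level that its fusion penalty tolerates. The
comparison point of the basic inequality absorbs the excess (`quadratic_bound`), so only clipped
noise appears in the gradient. Clipping is an odd contraction, hence the clipped noise stays centred
and sub-Gaussian (`odd_contraction_subgaussian`). The excess is centred too, and the second moment
of its sum is tiny (`sum_exceedance_sq_le`).

Irregular sources: by Markov's inequality at most a fraction `p ^ (-8)` of the source samples is
irregular (`measure_card_gt_le`). If there is any, then `K > p ^ 5`, so `nS` is at least of order `K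
* p ^ 4` (`Scaling.card_large`), and all sample covariance matrices are positive definite with high
probability. A crude bound then makes the total bias of the irregular sources small enough to be
counted among the contrasts (`irregular_bias_le`).

Conditioning on the designs requires the noise to be a measurable function of them. The debiasing
rows `θ` need not be unique, but `X θ` is: it is the shortest vector of a closed convex set, and
this vector depends measurably on the design (`measurable_minNorm`). -/

lemma l1_nonneg (v : Fin p → ℝ) : 0 ≤ l1 v := Finset.sum_nonneg fun _ _ => abs_nonneg _

lemma sqNorm_nonneg (v : Fin p → ℝ) : 0 ≤ sqNorm v := Finset.sum_nonneg fun _ _ => sq_nonneg _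

lemma l1_add_le (u v : Fin p → ℝ) : l1 (u + v) ≤ l1 u + l1 v := by
  simp only [l1, ← Finset.sum_add_distrib]
  exact Finset.sum_le_sum fun j _ => abs_add_le _ _

lemma l1_neg (v : Fin p → ℝ) : l1 (-v) = l1 v := by simp [l1]

lemma l1_sub_le (u v : Fin p → ℝ) : l1 (u - v) ≤ l1 u + l1 v := by
  rw [sub_eq_add_neg, ← l1_neg v]; exact l1_add_le _ _

lemma l1_smul (c : ℝ) (v : Fin p → ℝ) : l1 (c • v) = |c| * l1 v := by
  simp [l1, abs_mul, Finset.mul_sum]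

lemma l1_zero : l1 (0 : Fin p → ℝ) = 0 := by simp [l1]

lemma l1_sum_le {ι : Type*} (s : Finset ι) (f : ι → Fin p → ℝ) :
    l1 (∑ k ∈ s, f k) ≤ ∑ k ∈ s, l1 (f k) := by
  classical
  induction s using Finset.induction_on with
  | empty => simp [l1_zero]
  | insert a s ha ih =>
    rw [Finset.sum_insert ha, Finset.sum_insert ha]
    exact (l1_add_le _ _).trans (by linarith)

lemma abs_apply_le_l1 (v : Fin p → ℝ) (j : Fin p) : |v j| ≤ l1 v :=
  Finset.single_le_sum (f := fun j => |v j|) (fun _ _ => abs_nonneg _) (Finset.mem_univ j)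

lemma sqNorm_smul (c : ℝ) (v : Fin p → ℝ) : sqNorm (c • v) = c ^ 2 * sqNorm v := by
  simp [sqNorm, mul_pow, Finset.mul_sum]

lemma sqNorm_neg (v : Fin p → ℝ) : sqNorm (-v) = sqNorm v := by simp [sqNorm]

lemma dotProduct_self_eq (v : Fin p → ℝ) : v ⬝ᵥ v = sqNorm v := by
  simp [dotProduct, sqNorm, sq]

lemma sqNorm_add (u v : Fin p → ℝ) :
    sqNorm (u + v) = sqNorm u + 2 * (u ⬝ᵥ v) + sqNorm v := by
  simp only [sqNorm, dotProduct, Finset.mul_sum, ← Finset.sum_add_distrib, Pi.add_apply]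
  exact Finset.sum_congr rfl fun _ _ => by ring

lemma sqNorm_sub (u v : Fin p → ℝ) :
    sqNorm (u - v) = sqNorm u - 2 * (u ⬝ᵥ v) + sqNorm v := by
  rw [sub_eq_add_neg, sqNorm_add, sqNorm_neg, dotProduct_neg]; ring

lemma sqNorm_add_add_le (u v w : Fin p → ℝ) :
    sqNorm (u + v + w) ≤ 3 * (sqNorm u + sqNorm v + sqNorm w) := by
  simp only [sqNorm, Finset.mul_sum, ← Finset.sum_add_distrib, Pi.add_apply]
  exact Finset.sum_le_sum fun j _ => by
    nlinarith [sq_nonneg (u j - v j), sq_nonneg (u j - w j), sq_nonneg (v j - w j)]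

lemma sqNorm_eq_zero {v : Fin p → ℝ} (h : sqNorm v = 0) : v = 0 := by
  funext j
  have := (Finset.sum_eq_zero_iff_of_nonneg (fun i _ => sq_nonneg (v i))).1 h j (Finset.mem_univ j)
  exact pow_eq_zero_iff (two_ne_zero) |>.1 this

lemma sq_apply_le_sqNorm (v : Fin p → ℝ) (j : Fin p) : v j ^ 2 ≤ sqNorm v :=
  Finset.single_le_sum (f := fun j => v j ^ 2) (fun _ _ => sq_nonneg _) (Finset.mem_univ j)

lemma abs_dotProduct_le (a b : Fin p → ℝ) {c : ℝ} (h : ∀ i, |a i| ≤ c) :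
    |a ⬝ᵥ b| ≤ c * l1 b := by
  rw [dotProduct, l1, Finset.mul_sum]
  refine (Finset.abs_sum_le_sum_abs _ _).trans (Finset.sum_le_sum fun i _ => ?_)
  rw [abs_mul]; exact mul_le_mul_of_nonneg_right (h i) (abs_nonneg _)

lemma dotProduct_sq_le (a b : Fin p → ℝ) : (a ⬝ᵥ b) ^ 2 ≤ sqNorm a * sqNorm b :=
  Finset.sum_mul_sq_le_sq_mul_sq _ _ _

lemma dotProduct_le_sqrt (a b : Fin p → ℝ) : a ⬝ᵥ b ≤ √(sqNorm a) * √(sqNorm b) := by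
  rw [← Real.sqrt_mul (sqNorm_nonneg a)]
  exact (le_abs_self _).trans (Real.abs_le_sqrt (dotProduct_sq_le a b))

lemma sum_abs_sq_le (S : Finset (Fin p)) {s : ℕ} (hs : S.card ≤ s) (u : Fin p → ℝ) :
    (∑ j ∈ S, |u j|) ^ 2 ≤ s * sqNorm u := by
  calc (∑ j ∈ S, |u j|) ^ 2 ≤ S.card * ∑ j ∈ S, |u j| ^ 2 := sq_sum_le_card_mul_sum_sq
    _ ≤ s * sqNorm u := by
      gcongr
      simp only [sq_abs, sqNorm]
      exact Finset.sum_le_sum_of_subset_of_nonneg (Finset.subset_univ _) fun _ _ _ => sq_nonneg _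

lemma sum_abs_le (S : Finset (Fin p)) {s : ℕ} (hs : S.card ≤ s) (u : Fin p → ℝ) :
    ∑ j ∈ S, |u j| ≤ √(s * sqNorm u) := by
  refine Real.le_sqrt_of_sq_le (sum_abs_sq_le S hs u)

lemma l1_sq_le (u : Fin p → ℝ) : l1 u ^ 2 ≤ p * sqNorm u :=
  sum_abs_sq_le Finset.univ (by simp) u

lemma sqNorm_le_l1_sq (u : Fin p → ℝ) : sqNorm u ≤ l1 u ^ 2 := by
  rw [sq (l1 u)]
  nth_rw 2 [l1]
  rw [Finset.mul_sum]
  refine Finset.sum_le_sum fun j _ => ?_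
  rw [← sq_abs, sq]
  exact mul_le_mul_of_nonneg_right (abs_apply_le_l1 u j) (abs_nonneg _)

lemma abs_quadForm_le (A : Matrix (Fin p) (Fin p) ℝ) {η : ℝ} (hA : ∀ i j, |A i j| ≤ η)
    (u : Fin p → ℝ) : |u ⬝ᵥ (A *ᵥ u)| ≤ η * l1 u ^ 2 := by
  rw [dotProduct_comm]
  refine (abs_dotProduct_le _ _ (c := η * l1 u) fun i => ?_).trans (le_of_eq (by ring))
  exact abs_dotProduct_le _ _ (hA i)

/-- This replaces a restricted eigenvalue condition: the loss `η * l1 u ^ 2` is harmless once `l1 u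
^ 2` is of order `s * sqNorm u` and `s * η` is small. -/
lemma quadForm_ge {A B : Matrix (Fin p) (Fin p) ℝ} {η c : ℝ}
    (hB : ∀ u, c * sqNorm u ≤ u ⬝ᵥ (B *ᵥ u)) (hA : ∀ i j, |A i j - B i j| ≤ η)
    (u : Fin p → ℝ) : c * sqNorm u - η * l1 u ^ 2 ≤ u ⬝ᵥ (A *ᵥ u) := by
  have h1 := abs_quadForm_le (A - B) (η := η) (by simpa using hA) u
  rw [Matrix.sub_mulVec, dotProduct_sub] at h1
  linarith [hB u, (abs_le.1 h1).1]

/-- Decrease of the `ℓ₁` norm at a vector that is the sum of a vector supported on `S` and `d`. -/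
lemma l1_sub_l1_le (S : Finset (Fin p)) (b d u : Fin p → ℝ) (hb : ∀ j ∉ S, b j = 0) :
    l1 (b + d) - l1 (b + d + u) ≤ 2 * (∑ j ∈ S, |u j|) - l1 u + 2 * l1 d := by
  classical
  have key : ∀ j, |b j + d j| - |b j + d j + u j| + |u j| ≤
      2 * (if j ∈ S then |u j| else 0) + 2 * |d j| := by
    intro j
    split_ifs with hj
    · have := abs_sub_abs_le_abs_sub (b j + d j) (b j + d j + u j)
      have h2 : |b j + d j - (b j + d j + u j)| = |u j| := by
        rw [show b j + d j - (b j + d j + u j) = -u j by ring, abs_neg]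
      have := abs_nonneg (d j)
      linarith
    · rw [hb j hj, zero_add]
      have h3 : |u j| ≤ |d j + u j| + |d j| := by
        have := abs_sub (d j + u j) (d j); simpa using this
      linarith
  have := Finset.sum_le_sum fun j (_ : j ∈ Finset.univ) => key j
  simp only [Finset.sum_add_distrib, Finset.sum_sub_distrib, ← Finset.mul_sum,
    Finset.sum_ite_mem, Finset.univ_inter] at this
  simp only [l1, Pi.add_apply]
  linarith

/-- Cauchy–Schwarz with weights; it passes from errors of averages to averages of squared errors. -/
lemma sqNorm_weighted_sum_le {ι : Type*} (s : Finset ι) (w : ι → ℝ) (hw : ∀ k ∈ s, 0 ≤ w k)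
    (v : ι → Fin p → ℝ) :
    sqNorm (∑ k ∈ s, w k • v k) ≤ (∑ k ∈ s, w k) * ∑ k ∈ s, w k * sqNorm (v k) := by
  have : ∀ j, (∑ k ∈ s, w k * v k j) ^ 2 ≤ (∑ k ∈ s, w k) * ∑ k ∈ s, w k * v k j ^ 2 := by
    intro j
    refine Finset.sum_sq_le_sum_mul_sum_of_sq_le_mul s hw
      (fun k hk => mul_nonneg (hw k hk) (sq_nonneg _)) fun k _ => le_of_eq (by ring)
  simp only [sqNorm, Finset.sum_apply, Pi.smul_apply, smul_eq_mul]
  refine (Finset.sum_le_sum fun j _ => this j).trans (le_of_eq ?_)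
  rw [← Finset.mul_sum, Finset.sum_comm]
  simp only [Finset.mul_sum]

lemma exists_support (v : Fin p → ℝ) {s : ℕ} (h : l0 v ≤ s) :
    ∃ S : Finset (Fin p), S.card ≤ s ∧ ∀ j ∉ S, v j = 0 := by
  classical
  refine ⟨Finset.univ.filter fun j => v j ≠ 0, ?_, fun j hj => by simpa using hj⟩
  rw [l0] at h
  rwa [← Set.ncard_coe_finset, Finset.coe_filter_univ]

end Norms

/-! ## The Lasso -/

section Lasso

variable {p n : ℕ}

lemma gram_apply (X : Matrix (Fin n) (Fin p) ℝ) (i j : Fin p) :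
    gram X i j = 1 / (n : ℝ) * ∑ o, X o i * X o j := by
  simp [gram, Matrix.mul_apply]

lemma gram_mulVec (X : Matrix (Fin n) (Fin p) ℝ) (u : Fin p → ℝ) :
    gram X *ᵥ u = (1 / (n : ℝ)) • (Xᵀ *ᵥ (X *ᵥ u)) := by
  rw [gram, Matrix.smul_mulVec, Matrix.mulVec_mulVec]

lemma dotProduct_transpose_mulVec (X : Matrix (Fin n) (Fin p) ℝ) (u : Fin p → ℝ)
    (v : Fin n → ℝ) : u ⬝ᵥ (Xᵀ *ᵥ v) = (X *ᵥ u) ⬝ᵥ v := by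
  rw [Matrix.dotProduct_mulVec, Matrix.vecMul_transpose]

lemma gram_quadForm (X : Matrix (Fin n) (Fin p) ℝ) (u : Fin p → ℝ) :
    u ⬝ᵥ (gram X *ᵥ u) = 1 / (n : ℝ) * sqNorm (X *ᵥ u) := by
  rw [gram_mulVec, dotProduct_smul, dotProduct_transpose_mulVec, dotProduct_self_eq, smul_eq_mul]

lemma lasso_basic_inequality (X : Matrix (Fin n) (Fin p) ℝ) (β b : Fin p → ℝ) (e : Fin n → ℝ)
    {lam : ℝ} (h : IsLasso X (X *ᵥ β + e) lam b) :
    1 / 2 * ((b - β) ⬝ᵥ (gram X *ᵥ (b - β))) ≤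
      (b - β) ⬝ᵥ ((1 / (n : ℝ)) • (Xᵀ *ᵥ e)) + lam * (l1 β - l1 b) := by
  have h1 := h (Set.mem_univ β)
  simp only [Set.mem_ofPred_eq] at h1
  have e1 : X *ᵥ β + e - X *ᵥ b = e - X *ᵥ (b - β) := by
    rw [Matrix.mulVec_sub]; abel
  have e2 : X *ᵥ β + e - X *ᵥ β = e := by abel
  rw [e1, e2, sqNorm_sub] at h1
  rw [gram_quadForm, dotProduct_smul, dotProduct_transpose_mulVec, smul_eq_mul,
    dotProduct_comm (X *ᵥ (b - β)) e]
  have e3 : 1 / (2 * (n : ℝ)) = 1 / 2 * (1 / (n : ℝ)) := by rw [one_div_mul_one_div]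
  rw [e3] at h1
  linarith

/-- The `ℓ₁` error of the Lasso at an approximately sparse parameter. -/
lemma lasso_l1_error (X : Matrix (Fin n) (Fin p) ℝ) (β0 d b : Fin p → ℝ) (e : Fin n → ℝ)
    {B : Matrix (Fin p) (Fin p) ℝ} {lam η cL h : ℝ} {s : ℕ} (hlam : 0 < lam) (hcL : 0 < cL)
    (hL : IsLasso X (X *ᵥ (β0 + d) + e) lam b)
    (hs : l0 β0 ≤ s) (hd : l1 d ≤ h)
    (hB : ∀ u, 1 / cL * sqNorm u ≤ u ⬝ᵥ (B *ᵥ u)) (hA : ∀ i j, |gram X i j - B i j| ≤ η)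
    (hη0 : 0 ≤ η) (hη : 64 * cL * s * η ≤ 1)
    (hnoise : ∀ j, |((1 / (n : ℝ)) • (Xᵀ *ᵥ e)) j| ≤ lam / 2) :
    l1 (b - (β0 + d)) ≤ 32 * cL * lam * s + 8 * h := by
  obtain ⟨S, hS, hS0⟩ := exists_support β0 hs
  set Δ := b - (β0 + d) with hΔ
  have hh : 0 ≤ h := (l1_nonneg d).trans hd
  have h1 := lasso_basic_inequality X (β0 + d) b e hL
  rw [← hΔ] at h1
  have h2 : Δ ⬝ᵥ ((1 / (n : ℝ)) • (Xᵀ *ᵥ e)) ≤ lam / 2 * l1 Δ := by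
    rw [dotProduct_comm]; exact (le_abs_self _).trans (abs_dotProduct_le _ _ hnoise)
  have h3 := l1_sub_l1_le S β0 d Δ hS0
  rw [show β0 + d + Δ = b by rw [hΔ]; abel] at h3
  have h4 : lam * (l1 (β0 + d) - l1 b) ≤ lam * (2 * (∑ j ∈ S, |Δ j|) - l1 Δ + 2 * h) := by
    gcongr; linarith
  have h5 := quadForm_ge hB hA Δ
  -- `D` bounds the ℓ₁ mass of the error on the support. The basic inequality yields `l1 Δ ≤ 4 * D +
  -- 4 * h`, and the curvature bound then becomes a quadratic inequality in `D`.
  set D := √(s * sqNorm Δ) with hD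
  have hD0 : 0 ≤ D := Real.sqrt_nonneg _
  have hD2 : D ^ 2 = s * sqNorm Δ := Real.sq_sqrt (by have := sqNorm_nonneg Δ; positivity)
  have h6 : ∑ j ∈ S, |Δ j| ≤ D := sum_abs_le S hS Δ
  set q := Δ ⬝ᵥ (gram X *ᵥ Δ) with hq
  have hq0 : 0 ≤ q := by
    rw [hq, gram_quadForm]; have := sqNorm_nonneg (X *ᵥ Δ); positivity
  have h7 : lam * (∑ j ∈ S, |Δ j|) ≤ lam * D := by gcongr
  have h8 : 1 / 2 * q + lam / 2 * l1 Δ ≤ 2 * (lam * D) + 2 * lam * h := by nlinarith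
  have hl1 : l1 Δ ≤ 4 * D + 4 * h := by
    have : lam * l1 Δ ≤ lam * (4 * D + 4 * h) := by nlinarith
    exact le_of_mul_le_mul_left this hlam
  have h9 : l1 Δ ^ 2 ≤ 32 * D ^ 2 + 32 * h ^ 2 := by
    have := pow_le_pow_left₀ (l1_nonneg Δ) hl1 2
    nlinarith [sq_nonneg (D - h)]
  have h10 : q ≤ 4 * (lam * D) + 4 * lam * h := by
    have := mul_nonneg hlam.le (l1_nonneg Δ)
    nlinarith
  have hs0 : (0 : ℝ) ≤ s := Nat.cast_nonneg s
  have hsη : cL * (s * η) ≤ 1 / 64 := by nlinarith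
  -- The smallness of `s * η` limits the curvature loss to `D ^ 2 / 2 + h ^ 2 / 2`; its first term
  -- moves to the left, which doubles the constants.
  have h11 : D ^ 2 ≤ 8 * cL * lam * s * D + 8 * cL * lam * s * h + h ^ 2 := by
    have a1 : 1 / cL * sqNorm Δ ≤ 4 * (lam * D) + 4 * lam * h + η * (32 * D ^ 2 + 32 * h ^ 2) := by
      have := mul_le_mul_of_nonneg_left h9 hη0
      linarith
    have a2 : cL * s * (1 / cL * sqNorm Δ) = D ^ 2 := by
      rw [hD2]; field_simp
    have a3 := mul_le_mul_of_nonneg_left a1 (mul_nonneg hcL.le hs0)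
    rw [a2] at a3
    have a4 : cL * (s * η) * (32 * D ^ 2 + 32 * h ^ 2) ≤ 1 / 64 * (32 * D ^ 2 + 32 * h ^ 2) := by
      gcongr
    nlinarith
  have ha : 0 ≤ 8 * cL * lam * s := by positivity
  have h12 : D ≤ 8 * cL * lam * s + h := by
    by_contra hc
    push Not at hc
    nlinarith [mul_nonneg ha hh]
  linarith

/-- The `ℓ₁` error of the Lasso when the sample covariance matrix is positive definite. -/
lemma lasso_l1_error_of_posDef (X : Matrix (Fin n) (Fin p) ℝ) (β b : Fin p → ℝ) (e : Fin n → ℝ)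
    {lam c : ℝ} (hlam : 0 ≤ lam) (hc : 0 < c)
    (hL : IsLasso X (X *ᵥ β + e) lam b)
    (hA : ∀ u, 1 / c * sqNorm u ≤ u ⬝ᵥ (gram X *ᵥ u)) :
    l1 (b - β) ≤ 2 * c * √p * (√(sqNorm ((1 / (n : ℝ)) • (Xᵀ *ᵥ e))) + lam * √p) := by
  set Δ := b - β with hΔ
  set g := (1 / (n : ℝ)) • (Xᵀ *ᵥ e)
  have h1 := lasso_basic_inequality X β b e hL
  rw [← hΔ] at h1
  have h2 : Δ ⬝ᵥ g ≤ √(sqNorm Δ) * √(sqNorm g) := dotProduct_le_sqrt _ _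
  have h3 : l1 β - l1 b ≤ l1 Δ := by
    have := l1_sub_le b Δ
    rw [show b - Δ = β by rw [hΔ]; abel] at this
    linarith
  have h4 : l1 Δ ≤ √p * √(sqNorm Δ) := by
    rw [← Real.sqrt_mul (Nat.cast_nonneg p)]
    exact Real.le_sqrt_of_sq_le (l1_sq_le Δ)
  set r := √(sqNorm Δ) with hr
  have hr0 : 0 ≤ r := Real.sqrt_nonneg _
  have hr2 : r ^ 2 = sqNorm Δ := Real.sq_sqrt (sqNorm_nonneg _)
  have h5 : lam * (l1 β - l1 b) ≤ lam * (√p * r) := by gcongr; linarith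
  have h6 := hA Δ
  rw [← hr2] at h6
  have h7 : r * r ≤ r * (2 * c * (√(sqNorm g) + lam * √p)) := by
    have : 1 / c * r ^ 2 ≤ 2 * (r * √(sqNorm g) + lam * (√p * r)) := by linarith
    have h8 := mul_le_mul_of_nonneg_left this hc.le
    have h9 : c * (1 / c * r ^ 2) = r ^ 2 := by field_simp
    rw [h9] at h8
    linarith
  have h8 : r ≤ 2 * c * (√(sqNorm g) + lam * √p) := by
    rcases hr0.eq_or_lt with h0 | h0
    · rw [← h0]; positivity
    · exact le_of_mul_le_mul_left h7 h0
  calc l1 Δ ≤ √p * r := h4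
    _ ≤ √p * (2 * c * (√(sqNorm g) + lam * √p)) := by gcongr
    _ = _ := by ring

/-- Error decomposition of the debiased Lasso. -/
lemma debiased_error (X : Matrix (Fin n) (Fin p) ℝ) (β b : Fin p → ℝ) (e : Fin n → ℝ)
    (Th : Matrix (Fin p) (Fin p) ℝ) {μ : ℝ} (hTh : ∀ j, Th j ∈ debiasFeasible X μ j) (j : Fin p) :
    |(b + (1 / (n : ℝ)) • (Th *ᵥ (Xᵀ *ᵥ (X *ᵥ β + e - X *ᵥ b)))) j - β j
      - 1 / (n : ℝ) * ((X *ᵥ Th j) ⬝ᵥ e)| ≤ μ * l1 (b - β) := by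
  have e1 : X *ᵥ β + e - X *ᵥ b = e - X *ᵥ (b - β) := by
    rw [Matrix.mulVec_sub]; abel
  have e2 : (Th *ᵥ (Xᵀ *ᵥ (e - X *ᵥ (b - β)))) j =
      (X *ᵥ Th j) ⬝ᵥ e - (X *ᵥ Th j) ⬝ᵥ (X *ᵥ (b - β)) := by
    rw [← dotProduct_sub, ← dotProduct_transpose_mulVec]; rfl
  have e3 : 1 / (n : ℝ) * ((X *ᵥ Th j) ⬝ᵥ (X *ᵥ (b - β))) = (gram X *ᵥ Th j) ⬝ᵥ (b - β) := by
    rw [gram_mulVec, smul_dotProduct, dotProduct_comm (Xᵀ *ᵥ _), dotProduct_transpose_mulVec,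
      dotProduct_comm, smul_eq_mul]
  have e4 : (Pi.single j 1 : Fin p → ℝ) ⬝ᵥ (b - β) = b j - β j := by simp
  -- Apart from the linear form in `e`, the error is `(eⱼ - Σ̂ θⱼ) ⬝ᵥ (b - β)`; the constraint
  -- bounds the first factor entrywise.
  have h1 := abs_dotProduct_le (gram X *ᵥ Th j - Pi.single j 1) (b - β) (c := μ)
    (fun i => hTh j i)
  rw [sub_dotProduct, e4, ← e3] at h1
  rw [← abs_neg]
  refine le_of_eq_of_le (congrArg _ ?_) h1
  rw [e1, Pi.add_apply, Pi.smul_apply, e2, smul_eq_mul]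
  ring

end Lasso

end TransFusion

namespace TransFusion

/-! ## Minimal norm points of closed convex sets -/

section MinNorm

variable {n : ℕ}

lemma continuous_sqNorm : Continuous (sqNorm : (Fin n → ℝ) → ℝ) := by
  unfold sqNorm; fun_prop

lemma continuous_l1 : Continuous (l1 : (Fin n → ℝ) → ℝ) := by
  unfold l1; fun_prop

lemma norm_le_l1 (v : Fin n → ℝ) : ‖v‖ ≤ l1 v :=
  (pi_norm_le_iff_of_nonneg (l1_nonneg v)).2 fun j => abs_apply_le_l1 v j

lemma norm_sq_le_sqNorm (v : Fin n → ℝ) : ‖v‖ ^ 2 ≤ sqNorm v := by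
  have h : ‖v‖ ≤ √(sqNorm v) :=
    (pi_norm_le_iff_of_nonneg (Real.sqrt_nonneg _)).2 fun j =>
      Real.abs_le_sqrt (sq_apply_le_sqNorm v j)
  have := pow_le_pow_left₀ (norm_nonneg v) h 2
  rwa [Real.sq_sqrt (sqNorm_nonneg v)] at this

lemma isCompact_sqNorm_le (q : ℝ) : IsCompact {v : Fin n → ℝ | sqNorm v ≤ q} := by
  refine Metric.isCompact_of_isClosed_isBounded (isClosed_le continuous_sqNorm continuous_const) ?_
  refine (Metric.isBounded_closedBall (x := (0 : Fin n → ℝ)) (r := √q)).subset fun v hv => ?_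
  rw [mem_closedBall_zero_iff]
  exact Real.le_sqrt_of_sq_le ((norm_sq_le_sqNorm v).trans hv)

lemma exists_isMinOn_sqNorm {C : Set (Fin n → ℝ)} (hC : IsClosed C) (hne : C.Nonempty) :
    ∃ v ∈ C, IsMinOn sqNorm C v := by
  obtain ⟨w, hw⟩ := hne
  obtain ⟨v, hv, hmin⟩ := ((isCompact_sqNorm_le (sqNorm w)).inter_left hC).exists_isMinOn
    ⟨w, hw, le_refl (sqNorm w)⟩ continuous_sqNorm.continuousOn
  refine ⟨v, hv.1, fun x hx => ?_⟩
  by_cases h : sqNorm x ≤ sqNorm w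
  · exact hmin ⟨hx, h⟩
  · exact le_trans hv.2 (not_le.1 h).le

/-- Parallelogram law: the midpoint belongs to `C` and would be shorter by a quarter of `sqNorm (v -
w)`. -/
lemma isMinOn_sqNorm_unique {C : Set (Fin n → ℝ)} (hC : Convex ℝ C) {v w : Fin n → ℝ}
    (hv : v ∈ C) (hw : w ∈ C) (hvm : IsMinOn sqNorm C v) (hwv : sqNorm w ≤ sqNorm v) : w = v := by
  have h1 := hvm (hC hv hw (by norm_num : (0 : ℝ) ≤ 1 / 2) (by norm_num : (0 : ℝ) ≤ 1 / 2)
    (by norm_num))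
  simp only [Set.mem_ofPred_eq] at h1
  rw [← smul_add, sqNorm_smul, sqNorm_add] at h1
  have h2 := sqNorm_sub v w
  have h3 := sqNorm_nonneg (v - w)
  have h4 : sqNorm (v - w) = 0 := by linarith
  exact (sub_eq_zero.1 (sqNorm_eq_zero h4)).symm

open Classical in
/-- The point of minimal norm of a set, `0` if there is none. -/
noncomputable def minNorm (C : Set (Fin n → ℝ)) : Fin n → ℝ :=
  if h : ∃ v ∈ C, IsMinOn sqNorm C v then h.choose else 0

lemma minNorm_spec {C : Set (Fin n → ℝ)} (hC : IsClosed C) (hne : C.Nonempty) :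
    minNorm C ∈ C ∧ IsMinOn sqNorm C (minNorm C) := by
  have h := exists_isMinOn_sqNorm hC hne
  rw [minNorm, dif_pos h]
  exact h.choose_spec

lemma minNorm_of_empty {C : Set (Fin n → ℝ)} (h : ¬ C.Nonempty) : minNorm C = 0 := by
  rw [minNorm, dif_neg]
  rintro ⟨v, hv, -⟩
  exact h ⟨v, hv⟩

/-- Projection along a compact factor is a closed map. -/
lemma isClosed_exists_mem_compact {A Y : Type*} [TopologicalSpace A] [TopologicalSpace Y]
    {D : Set (A × Y)} (hD : IsClosed D) {F : Set Y} (hF : IsCompact F) :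
    IsClosed {a | ∃ y ∈ F, (a, y) ∈ D} := by
  have : CompactSpace F := isCompact_iff_compactSpace.1 hF
  have h : IsClosed ((fun q : A × F => (q.1, (q.2 : Y))) ⁻¹' D) :=
    hD.preimage (by fun_prop)
  convert isClosedMap_fst_of_compactSpace _ h using 1
  ext a
  constructor
  · rintro ⟨y, hy, hD⟩
    exact ⟨(a, ⟨y, hy⟩), hD, rfl⟩
  · rintro ⟨⟨a', y⟩, hq, rfl⟩
    exact ⟨y, y.2, hq⟩

/-- The shortest point of a nonempty section lies in a closed set `F` iff, for every rational `q`, a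
section that contains a point of squared norm at most `q` contains such a point in `F`. For fixed
`q` both properties define projections of closed sets along compact ones, hence closed sets of
parameters. -/
lemma measurable_minNorm {A : Type*} [TopologicalSpace A] [MeasurableSpace A]
    [OpensMeasurableSpace A] {D : Set (A × (Fin n → ℝ))} (hD : IsClosed D)
    (hconv : ∀ a, Convex ℝ {w | (a, w) ∈ D}) :
    Measurable fun a => minNorm {w | (a, w) ∈ D} := by
  have hcl : ∀ a, IsClosed {w | (a, w) ∈ D} := fun a => hD.preimage (by fun_prop)
  let S : Set (Fin n → ℝ) → ℚ → Set A := fun F q =>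
    {a | ∃ w ∈ F ∩ {v | sqNorm v ≤ q}, (a, w) ∈ D}
  have hS : ∀ F, IsClosed F → ∀ q, MeasurableSet (S F q) := fun F hF q =>
    (isClosed_exists_mem_compact hD ((isCompact_sqNorm_le _).inter_left hF)).measurableSet
  let T : Set A := ⋃ q, S Set.univ q
  have hT : ∀ a, a ∈ T ↔ {w | (a, w) ∈ D}.Nonempty := by
    intro a
    simp only [T, Set.mem_iUnion]
    constructor
    · rintro ⟨q, w, -, hw⟩; exact ⟨w, hw⟩
    · rintro ⟨w, hw⟩
      obtain ⟨q, hq⟩ := exists_rat_gt (sqNorm w)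
      exact ⟨q, w, ⟨trivial, hq.le⟩, hw⟩
  have hTm : MeasurableSet T := MeasurableSet.iUnion fun q => hS _ isClosed_univ q
  refine measurable_of_isClosed fun F hF => ?_
  -- `T` collects the parameters with nonempty section; outside of it `minNorm` takes its default
  -- value `0`.
  have hset : (fun a => minNorm {w | (a, w) ∈ D}) ⁻¹' F =
      (T ∩ ⋂ q, (S Set.univ q)ᶜ ∪ S F q) ∪ (Tᶜ ∩ {_a | (0 : Fin n → ℝ) ∈ F}) := by
    ext a
    simp only [Set.mem_preimage, Set.mem_union, Set.mem_inter_iff, Set.mem_iInter,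
      Set.mem_compl_iff, Set.mem_ofPred_eq]
    by_cases ha : a ∈ T
    · have hne := (hT a).1 ha
      obtain ⟨hm, hmin⟩ := minNorm_spec (hcl a) hne
      simp only [ha, true_and, not_true_eq_false, false_and, or_false]
      constructor
      · intro hF' q
        by_cases hq : a ∈ S Set.univ q
        · right
          obtain ⟨w, hw, hwD⟩ := hq
          exact ⟨_, ⟨hF', (show sqNorm _ ≤ sqNorm w from hmin hwD).trans hw.2⟩, hm⟩
        · exact Or.inl hq
      · intro hall
        have hcmp : IsClosed ({w | (a, w) ∈ D} ∩ F) := (hcl a).inter hF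
        have hne' : ({w | (a, w) ∈ D} ∩ F).Nonempty := by
          obtain ⟨q, hq⟩ := exists_rat_gt (sqNorm (minNorm {w | (a, w) ∈ D}))
          rcases hall q with h | ⟨w, hw, hwD⟩
          · exact absurd ⟨_, ⟨trivial, hq.le⟩, hm⟩ h
          · exact ⟨w, hwD, hw.1⟩
        obtain ⟨v, hv, hvm⟩ := exists_isMinOn_sqNorm hcmp hne'
        have hle : sqNorm v ≤ sqNorm (minNorm {w | (a, w) ∈ D}) := by
          by_contra hlt
          push Not at hlt
          obtain ⟨q, hq1, hq2⟩ := exists_rat_btwn hlt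
          rcases hall q with h | ⟨w, hw, hwD⟩
          · exact h ⟨_, ⟨trivial, hq1.le⟩, hm⟩
          · have : sqNorm v ≤ sqNorm w := hvm ⟨hwD, hw.1⟩
            have := hw.2
            simp only [Set.mem_ofPred_eq] at this
            linarith
        rw [← isMinOn_sqNorm_unique (hconv a) hm hv.1 hmin hle]
        exact hv.2
    · have hne : ¬ {w | (a, w) ∈ D}.Nonempty := fun h => ha ((hT a).2 h)
      simp [ha, minNorm_of_empty hne]
  rw [hset]
  refine (hTm.inter (MeasurableSet.iInter fun q =>
    (hS _ isClosed_univ q).compl.union (hS F hF q))).union (hTm.compl.inter ?_)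
  exact MeasurableSet.const _

end MinNorm

/-! ## Existence of the estimators -/

section Existence

variable {p n : ℕ}

lemma exists_isMinOn_univ_of_norm_le {E : Type*} [NormedAddCommGroup E] [ProperSpace E]
    {f : E → ℝ} (hf : Continuous f) {c : ℝ} (hb : ∀ x, ‖x‖ ≤ c * f x) (hc : 0 < c) :
    ∃ x, IsMinOn f Set.univ x := by
  obtain ⟨x, hx⟩ := hf.exists_forall_le' (0 : E) <| by
    filter_upwards [(tendsto_norm_cocompact_atTop (E := E)).eventually_ge_atTop (c * f 0)] with x hx
    exact le_of_mul_le_mul_left (hx.trans (hb x)) hc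
  exact ⟨x, fun y _ => hx y⟩

lemma exists_isLasso (X : Matrix (Fin n) (Fin p) ℝ) (y : Fin n → ℝ) {lam : ℝ} (h : 0 < lam) :
    ∃ b, IsLasso X y lam b := by
  refine exists_isMinOn_univ_of_norm_le (c := 1 / lam) ?_ (fun b => ?_) (by positivity)
  · have := @continuous_sqNorm n
    have := @continuous_l1 p
    fun_prop
  · have h1 := sqNorm_nonneg (y - X *ᵥ b)
    have h2 : lam * l1 b ≤ 1 / (2 * (n : ℝ)) * sqNorm (y - X *ᵥ b) + lam * l1 b := by
      have : 0 ≤ 1 / (2 * (n : ℝ)) * sqNorm (y - X *ᵥ b) := by positivity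
      linarith
    refine (norm_le_l1 b).trans ?_
    rw [one_div, ← div_eq_inv_mul, le_div_iff₀ h]
    linarith

/-- The penalty alone is coercive: it bounds `b 0`, and then every `b k.succ` through its difference
from `b 0`. -/
lemma exists_isMinOn_aggObjective {K nS nT : ℕ} (bt : Fin K → Fin p → ℝ)
    (X0 : Matrix (Fin nT) (Fin p) ℝ) (y0 : Fin nT → ℝ) {lam0 : ℝ} {a : Fin K → ℝ}
    (hlam : 0 < lam0) (ha : ∀ k, 0 < a k) :
    ∃ b, IsMinOn (aggObjective (nS := nS) bt X0 y0 lam0 a) Set.univ b := by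
  have hS : 0 ≤ ∑ k, (a k)⁻¹ := Finset.sum_nonneg fun k _ => (inv_pos.2 (ha k)).le
  refine exists_isMinOn_univ_of_norm_le (c := (1 + ∑ k, (a k)⁻¹) / lam0) ?_ (fun b => ?_)
    (by positivity)
  · have := @continuous_sqNorm p
    have := @continuous_sqNorm nT
    have := @continuous_l1 p
    unfold aggObjective
    fun_prop
  · set P := l1 (b 0) + ∑ k : Fin K, a k * l1 (b k.succ - b 0) with hP
    have hsum : ∀ k, a k * l1 (b k.succ - b 0) ≤ ∑ k : Fin K, a k * l1 (b k.succ - b 0) :=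
      fun k => Finset.single_le_sum (f := fun k => a k * l1 (b k.succ - b 0))
        (fun k _ => mul_nonneg (ha k).le (l1_nonneg _)) (Finset.mem_univ k)
    have hsum0 : 0 ≤ ∑ k : Fin K, a k * l1 (b k.succ - b 0) :=
      Finset.sum_nonneg fun k _ => mul_nonneg (ha k).le (l1_nonneg _)
    have hb0 : l1 (b 0) ≤ P := by linarith
    have hP0 : 0 ≤ P := (l1_nonneg _).trans hb0
    have hF : lam0 * P ≤ aggObjective (nS := nS) bt X0 y0 lam0 a b := by
      have h1 : 0 ≤ totalSize K nS nT := by unfold totalSize; positivity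
      have h2 : 0 ≤ ∑ k : Fin K, sqNorm (√(nS : ℝ) • (bt k - b k.succ)) :=
        Finset.sum_nonneg fun k _ => sqNorm_nonneg _
      have h3 := sqNorm_nonneg (y0 - X0 *ᵥ b 0)
      unfold aggObjective
      have : 0 ≤ 1 / (2 * totalSize K nS nT) := by positivity
      have h4 := mul_nonneg this h2
      have h5 := mul_nonneg this h3
      linarith
    have hnorm : ‖b‖ ≤ (1 + ∑ k, (a k)⁻¹) * P := by
      refine (pi_norm_le_iff_of_nonneg (by positivity)).2 fun k => ?_
      refine (norm_le_l1 _).trans ?_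
      refine Fin.cases ?_ (fun k => ?_) k
      · nlinarith
      · have h1 : l1 (b k.succ - b 0) ≤ (a k)⁻¹ * P := by
          rw [← div_eq_inv_mul, le_div_iff₀ (ha k)]
          linarith [hsum k, l1_nonneg (b 0)]
        have h2 : (a k)⁻¹ ≤ ∑ k, (a k)⁻¹ := Finset.single_le_sum (f := fun k => (a k)⁻¹)
          (fun k _ => (inv_pos.2 (ha k)).le) (Finset.mem_univ k)
        have h3 := l1_add_le (b k.succ - b 0) (b 0)
        rw [sub_add_cancel] at h3
        nlinarith
    refine hnorm.trans ?_
    rw [div_mul_eq_mul_div, le_div_iff₀ hlam, mul_assoc, mul_comm P]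
    gcongr

/-- The constraint of the debiasing program in terms of `w = X θ`. -/
def debiasConstraint (X : Fin n → Fin p → ℝ) (μ : ℝ) (j : Fin p) : Set (Fin n → ℝ) :=
  {w | ∀ i, |((1 / (n : ℝ)) • ((Matrix.of X)ᵀ *ᵥ w)) i - (Pi.single j 1 : Fin p → ℝ) i| ≤ μ}

/-- The vector `X θ` for the solutions `θ` of the debiasing program. -/
noncomputable def debiasDirection (X : Fin n → Fin p → ℝ) (μ : ℝ) (j : Fin p) : Fin n → ℝ :=
  minNorm (debiasConstraint X μ j)

lemma isClosed_debiasConstraint_graph (μ : ℝ) (j : Fin p) :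
    IsClosed {q : (Fin n → Fin p → ℝ) × (Fin n → ℝ) | q.2 ∈ debiasConstraint q.1 μ j} := by
  have hset : {q : (Fin n → Fin p → ℝ) × (Fin n → ℝ) | q.2 ∈ debiasConstraint q.1 μ j} =
      ⋂ i, {q | |1 / (n : ℝ) * ∑ o, q.1 o i * q.2 o - (Pi.single j 1 : Fin p → ℝ) i| ≤ μ} := by
    ext q
    simp only [Set.mem_iInter]
    rfl
  rw [hset]
  exact isClosed_iInter fun i => isClosed_le (by fun_prop) continuous_const

lemma isClosed_debiasConstraint (X : Fin n → Fin p → ℝ) (μ : ℝ) (j : Fin p) :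
    IsClosed (debiasConstraint X μ j) :=
  (isClosed_debiasConstraint_graph μ j).preimage (f := fun w => (X, w)) (by fun_prop)

lemma convex_debiasConstraint (X : Fin n → Fin p → ℝ) (μ : ℝ) (j : Fin p) :
    Convex ℝ (debiasConstraint X μ j) := by
  intro v hv w hw a b ha hb hab i
  have e1 : ((1 / (n : ℝ)) • ((Matrix.of X)ᵀ *ᵥ (a • v + b • w))) i
      - (Pi.single j 1 : Fin p → ℝ) i =
      a * (((1 / (n : ℝ)) • ((Matrix.of X)ᵀ *ᵥ v)) i - (Pi.single j 1 : Fin p → ℝ) i)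
      + b * (((1 / (n : ℝ)) • ((Matrix.of X)ᵀ *ᵥ w)) i - (Pi.single j 1 : Fin p → ℝ) i) := by
    rw [Matrix.mulVec_add, Matrix.mulVec_smul, Matrix.mulVec_smul]
    simp only [Pi.smul_apply, Pi.add_apply, smul_eq_mul]
    linear_combination (Pi.single j 1 : Fin p → ℝ) i * hab
  rw [e1]
  refine (abs_add_le _ _).trans ?_
  rw [abs_mul, abs_mul, abs_of_nonneg ha, abs_of_nonneg hb]
  calc _ ≤ a * μ + b * μ := by gcongr; exacts [hv i, hw i]
    _ = μ := by rw [← add_mul, hab, one_mul]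

lemma measurable_debiasDirection (μ : ℝ) (j : Fin p) :
    Measurable fun X : Fin n → Fin p → ℝ => debiasDirection X μ j :=
  measurable_minNorm (isClosed_debiasConstraint_graph μ j) fun X => convex_debiasConstraint X μ j

lemma mem_debiasFeasible_iff (X : Matrix (Fin n) (Fin p) ℝ) (μ : ℝ) (j : Fin p) (θ : Fin p → ℝ) :
    θ ∈ debiasFeasible X μ j ↔ X *ᵥ θ ∈ debiasConstraint X μ j := by
  simp only [debiasFeasible, debiasConstraint, Set.mem_ofPred_eq, gram_mulVec]
  rfl

/-- `Xᵀ * X` and `Xᵀ` have equal rank, hence equal range. -/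
lemma exists_normal_equations (X : Matrix (Fin n) (Fin p) ℝ) (w : Fin n → ℝ) :
    ∃ θ : Fin p → ℝ, Xᵀ *ᵥ (X *ᵥ θ) = Xᵀ *ᵥ w := by
  have hle : LinearMap.range (Xᵀ * X).mulVecLin ≤ LinearMap.range Xᵀ.mulVecLin := by
    rintro _ ⟨θ, rfl⟩
    exact ⟨X *ᵥ θ, Matrix.mulVec_mulVec θ Xᵀ X⟩
  have heq := Submodule.eq_of_le_of_finrank_eq hle
    ((Matrix.rank_transpose_mul_self X).trans (Matrix.rank_transpose X).symm)
  have : Xᵀ.mulVecLin w ∈ LinearMap.range (Xᵀ * X).mulVecLin := by rw [heq]; exact ⟨w, rfl⟩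
  obtain ⟨θ, hθ⟩ := this
  exact ⟨θ, (Matrix.mulVec_mulVec _ _ _).trans hθ⟩

/-- The constraint depends on `w` only through `Xᵀ *ᵥ w`. Projecting the shortest feasible `w` onto
the range of `X` keeps it feasible and does not lengthen it, so by uniqueness it already lay in the
range. -/
lemma exists_debias_row (X : Matrix (Fin n) (Fin p) ℝ) {μ : ℝ} {j : Fin p}
    (hne : (debiasFeasible X μ j).Nonempty) :
    ∃ θ ∈ debiasFeasible X μ j, X *ᵥ θ = debiasDirection X μ j := by
  obtain ⟨θ0, hθ0⟩ := hne
  have hcl := isClosed_debiasConstraint X μ j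
  obtain ⟨hm, hmin⟩ := minNorm_spec hcl ⟨_, (mem_debiasFeasible_iff X μ j θ0).1 hθ0⟩
  set v := minNorm (debiasConstraint X μ j) with hv
  obtain ⟨θ, hθ⟩ := exists_normal_equations X v
  have hmem : X *ᵥ θ ∈ debiasConstraint X μ j := by
    intro i
    have := hm i
    change |((1 / (n : ℝ)) • (Xᵀ *ᵥ (X *ᵥ θ))) i - _| ≤ μ
    rw [hθ]; exact this
  refine ⟨θ, (mem_debiasFeasible_iff X μ j θ).2 hmem, ?_⟩
  refine isMinOn_sqNorm_unique (convex_debiasConstraint X μ j) hm hmem hmin ?_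
  have h1 : (X *ᵥ θ) ⬝ᵥ (v - X *ᵥ θ) = 0 := by
    rw [← dotProduct_transpose_mulVec, Matrix.mulVec_sub, hθ, sub_self, dotProduct_zero]
  have h2 := sqNorm_add (X *ᵥ θ) (v - X *ᵥ θ)
  rw [h1, add_sub_cancel] at h2
  have h3 := sqNorm_nonneg (v - X *ᵥ θ)
  change sqNorm (X *ᵥ θ) ≤ sqNorm v
  linarith

lemma exists_isDebiasMatrix (X : Matrix (Fin n) (Fin p) ℝ) {μ : ℝ}
    (hne : ∀ j, (debiasFeasible X μ j).Nonempty) : ∃ Th, IsDebiasMatrix X μ Th := by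
  choose Th hTh hdir using fun j => exists_debias_row X (hne j)
  refine ⟨Matrix.of Th, fun j => ⟨hTh j, fun θ hθ => ?_⟩⟩
  have h := (mem_debiasFeasible_iff X μ j θ).1 hθ
  have h2 := (minNorm_spec (isClosed_debiasConstraint X μ j) ⟨_, h⟩).2 h
  change Th j ⬝ᵥ (gram X *ᵥ Th j) ≤ θ ⬝ᵥ (gram X *ᵥ θ)
  rw [gram_quadForm, gram_quadForm, hdir j]
  exact mul_le_mul_of_nonneg_left h2 (by positivity)

/-- This makes the noise of the debiased estimator independent of the choice among minimizing
matrices, and a function of the design alone apart from `e`. -/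
lemma IsDebiasMatrix.mulVec_eq {X : Matrix (Fin n) (Fin p) ℝ} {μ : ℝ}
    {Th : Matrix (Fin p) (Fin p) ℝ} (h : IsDebiasMatrix X μ Th) (hn : 0 < n) (j : Fin p) :
    X *ᵥ Th j = debiasDirection X μ j := by
  obtain ⟨hf, hmin⟩ := h j
  obtain ⟨θ, hθ, hdir⟩ := exists_debias_row X ⟨_, hf⟩
  have hc := (mem_debiasFeasible_iff X μ j (Th j)).1 hf
  obtain ⟨hm, hmm⟩ := minNorm_spec (isClosed_debiasConstraint X μ j) ⟨_, hc⟩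
  refine isMinOn_sqNorm_unique (convex_debiasConstraint X μ j) hm hc hmm ?_
  have h1 := hmin hθ
  simp only [Set.mem_ofPred_eq, gram_quadForm] at h1
  have hn' : (0 : ℝ) < 1 / n := by positivity
  have := le_of_mul_le_mul_left h1 hn'
  rwa [hdir] at this

lemma sqNorm_debiasDirection_le {X : Matrix (Fin n) (Fin p) ℝ} {μ c : ℝ} {j : Fin p}
    {θ : Fin p → ℝ} (hθ : θ ∈ debiasFeasible X μ j) (hc : θ ⬝ᵥ (gram X *ᵥ θ) ≤ c)
    (hn : 0 < n) : sqNorm (debiasDirection X μ j) ≤ n * c := by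
  have h := (mem_debiasFeasible_iff X μ j θ).1 hθ
  have h2 := (minNorm_spec (isClosed_debiasConstraint X μ j) ⟨_, h⟩).2 h
  simp only [Set.mem_ofPred_eq] at h2
  rw [gram_quadForm, one_div, ← div_eq_inv_mul, div_le_iff₀ (by positivity)] at hc
  change sqNorm (minNorm _) ≤ _
  linarith

end Existence

end TransFusion

namespace TransFusion

/-! ## Clipping -/

/-- Clipping to the interval `[-t, t]`. -/
def clip (t x : ℝ) : ℝ := max (-t) (min x t)

lemma abs_clip_le {t : ℝ} (ht : 0 ≤ t) (x : ℝ) : |clip t x| ≤ t :=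
  abs_le.2 ⟨le_max_left _ _, max_le (by linarith) (min_le_right _ _)⟩

lemma clip_of_abs_le {t x : ℝ} (h : |x| ≤ t) : clip t x = x := by
  rw [clip, min_eq_left (abs_le.1 h).2, max_eq_right (abs_le.1 h).1]

/-- Where the excess is nonzero, the clipped value is `t` with the sign of the excess. Thus the
clipped noise is a subgradient of `t * l1` at the excess. -/
lemma clip_mul_sub {t : ℝ} (ht : 0 ≤ t) (x : ℝ) :
    clip t x * (x - clip t x) = t * |x - clip t x| := by
  unfold clip
  rcases le_total x t with h | h
  · rw [min_eq_left h]
    rcases le_total (-t) x with h2 | h2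
    · rw [max_eq_right h2]; simp
    · rw [max_eq_left h2, abs_of_nonpos (by linarith)]; ring
  · rw [min_eq_right h, max_eq_right (by linarith), abs_of_nonneg (by linarith)]

lemma clip_neg {t : ℝ} (ht : 0 ≤ t) (x : ℝ) : clip t (-x) = -clip t x := by
  unfold clip
  rcases le_total x t with h | h <;> rcases le_total (-t) x with h2 | h2
  · rw [min_eq_left h, max_eq_right h2, min_eq_left (by linarith), max_eq_right (by linarith)]
  · rw [min_eq_left h, max_eq_left h2, min_eq_right (by linarith), max_eq_right (by linarith)]
    ring
  · rw [min_eq_right h, min_eq_left (show -x ≤ t by linarith),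
      max_eq_left (show -x ≤ -t by linarith), max_eq_right (show -t ≤ t by linarith)]
  · have hx : x = 0 := by linarith
    have ht' : t = 0 := by linarith
    simp [hx, ht']

lemma abs_clip_le_abs {t : ℝ} (ht : 0 ≤ t) (x : ℝ) : |clip t x| ≤ |x| := by
  by_cases h : |x| ≤ t
  · rw [clip_of_abs_le h]
  · exact (abs_clip_le ht x).trans (not_le.1 h).le

lemma measurable_clip (t : ℝ) : Measurable (clip t) := by
  unfold clip; fun_prop

lemma abs_sub_clip {t : ℝ} (ht : 0 ≤ t) (x : ℝ) : |x - clip t x| = max (|x| - t) 0 := by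
  by_cases h : |x| ≤ t
  · rw [clip_of_abs_le h, sub_self, abs_zero, max_eq_right (by linarith)]
  · push Not at h
    rw [max_eq_left (by linarith)]
    unfold clip
    rcases lt_abs.1 h with h1 | h1
    · rw [min_eq_right h1.le, max_eq_right (by linarith), abs_of_pos (by linarith),
        abs_of_pos (by linarith)]
    · rw [min_eq_left (by linarith), max_eq_left (by linarith), abs_of_neg (by linarith),
        abs_of_neg (by linarith)]
      ring

/-! ## The aggregation step -/

section Aggregation

variable {p K nS nT : ℕ}

/-- One source's share of the basic inequality. With `q` the clipped noise and `ζ` the excess,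
moving the comparison point by `ζ` costs a penalty `α * l1 ζ`, which equals the gain `ω * (q ⬝ᵥ ζ)`
because `α = ω * t`. What remains of the noise is `q`, tested against `u` and `η`; its product with
`d` is paid by a second copy of `α * l1 d`. -/
lemma quadratic_bound {ω α t : ℝ} (hα : ω * t = α) (hω : 0 ≤ ω) (ht : 0 ≤ t)
    (u η d z : Fin p → ℝ) :
    ω / 2 * sqNorm (fun j => clip t (z j)) + α * l1 (d + fun j => z j - clip t (z j))
      + (ω / 2 * sqNorm (u + η - d - fun j => z j - clip t (z j)) + (α * l1 η
        - ω * ((fun j => clip t (z j)) ⬝ᵥ η)))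
      ≤ ω / 2 * sqNorm (d + z - u - η) + α * l1 η + ω * ((fun j => clip t (z j)) ⬝ᵥ u)
        + 2 * (α * l1 d) := by
  set q : Fin p → ℝ := fun j => clip t (z j) with hq
  set ζ : Fin p → ℝ := fun j => z j - clip t (z j) with hζ
  have hz : z = q + ζ := by funext j; simp [hq, hζ]
  have e1 : d + z - u - η = q - (u + η - d - ζ) := by rw [hz]; abel
  have h1 : q ⬝ᵥ ζ = t * l1 ζ := by
    simp only [dotProduct, l1, Finset.mul_sum, hq, hζ]
    exact Finset.sum_congr rfl fun j _ => clip_mul_sub ht _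
  have h2 : |q ⬝ᵥ d| ≤ t * l1 d := abs_dotProduct_le _ _ fun j => abs_clip_le ht _
  have h3 : ω * (-(q ⬝ᵥ d)) ≤ α * l1 d := by
    rw [← hα, mul_assoc]
    exact mul_le_mul_of_nonneg_left (by linarith [(abs_le.1 h2).1]) hω
  have h4 : α * l1 (d + ζ) ≤ α * (l1 d + l1 ζ) :=
    mul_le_mul_of_nonneg_left (l1_add_le _ _) (by rw [← hα]; positivity)
  have h5 : ω * (q ⬝ᵥ ζ) = α * l1 ζ := by rw [h1, ← hα]; ring
  rw [e1, sqNorm_sub q]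
  have e2 : q ⬝ᵥ (u + η - d - ζ) = q ⬝ᵥ u + q ⬝ᵥ η - q ⬝ᵥ d - q ⬝ᵥ ζ := by
    rw [dotProduct_sub, dotProduct_sub, dotProduct_add]
  rw [e2]
  linarith

/-- Basic inequality for the fused least squares estimator: comparison of the minimizer with the
vector whose source components absorb the part of the noise that exceeds the penalty. -/
lemma agg_basic_inequality {X0 : Matrix (Fin nT) (Fin p) ℝ} {e0 : Fin nT → ℝ} {lam : ℝ}
    {a : Fin K → ℝ} (hlam : 0 < lam) (ha : ∀ k, 0 ≤ a k) {β0 : Fin p → ℝ}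
    {d z : Fin K → Fin p → ℝ} {b : Fin (K + 1) → Fin p → ℝ}
    (hb : IsMinOn (aggObjective (nS := nS) (fun k => β0 + d k + z k) X0 (X0 *ᵥ β0 + e0) lam a)
      Set.univ b) (hn : 0 < nS) (hK : 1 ≤ K) :
    let ω : ℝ := nS / totalSize K nS nT
    let t : Fin K → ℝ := fun k => a k * lam / ω
    let u := b 0 - β0
    ω / 2 * ∑ k, sqNorm (b k.succ - β0 - d k - fun j => z k j - clip (t k) (z k j))
      + 1 / (2 * totalSize K nS nT) * sqNorm (X0 *ᵥ u)
      + ∑ k, (a k * lam * l1 (b k.succ - b 0)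
          - ω * ((fun j => clip (t k) (z k j)) ⬝ᵥ (b k.succ - b 0)))
      ≤ (fun j => ω * ∑ k, clip (t k) (z k j)
          + 1 / totalSize K nS nT * (X0ᵀ *ᵥ e0) j) ⬝ᵥ u
        + lam * (l1 β0 - l1 (b 0)) + 2 * ∑ k, a k * lam * l1 (d k) := by
  intro ω t u
  have hN : 0 < totalSize K nS nT := by
    unfold totalSize
    have : (0 : ℝ) < K * nS := by positivity
    positivity
  have hω : 0 < ω := by positivity
  set N := totalSize K nS nT with hNdef
  have h1 := hb (Set.mem_univ (Fin.cons β0 fun k => β0 + d k + fun j => z k j - clip (t k) (z k j)))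
  simp only [Set.mem_ofPred_eq, aggObjective, Fin.cons_zero, Fin.cons_succ] at h1
  have hsq : ∀ v : Fin p → ℝ, sqNorm (√(nS : ℝ) • v) = nS * sqNorm v := fun v => by
    rw [sqNorm_smul, Real.sq_sqrt (Nat.cast_nonneg _)]
  simp only [hsq, ← Finset.mul_sum, ← hNdef] at h1
  have e0' : 1 / (2 * N) * (nS * 0 : ℝ) = 0 := by simp
  have eω : ∀ x : ℝ, 1 / (2 * N) * (nS * x) = ω / 2 * x := fun x => by
    simp only [ω, ← hNdef]; field_simp
  rw [eω, eω] at h1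
  have e1 : X0 *ᵥ β0 + e0 - X0 *ᵥ b 0 = e0 - X0 *ᵥ u := by
    simp only [u, Matrix.mulVec_sub]; abel
  have e2 : X0 *ᵥ β0 + e0 - X0 *ᵥ β0 = e0 := by abel
  rw [e1, e2, sqNorm_sub e0] at h1
  have e3 : e0 ⬝ᵥ (X0 *ᵥ u) = (X0ᵀ *ᵥ e0) ⬝ᵥ u := by
    rw [dotProduct_comm, ← dotProduct_transpose_mulVec, dotProduct_comm]
  rw [e3] at h1
  have key : ∀ k, _ := fun k => quadratic_bound (ω := ω) (α := a k * lam) (t := t k)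
    (by simp only [t]; field_simp) hω.le
    (by have := ha k; simp only [t]; positivity) u (b k.succ - b 0) (d k) (z k)
  have hsum := Finset.sum_le_sum fun k (_ : k ∈ Finset.univ) => key k
  simp only [Finset.sum_add_distrib, ← Finset.mul_sum] at hsum
  have e4 : ∀ k, u + (b k.succ - b 0) - d k - (fun j => z k j - clip (t k) (z k j)) =
      b k.succ - β0 - d k - fun j => z k j - clip (t k) (z k j) := fun k => by
    simp only [u]; abel
  have e5 : ∀ k, d k + z k - u - (b k.succ - b 0) = β0 + d k + z k - b k.succ := fun k => by
    simp only [u]; abel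
  have e6 : ∀ k, β0 + d k + z k - (β0 + d k + fun j => z k j - clip (t k) (z k j)) =
      fun j => clip (t k) (z k j) := fun k => by
    funext j; simp only [Pi.add_apply, Pi.sub_apply]; ring
  have e7 : ∀ k, (β0 + d k + fun j => z k j - clip (t k) (z k j)) - β0 =
      d k + fun j => z k j - clip (t k) (z k j) := fun k => by abel
  have e8 : (fun j => ω * ∑ k, clip (t k) (z k j) + 1 / N * (X0ᵀ *ᵥ e0) j) ⬝ᵥ u =
      ω * ∑ k, (fun j => clip (t k) (z k j)) ⬝ᵥ u + 1 / N * ((X0ᵀ *ᵥ e0) ⬝ᵥ u) := by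
    simp only [dotProduct, add_mul, Finset.sum_add_distrib]
    congr 1
    · rw [Finset.sum_comm, Finset.mul_sum]
      refine Finset.sum_congr rfl fun j _ => ?_
      rw [mul_assoc, Finset.sum_mul]
    · rw [Finset.mul_sum]
      exact Finset.sum_congr rfl fun j _ => by ring
  simp only [e4, e5] at hsum
  simp only [e6, e7] at h1
  have e9 : ∀ f : Fin K → ℝ, lam * ∑ k, a k * f k = ∑ k, a k * lam * f k := fun f => by
    rw [Finset.mul_sum]; exact Finset.sum_congr rfl fun k _ => by ring
  rw [mul_add lam, mul_add lam, e9, e9] at h1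
  rw [e8]
  have e10 : 1 / (2 * N) * (sqNorm e0 - 2 * ((X0ᵀ *ᵥ e0) ⬝ᵥ u) + sqNorm (X0 *ᵥ u)) =
      1 / (2 * N) * sqNorm e0 - 1 / N * ((X0ᵀ *ᵥ e0) ⬝ᵥ u) + 1 / (2 * N) * sqNorm (X0 *ᵥ u) := by
    field_simp
  rw [e10] at h1
  linarith

/-- From the basic inequality to a bound on the quadratic form and the `ℓ₁` error. -/
lemma fused_cone_bound {s : ℕ} {S : Finset (Fin p)} (hS : S.card ≤ s) {u : Fin p → ℝ}
    {D η d : Fin K → Fin p → ℝ} {α : Fin K → ℝ} {good : Finset (Fin K)}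
    {ω τ lam ρ QX R : ℝ} (hK : 1 ≤ K) (hω : 0 ≤ ω) (hτ : 0 ≤ τ)
    (hsum : K * ω + τ = 1) (hlam : 0 < lam)
    (hα : ∀ k, 0 < α k) (hρ : ∀ k j, α k ≤ ρ * α j) (hρ1 : 1 ≤ ρ)
    (hαsum : 8 * lam * (1 - τ) ≤ ∑ k, α k)
    (hbad : 2 * ρ * (goodᶜ.card : ℝ) ≤ K)
    (hu : ∀ k ∈ good, u = D k - η k + d k)
    (hR : 2 * ∑ k, α k * l1 (d k) ≤ R)
    (hbasic : 1 / 2 * (ω * ∑ k, sqNorm (D k) + QX) + 1 / 2 * ∑ k ∈ good, α k * l1 (η k)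
      ≤ lam / 2 * l1 u + lam * (2 * (∑ j ∈ S, |u j|) - l1 u) + R) :
    1 / 2 * (ω * ∑ k, sqNorm (D k) + QX) + lam / 2 * l1 u ≤
      2 * lam * √(s * (2 * ρ * (ω * ∑ k, sqNorm (D k) + τ * sqNorm u))) + 2 * R := by
  classical
  have hK0 : (0 : ℝ) < K := by exact_mod_cast hK
  have hsplit := Finset.sum_add_sum_compl good α
  -- Every `α k` is at most `ρ / K` times the total, so the few sources outside `good` carry at most
  -- half of the total penalty weight.
  have hbadsum : 2 * ∑ k ∈ goodᶜ, α k ≤ ∑ k, α k := by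
    have h1 : ∀ k, K * α k ≤ ρ * ∑ j, α j := fun k => by
      have := Finset.sum_le_sum fun j (_ : j ∈ Finset.univ) => hρ k j
      simpa [Finset.mul_sum] using this
    have h2 := Finset.sum_le_sum fun k (_ : k ∈ goodᶜ) => h1 k
    rw [← Finset.mul_sum, Finset.sum_const, nsmul_eq_mul] at h2
    have h3 : 0 ≤ ∑ k, α k := Finset.sum_nonneg fun k _ => (hα k).le
    have h4 : K * (2 * ∑ k ∈ goodᶜ, α k) ≤ K * ∑ k, α k := by nlinarith
    exact le_of_mul_le_mul_left h4 hK0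
  set A := ∑ k ∈ good, α k with hA
  have hA1 : ∑ k, α k ≤ 2 * A := by linarith
  have hApos : 0 < A := by
    have : 0 < ∑ k, α k := Finset.sum_pos (fun k _ => hα k) ⟨⟨0, hK⟩, Finset.mem_univ _⟩
    linarith
  have hτ1 : 1 - τ = K * ω := by linarith
  -- Averaging weights on the good sources, proportional to `α` and of total mass `1 - τ`. They
  -- serve two purposes: `hwα` lets the fusion penalties absorb `w k * l1 (η k)`, and `hwω` compares
  -- the weights with `ω`, so that the average is controlled by the quadratic form.
  set w : Fin K → ℝ := fun k => if k ∈ good then (1 - τ) * α k / A else 0 with hw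
  have hw0 : ∀ k, 0 ≤ w k := fun k => by
    simp only [hw]; split_ifs
    · have := (hα k).le; rw [hτ1]; positivity
    · exact le_rfl
  have hwsum : ∑ k, w k = 1 - τ := by
    simp only [hw, Finset.sum_ite_mem, Finset.univ_inter]
    rw [← Finset.sum_div, ← Finset.mul_sum, ← hA]; field_simp
  have hwα : ∀ k, 4 * lam * w k ≤ if k ∈ good then α k else 0 := fun k => by
    simp only [hw]; split_ifs
    · rw [← mul_div_assoc, div_le_iff₀ hApos]
      nlinarith [hα k]
    · simp
  have hwω : ∀ k, w k ≤ 2 * ρ * ω := fun k => by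
    simp only [hw]; split_ifs
    · rw [div_le_iff₀ hApos, hτ1]
      have h1 : K * α k ≤ ρ * ∑ j, α j := by
        have := Finset.sum_le_sum fun j (_ : j ∈ Finset.univ) => hρ k j
        simpa [Finset.mul_sum] using this
      have h2 : ρ * ∑ j, α j ≤ ρ * (2 * A) := by gcongr
      nlinarith
    · positivity
  set W : Fin p → ℝ := ∑ k, w k • D k + τ • u with hW
  have hQ0 : ∀ k, 0 ≤ sqNorm (D k) := fun k => sqNorm_nonneg _
  have hu0 := sqNorm_nonneg u
  set Q := ω * ∑ k, sqNorm (D k) + τ * sqNorm u with hQ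
  have hQnn : 0 ≤ Q := by
    have := Finset.sum_nonneg fun k (_ : k ∈ Finset.univ) => hQ0 k; positivity
  have hWQ : sqNorm W ≤ 2 * ρ * Q := by
    have h1 := sqNorm_weighted_sum_le (Finset.univ : Finset (Fin (K + 1)))
      (Fin.cons τ w : Fin (K + 1) → ℝ) (fun k _ => by
        refine Fin.cases ?_ (fun k => ?_) k
        · simpa using hτ
        · simpa using hw0 k) (Fin.cons u D : Fin (K + 1) → Fin p → ℝ)
    simp only [Fin.sum_univ_succ, Fin.cons_zero, Fin.cons_succ, hwsum] at h1
    rw [add_comm, ← hW] at h1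
    refine h1.trans ?_
    have h2 : ∑ k, w k * sqNorm (D k) ≤ ∑ k, 2 * ρ * ω * sqNorm (D k) :=
      Finset.sum_le_sum fun k _ => mul_le_mul_of_nonneg_right (hwω k) (hQ0 k)
    rw [← Finset.mul_sum] at h2
    have h3 : τ * sqNorm u ≤ 2 * ρ * (τ * sqNorm u) := by
      have := mul_nonneg hτ hu0; nlinarith
    rw [hQ]
    nlinarith
  -- The weights in `W` sum to `(1 - τ) + τ = 1`, so `u` differs from `W` only by fused differences
  -- and contrasts.
  have hu_eq : u = W - ∑ k, w k • (η k - d k) := by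
    have h1 : ∀ k, w k • (η k - d k) = w k • D k - w k • u := fun k => by
      by_cases hk : k ∈ good
      · rw [← smul_sub]
        congr 1
        have := hu k hk
        rw [this]; abel
      · simp [hw, hk]
    rw [Finset.sum_congr rfl fun k _ => h1 k, Finset.sum_sub_distrib, ← Finset.sum_smul, hwsum, hW,
      sub_smul, one_smul]
    abel
  have huS : ∑ j ∈ S, |u j| ≤ √(s * (2 * ρ * Q)) + ∑ k, w k * (l1 (η k) + l1 (d k)) := by
    have h1 : ∀ j, |u j| ≤ |W j| + |(∑ k, w k • (η k - d k)) j| := fun j => by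
      have := congrFun hu_eq j
      rw [this]; exact abs_sub _ _
    have h2 := Finset.sum_le_sum fun j (_ : j ∈ S) => h1 j
    rw [Finset.sum_add_distrib] at h2
    have h3 : ∑ j ∈ S, |W j| ≤ √(s * (2 * ρ * Q)) :=
      (sum_abs_le S hS W).trans (Real.sqrt_le_sqrt (by gcongr))
    have h4 : ∑ j ∈ S, |(∑ k, w k • (η k - d k)) j| ≤ l1 (∑ k, w k • (η k - d k)) :=
      Finset.sum_le_sum_of_subset_of_nonneg (Finset.subset_univ _) fun _ _ _ => abs_nonneg _
    have h5 : l1 (∑ k, w k • (η k - d k)) ≤ ∑ k, w k * (l1 (η k) + l1 (d k)) := by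
      refine (l1_sum_le _ _).trans (Finset.sum_le_sum fun k _ => ?_)
      rw [l1_smul, abs_of_nonneg (hw0 k)]
      exact mul_le_mul_of_nonneg_left (l1_sub_le _ _) (hw0 k)
    linarith
  set r := √(s * (2 * ρ * Q)) with hr
  have hr0 : 0 ≤ r := Real.sqrt_nonneg _
  have hr2 : r ^ 2 = s * (2 * ρ * Q) := Real.sq_sqrt (by positivity)
  have hwl : 4 * lam * ∑ k, w k * (l1 (η k) + l1 (d k)) ≤
      ∑ k ∈ good, α k * l1 (η k) + ∑ k, α k * l1 (d k) := by
    have h1 : ∀ k, 4 * lam * (w k * (l1 (η k) + l1 (d k))) ≤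
        (if k ∈ good then α k * l1 (η k) else 0) + α k * l1 (d k) := fun k => by
      have h2 := mul_le_mul_of_nonneg_right (hwα k)
        (add_nonneg (l1_nonneg (η k)) (l1_nonneg (d k)))
      have h3 := mul_nonneg (hα k).le (l1_nonneg (d k))
      split_ifs at h2 ⊢ <;> nlinarith
    have h2 := Finset.sum_le_sum fun k (_ : k ∈ Finset.univ) => h1 k
    simpa [Finset.mul_sum, Finset.sum_add_distrib, Finset.sum_ite_mem] using h2
  have h1 := mul_le_mul_of_nonneg_left huS (by positivity : 0 ≤ 2 * lam)
  have h2 : 0 ≤ ∑ k, α k * l1 (d k) :=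
    Finset.sum_nonneg fun k _ => mul_nonneg (hα k).le (l1_nonneg _)
  linarith

/-- From a bound on the quadratic form and the `ℓ₁` error to a bound on the `ℓ₂` error. -/
lemma quadratic_error_bound {s : ℕ} {lam ρ c E CR Q Qn l R : ℝ} (hlam : 0 < lam) (hc : 0 < c)
    (hE : 0 ≤ E) (hQnn : 0 ≤ Q) (hneg : 0 ≤ Qn) (hl : 0 ≤ l) (hR0 : 0 ≤ R) (hρ1 : 1 ≤ ρ)
    (hmain : 1 / 2 * Qn + lam / 2 * l ≤ 2 * lam * √(s * (2 * ρ * Q)) + 2 * R)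
    (hQn : c * Q - E * l ^ 2 ≤ Qn)
    (hEs : 256 * (E * s * ρ) ≤ c) (hER : E * R ≤ CR * lam ^ 2) :
    Q ≤ 64 * (s * ρ * lam ^ 2) / c ^ 2 + (8 + 64 * CR) * R / c := by
  set r := √(s * (2 * ρ * Q)) with hr
  have hr0 : 0 ≤ r := Real.sqrt_nonneg _
  have hr2 : r ^ 2 = s * (2 * ρ * Q) := Real.sq_sqrt (by positivity)
  have hl1 : l ≤ 4 * r + 4 * (R / lam) := by
    have h1 : lam * l ≤ lam * (4 * r + 4 * (R / lam)) := by
      have : lam * (R / lam) = R := by field_simp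
      nlinarith
    exact le_of_mul_le_mul_left h1 hlam
  have hl2 : l ^ 2 ≤ 32 * r ^ 2 + 32 * (R / lam) ^ 2 := by
    have := pow_le_pow_left₀ (hl) hl1 2
    nlinarith [sq_nonneg (r - R / lam)]
  -- The part of the ℓ₁ error that comes from `R` is not controlled by the sparsity; `hER` turns its
  -- curvature loss into a multiple of `R`.
  have hER2 : E * (R / lam) ^ 2 ≤ CR * R := by
    have h1 : E * (R / lam) ^ 2 = E * R * (R / lam ^ 2) := by field_simp
    have h2 : CR * R = CR * lam ^ 2 * (R / lam ^ 2) := by field_simp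
    rw [h1, h2]
    exact mul_le_mul_of_nonneg_right hER (by positivity)
  have hEl : E * l ^ 2 ≤ c / 4 * Q + 32 * (CR * R) := by
    have h1 := mul_le_mul_of_nonneg_left hl2 hE
    have h2 : E * (32 * r ^ 2) ≤ c / 4 * Q := by
      rw [hr2]
      have := mul_le_mul_of_nonneg_right hEs hQnn
      nlinarith
    nlinarith
  have hcross : 4 * lam * r ≤ c / 4 * Q + 32 * (s * ρ * lam ^ 2) / c := by
    have h1 : r ≤ √(2 * (s * ρ)) * √Q := by
      rw [hr, ← Real.sqrt_mul (by positivity)]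
      exact Real.sqrt_le_sqrt (by linarith)
    set x := √(2 * (s * ρ))
    have hx : x ^ 2 = 2 * (s * ρ) := Real.sq_sqrt (by positivity)
    set y := √Q
    have hy : y ^ 2 = Q := Real.sq_sqrt hQnn
    have h2 : 32 * (s * ρ * lam ^ 2) / c = (4 * lam * x) ^ 2 / c := by
      rw [mul_pow, hx]; ring
    rw [h2, ← hy]
    have h3 : 4 * lam * r ≤ (4 * lam * x) * y := by
      rw [mul_assoc (4 * lam)]; exact mul_le_mul_of_nonneg_left h1 (by positivity)
    refine h3.trans ?_
    set m := 4 * lam * x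
    have h4 : c / 4 * y ^ 2 + m ^ 2 / c - m * y = (c / 2 * y - m) ^ 2 / c := by
      field_simp; ring
    have h5 : 0 ≤ (c / 2 * y - m) ^ 2 / c := by positivity
    linarith
  have hfin : c / 2 * Q ≤ 32 * (s * ρ * lam ^ 2) / c + (4 + 32 * CR) * R := by
    have h1 : 0 ≤ lam / 2 * l := by positivity
    linarith
  have h6 : Q ≤ (32 * (s * ρ * lam ^ 2) / c + (4 + 32 * CR) * R) * (2 / c) := by
    rw [← div_le_iff₀ (by positivity), div_div_eq_mul_div]
    linarith
  refine h6.trans (le_of_eq ?_)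
  field_simp
  ring

/-- Error bound for the aggregated estimator. The sources outside `good` may have arbitrarily
large noise `z k`. -/
lemma agg_error {X0 : Matrix (Fin nT) (Fin p) ℝ} {e0 : Fin nT → ℝ} {lam ρ c E CR : ℝ} {s : ℕ}
    {a : Fin K → ℝ} (hlam : 0 < lam) (ha : ∀ k, 0 < a k) {β0 : Fin p → ℝ}
    {d z : Fin K → Fin p → ℝ} {b : Fin (K + 1) → Fin p → ℝ} {good : Finset (Fin K)}
    (hb : IsMinOn (aggObjective (nS := nS) (fun k => β0 + d k + z k) X0 (X0 *ᵥ β0 + e0) lam a)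
      Set.univ b) (hn : 0 < nS) (hK : 1 ≤ K) (hs : l0 β0 ≤ s)
    {ω τ R : ℝ} (hωdef : ω = nS / totalSize K nS nT) (hτdef : τ = nT / totalSize K nS nT)
    (hRdef : R = 2 * ∑ k, a k * lam * l1 (d k))
    (hc : 0 < c) (hc1 : c ≤ 1) (hE : 0 ≤ E)
    (hρ : ∀ k j, a k ≤ ρ * a j) (hρ1 : 1 ≤ ρ)
    (hαsum : 8 * lam * (1 - τ) ≤ ∑ k, a k * lam)
    (hbad : 2 * ρ * (goodᶜ.card : ℝ) ≤ K)
    (hgood : ∀ k ∈ good, ∀ j, ω * |z k j| ≤ a k * lam / 2)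
    (hnoise : ∀ j, |ω * ∑ k, clip (a k * lam / ω) (z k j)
      + 1 / totalSize K nS nT * (X0ᵀ *ᵥ e0) j| ≤ lam / 2)
    (hRSC : ∀ u, c * (τ * sqNorm u) - E * l1 u ^ 2 ≤ 1 / totalSize K nS nT * sqNorm (X0 *ᵥ u))
    (hEs : 256 * (E * s * ρ) ≤ c) (hER : E * R ≤ CR * lam ^ 2) :
    sqNorm (ω • ∑ k : Fin K, b k.succ + τ • b 0 - β0) ≤
      3 * (64 * (s * ρ * lam ^ 2) / c ^ 2 + (8 + 64 * CR) * R / c + sqNorm (ω • ∑ k, d k)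
        + sqNorm (fun j => ω * ∑ k, (z k j - clip (a k * lam / ω) (z k j)))) := by
  obtain ⟨S, hS, hS0⟩ := exists_support β0 hs
  have hN : 0 < totalSize K nS nT := by
    unfold totalSize
    have : (0 : ℝ) < K * nS := by positivity
    positivity
  have hbasic := agg_basic_inequality hlam (fun k => (ha k).le) hb hn hK
  simp only [← hωdef] at hbasic
  have hω : 0 < ω := by rw [hωdef]; positivity
  have hτ : 0 ≤ τ := by rw [hτdef]; positivity
  have hsum : K * ω + τ = 1 := by
    rw [hωdef, hτdef, ← mul_div_assoc, ← add_div]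
    exact div_self hN.ne'
  set N := totalSize K nS nT
  set u := b 0 - β0 with hu
  set t : Fin K → ℝ := fun k => a k * lam / ω with ht
  have ht0 : ∀ k, 0 ≤ t k := fun k => by have := ha k; simp only [ht]; positivity
  have htω : ∀ k, ω * t k = a k * lam := fun k => by simp only [ht]; field_simp
  set D : Fin K → Fin p → ℝ := fun k =>
    b k.succ - β0 - d k - fun j => z k j - clip (t k) (z k j) with hD
  set η : Fin K → Fin p → ℝ := fun k => b k.succ - b 0 with hη
  have hzt : ∀ k ∈ good, ∀ j, |z k j| ≤ t k / 2 := fun k hk j => by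
    have := hgood k hk j
    rw [← htω k, mul_div_assoc] at this
    exact le_of_mul_le_mul_left this hω
  have hclip : ∀ k ∈ good, ∀ j, clip (t k) (z k j) = z k j := fun k hk j =>
    clip_of_abs_le ((hzt k hk j).trans (by linarith [ht0 k]))
  have hR0 : 0 ≤ R := by
    have : 0 ≤ ∑ k, a k * lam * l1 (d k) := Finset.sum_nonneg fun k _ =>
      mul_nonneg (mul_nonneg (ha k).le hlam.le) (l1_nonneg _)
    linarith
  -- The clipped noise never exceeds the penalty level, so no summand is negative; on good sources
  -- it is at most half that level, and half of the penalty survives.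
  have hgain : 1 / 2 * ∑ k ∈ good, a k * lam * l1 (η k) ≤
      ∑ k, (a k * lam * l1 (η k) - ω * ((fun j => clip (t k) (z k j)) ⬝ᵥ η k)) := by
    have hnn : ∀ k, 0 ≤ a k * lam * l1 (η k) - ω * ((fun j => clip (t k) (z k j)) ⬝ᵥ η k) := by
      intro k
      have h1 := abs_dotProduct_le (fun j => clip (t k) (z k j)) (η k)
        (fun j => abs_clip_le (ht0 k) _)
      have h2 := mul_le_mul_of_nonneg_left ((le_abs_self _).trans h1) hω.le
      rw [← mul_assoc, htω] at h2
      linarith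
    rw [Finset.mul_sum]
    refine (Finset.sum_le_sum fun k hk => ?_).trans
      (Finset.sum_le_sum_of_subset_of_nonneg (Finset.subset_univ good) fun k _ _ => hnn k)
    have h1 := abs_dotProduct_le (fun j => clip (t k) (z k j)) (η k) (c := t k / 2)
      (fun j => by rw [hclip k hk j]; exact hzt k hk j)
    have h2 := mul_le_mul_of_nonneg_left ((le_abs_self _).trans h1) hω.le
    have h3 : ω * (t k / 2 * l1 (η k)) = a k * lam * l1 (η k) / 2 := by rw [← htω]; ring
    linarith
  have hdot := (le_abs_self _).trans (abs_dotProduct_le _ u hnoise)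
  have hl1 := l1_sub_l1_le S β0 0 u hS0
  rw [add_zero, l1_zero, hu, show β0 + (b 0 - β0) = b 0 by abel, ← hu] at hl1
  have hl2 : lam * (l1 β0 - l1 (b 0)) ≤ lam * (2 * (∑ j ∈ S, |u j|) - l1 u) :=
    mul_le_mul_of_nonneg_left (by linarith) hlam.le
  have hQX : 0 ≤ 1 / N * sqNorm (X0 *ᵥ u) := by
    have := sqNorm_nonneg (X0 *ᵥ u); positivity
  have hDnn : 0 ≤ ∑ k, sqNorm (D k) := Finset.sum_nonneg fun k _ => sqNorm_nonneg _
  have hcone := fused_cone_bound (K := K) (u := u) (ω := ω) (τ := τ) (lam := lam) (ρ := ρ)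
      (η := η) (d := d)
    (α := fun k => a k * lam) (good := good) (QX := 1 / N * sqNorm (X0 *ᵥ u)) (R := R)
    (D := D) hS hK hω.le hτ hsum hlam
    (fun k => mul_pos (ha k) hlam) (fun k j => by
      have := mul_le_mul_of_nonneg_right (hρ k j) hlam.le; linarith) hρ1 hαsum hbad
    (fun k hk => by
      funext j
      simp only [hD, hη, hu, Pi.add_apply, Pi.sub_apply, hclip k hk j]; ring)
    hRdef.ge (by
      have e1 : 1 / (2 * N) * sqNorm (X0 *ᵥ u) = 1 / 2 * (1 / N * sqNorm (X0 *ᵥ u)) := by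
        rw [← mul_assoc, one_div_mul_one_div]
      rw [e1] at hbasic
      linarith)
  have hQ := quadratic_error_bound (Q := ω * ∑ k, sqNorm (D k) + τ * sqNorm u) hlam hc hE
    (by have := sqNorm_nonneg u; positivity) (by positivity) (l1_nonneg u) hR0 hρ1 hcone
    (by
      have h1 := hRSC u
      have h2 : 0 ≤ ω * ∑ k, sqNorm (D k) := by positivity
      nlinarith) hEs hER
  have hW : sqNorm (ω • ∑ k, D k + τ • u) ≤ ω * ∑ k, sqNorm (D k) + τ * sqNorm u := by
    have h1 := sqNorm_weighted_sum_le (Finset.univ : Finset (Fin (K + 1)))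
      (Fin.cons τ fun _ => ω : Fin (K + 1) → ℝ) (fun k _ => by
        refine Fin.cases ?_ (fun k => ?_) k
        · simpa using hτ
        · simpa using hω.le) (Fin.cons u D : Fin (K + 1) → Fin p → ℝ)
    simp only [Fin.sum_univ_succ, Fin.cons_zero, Fin.cons_succ, Finset.sum_const,
      Finset.card_univ, Fintype.card_fin, nsmul_eq_mul, ← Finset.smul_sum, ← Finset.mul_sum] at h1
    rw [add_comm τ, hsum, one_mul, add_comm (τ • u), add_comm (τ * _)] at h1
    exact h1
  -- The output error splits into the average distance to the comparison point, the average contrast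
  -- and the average excess noise.
  have heq : ω • ∑ k : Fin K, b k.succ + τ • b 0 - β0 = (ω • ∑ k, D k + τ • u)
      + ω • ∑ k, d k + fun j => ω * ∑ k, (z k j - clip (t k) (z k j)) := by
    funext j
    simp only [hD, hu, Pi.add_apply, Pi.sub_apply, Pi.smul_apply, smul_eq_mul, Finset.sum_apply,
      Finset.sum_sub_distrib, Finset.sum_const, Finset.card_univ, Fintype.card_fin, nsmul_eq_mul,
          Pi.mul_apply, Pi.natCast_apply]
    linear_combination (β0 j) * hsum
  rw [heq]
  refine (sqNorm_add_add_le _ _ _).trans ?_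
  linarith

end Aggregation

end TransFusion

namespace TransFusion

/-! ## Sub-Gaussian and sub-exponential random variables -/

section SubExponential

variable {Ω : Type*} [MeasurableSpace Ω]

lemma HasSubgaussianMGF.mono {P : Measure Ω} {X : Ω → ℝ} {c c' : ℝ≥0} (h : HasSubgaussianMGF X c P)
    (hc : c ≤ c') : HasSubgaussianMGF X c' P where
  integrable_exp_mul := h.integrable_exp_mul
  mgf_le t := (h.mgf_le t).trans (Real.exp_le_exp.2 (by gcongr))

variable {P : Measure Ω} [IsProbabilityMeasure P]

lemma measure_le_ofReal {S : Set Ω} {a : ℝ} (h : P.real S ≤ a) : P S ≤ ENNReal.ofReal a := by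
  rw [← ofReal_measureReal]; exact ENNReal.ofReal_le_ofReal h

lemma subgaussian_abs_tail {X : Ω → ℝ} {c : ℝ≥0} (h : HasSubgaussianMGF X c P) {V x : ℝ}
    (hV : (c : ℝ) ≤ V) (hx : 0 < x) :
    P {ω | √(2 * V * x) < |X ω|} ≤ ENNReal.ofReal (2 * Real.exp (-x)) := by
  -- For `c = 0` the Chernoff exponent divides by zero; the variable then vanishes almost surely.
  rcases eq_or_ne c 0 with rfl | hc
  · have h0 := HasSubgaussianMGF.ae_eq_zero_of_hasSubgaussianMGF_zero h
    have : P {ω | √(2 * V * x) < |X ω|} = 0 := by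
      refine measure_mono_null (t := {ω | ¬ X ω = 0}) (fun ω hω hX => ?_) (ae_iff.1 h0)
      simp only [Set.mem_ofPred_eq] at hω
      rw [hX, abs_zero] at hω
      exact absurd hω (not_lt.2 (Real.sqrt_nonneg _))
    rw [this]; exact zero_le
  have hc0 : (0 : ℝ) < c := by positivity
  have key : ∀ Y : Ω → ℝ, HasSubgaussianMGF Y c P →
      P.real {ω | √(2 * V * x) ≤ Y ω} ≤ Real.exp (-x) := fun Y hY => by
    refine (hY.measure_ge_le (Real.sqrt_nonneg _)).trans (Real.exp_le_exp.2 ?_)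
    rw [Real.sq_sqrt (by have := hc0.le.trans hV; positivity), div_le_iff₀ (by positivity)]
    nlinarith
  refine measure_le_ofReal ?_
  calc P.real {ω | √(2 * V * x) < |X ω|}
      ≤ P.real ({ω | √(2 * V * x) ≤ X ω} ∪ {ω | √(2 * V * x) ≤ (-X) ω}) := by
        refine measureReal_mono (fun ω hω => ?_)
        have hω' : √(2 * V * x) < |X ω| := hω
        rcases lt_abs.1 hω' with h1 | h1
        · exact Or.inl h1.le
        · exact Or.inr h1.le
    _ ≤ _ := measureReal_union_le _ _
    _ ≤ 2 * Real.exp (-x) := by linarith [key X h, key (-X) h.neg]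

/-- Uses `y ^ 2 / 2 ≤ exp y + exp (-y) - 2` at `y = X / √c` and `exp (1 / 2) ≤ 2`. -/
lemma subgaussian_sq_integral_le {X : Ω → ℝ} {c : ℝ≥0} (h : HasSubgaussianMGF X c P) :
    ∫⁻ ω, ENNReal.ofReal (X ω ^ 2) ∂P ≤ ENNReal.ofReal (4 * c) := by
  rcases eq_or_ne c 0 with rfl | hc
  · have h0 := HasSubgaussianMGF.ae_eq_zero_of_hasSubgaussianMGF_zero h
    rw [lintegral_congr_ae (g := fun _ => 0)]
    · simp
    · filter_upwards [h0] with ω hω; simp [hω]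
  have hc0 : (0 : ℝ) < c := by positivity
  set t : ℝ := 1 / √c with ht
  have ht2 : t ^ 2 = 1 / c := by rw [ht, div_pow, Real.sq_sqrt hc0.le, one_pow]
  have hpt : ∀ ω, X ω ^ 2 ≤ 2 * c * (Real.exp (t * X ω) + Real.exp (-t * X ω) - 2) := fun ω => by
    have h2 : (t * X ω) ^ 2 / 2 ≤ Real.exp (t * X ω) + Real.exp (-t * X ω) - 2 := by
      rw [neg_mul]
      rcases le_total 0 (t * X ω) with h0 | h0
      · have h3 := Real.quadratic_le_exp_of_nonneg h0
        have h4 := Real.add_one_le_exp (-(t * X ω))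
        linarith
      · have h3 := Real.quadratic_le_exp_of_nonneg (neg_nonneg.2 h0)
        have h4 := Real.add_one_le_exp (t * X ω)
        rw [neg_sq] at h3
        linarith
    rw [mul_pow, ht2] at h2
    have h3 : X ω ^ 2 = 2 * c * (1 / c * X ω ^ 2 / 2) := by field_simp
    rw [h3]
    exact mul_le_mul_of_nonneg_left h2 (by positivity)
  have hint : Integrable (fun ω => 2 * c * (Real.exp (t * X ω) + Real.exp (-t * X ω) - 2)) P :=
    (((h.integrable_exp_mul t).add (h.integrable_exp_mul (-t))).sub
      (integrable_const _)).const_mul _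
  calc ∫⁻ ω, ENNReal.ofReal (X ω ^ 2) ∂P
      ≤ ∫⁻ ω, ENNReal.ofReal (2 * c * (Real.exp (t * X ω) + Real.exp (-t * X ω) - 2)) ∂P :=
        lintegral_mono fun ω => ENNReal.ofReal_le_ofReal (hpt ω)
    _ = ENNReal.ofReal (∫ ω, 2 * c * (Real.exp (t * X ω) + Real.exp (-t * X ω) - 2) ∂P) :=
        (ofReal_integral_eq_lintegral_ofReal hint
          (ae_of_all _ fun ω => (sq_nonneg _).trans (hpt ω))).symm
    _ ≤ ENNReal.ofReal (4 * c) := by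
        refine ENNReal.ofReal_le_ofReal ?_
        have hadd : Integrable (fun ω => Real.exp (t * X ω) + Real.exp (-t * X ω)) P :=
          (h.integrable_exp_mul t).add (h.integrable_exp_mul (-t))
        rw [integral_const_mul, integral_sub hadd (integrable_const _),
          integral_add (h.integrable_exp_mul t) (h.integrable_exp_mul (-t))]
        have h1 := h.mgf_le t
        have h2 := h.mgf_le (-t)
        have h3 : (c : ℝ) * t ^ 2 / 2 = 1 / 2 := by rw [ht2]; field_simp
        rw [neg_sq, h3] at h2
        rw [h3] at h1
        have h4 : Real.exp (1 / 2) ≤ 2 := by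
          have := Real.exp_one_lt_d9
          have h5 : Real.exp (1 / 2) ^ 2 = Real.exp 1 := by
            rw [← Real.exp_nat_mul]; norm_num
          nlinarith [Real.exp_pos (1 / 2)]
        simp only [mgf] at h1 h2
        simp only [integral_const, probReal_univ, smul_eq_mul]
        nlinarith

/-- Exponential moments of the square of a sub-Gaussian variable. -/
lemma subgaussian_exp_sq_le {X : Ω → ℝ} {c : ℝ≥0} (h : HasSubgaussianMGF X c P)
    (hX : Measurable X) (hc : 0 < c) :
    ∫⁻ ω, ENNReal.ofReal (Real.exp (X ω ^ 2 / (4 * c))) ∂P ≤ ENNReal.ofReal 2 := by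
  -- An auxiliary standard Gaussian `g` linearizes the square: `exp (r ^ 2 * X ^ 2 / 2)` is the mean
  -- of `exp (r * X * g)`. After exchanging the integrals, the sub-Gaussian bound leaves the mean of
  -- `exp (g ^ 2 / 4)`, which is `√2`.
  set γ := gaussianReal 0 1 with hγ
  have hc0 : (0 : ℝ) < c := hc
  set r : ℝ := √(1 / (2 * c)) with hr
  have hr2 : r ^ 2 = 1 / (2 * c) := Real.sq_sqrt (by positivity)
  have h1 : ∀ ω, ENNReal.ofReal (Real.exp (X ω ^ 2 / (4 * c))) =
      ∫⁻ g, ENNReal.ofReal (Real.exp (r * X ω * g)) ∂γ := fun ω => by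
    rw [← ofReal_integral_eq_lintegral_ofReal (integrable_exp_mul_gaussianReal _)
      (ae_of_all _ fun g => (Real.exp_pos _).le)]
    have := congrFun (mgf_fun_id_gaussianReal (μ := 0) (v := 1)) (r * X ω)
    simp only [mgf] at this
    rw [this]
    congr 2
    rw [mul_pow, hr2]; push_cast; field_simp; ring
  simp_rw [h1]
  rw [lintegral_lintegral_swap (by fun_prop)]
  have h2 : ∀ g : ℝ, ∫⁻ ω, ENNReal.ofReal (Real.exp (r * X ω * g)) ∂P ≤
      ENNReal.ofReal (Real.exp (g ^ 2 / 4)) := fun g => by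
    have e1 : ∀ ω, r * X ω * g = r * g * X ω := fun ω => by ring
    simp_rw [e1]
    rw [← ofReal_integral_eq_lintegral_ofReal (h.integrable_exp_mul _)
      (ae_of_all _ fun g => (Real.exp_pos _).le)]
    refine ENNReal.ofReal_le_ofReal ((h.mgf_le (r * g)).trans (Real.exp_le_exp.2 (le_of_eq ?_)))
    rw [mul_pow, hr2]; field_simp; ring
  refine (lintegral_mono h2).trans ?_
  have hv : (1 : ℝ≥0) ≠ 0 := one_ne_zero
  rw [hγ, gaussianReal_of_var_ne_zero _ hv,
    lintegral_withDensity_eq_lintegral_mul _ (measurable_gaussianPDF _ _) (by fun_prop)]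
  have h3 : ∀ g : ℝ, (gaussianPDF 0 1 * fun g => ENNReal.ofReal (Real.exp (g ^ 2 / 4))) g =
      ENNReal.ofReal ((√(2 * Real.pi))⁻¹ * Real.exp (-(1 / 4) * g ^ 2)) := fun g => by
    rw [Pi.mul_apply, gaussianPDF, ← ENNReal.ofReal_mul (gaussianPDFReal_nonneg _ _ _),
      gaussianPDFReal, mul_assoc, ← Real.exp_add]
    congr 3
    · push_cast; ring_nf
    · push_cast; ring
  simp_rw [h3]
  rw [← ofReal_integral_eq_lintegral_ofReal
    ((integrable_exp_neg_mul_sq (by norm_num)).const_mul _)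
    (ae_of_all _ fun g => by positivity), integral_const_mul, integral_gaussian]
  refine ENNReal.ofReal_le_ofReal ?_
  have h4 : √(Real.pi / (1 / 4)) = √2 * √(2 * Real.pi) := by
    rw [← Real.sqrt_mul (by norm_num)]; congr 1; ring
  rw [h4, mul_comm (√2), ← mul_assoc, inv_mul_cancel₀ (by positivity), one_mul]
  exact Real.sqrt_le_iff.2 ⟨by norm_num, by norm_num⟩

/-- Second-order Taylor remainder. For a centred variable the linear term integrates to zero, which
leaves a bound quadratic in the parameter. -/
lemma exp_le_quadratic (y : ℝ) : Real.exp y ≤ 1 + y + y ^ 2 * Real.exp |y| := by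
  have h := Complex.norm_exp_sub_sum_le_norm_mul_exp (y : ℂ) 2
  simp only [Finset.sum_range_succ, Finset.sum_range_zero, pow_zero, Nat.factorial, Nat.cast_one,
    div_one, zero_add, pow_one, Nat.succ_eq_add_one, mul_one] at h
  have h2 : (Complex.exp y - (1 + y)) = ((Real.exp y - (1 + y) : ℝ) : ℂ) := by push_cast; rfl
  rw [h2, Complex.norm_real, Complex.norm_real, Real.norm_eq_abs, Real.norm_eq_abs, sq_abs] at h
  linarith [(abs_le.1 h).2]

/-- Moment generating function of a centred product of sub-Gaussian variables. -/
lemma product_mgf_le {U V : Ω → ℝ} {c : ℝ≥0} (hU : HasSubgaussianMGF U c P)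
    (hV : HasSubgaussianMGF V c P) (hUm : Measurable U) (hVm : Measurable V) (hc : 0 < c)
    {t : ℝ} (ht : |t| ≤ 1 / (8 * c)) :
    Integrable (fun ω => Real.exp (t * (U ω * V ω - ∫ ω, U ω * V ω ∂P))) P ∧
    mgf (fun ω => U ω * V ω - ∫ ω, U ω * V ω ∂P) P t ≤ Real.exp (704 * c ^ 2 * t ^ 2) := by
  have hc0 : (0 : ℝ) < c := hc
  set a : ℝ := 1 / (4 * c) with ha
  have ha0 : 0 < a := by positivity
  -- Dominating function: by the arithmetic–geometric mean inequality its mean is at most the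
  -- average of two exponential moments of squares, hence at most `2`.
  set G : Ω → ℝ := fun ω => Real.exp (a * |U ω * V ω|) with hG
  have hGm : Measurable G := by fun_prop
  have hGle : ∀ ω, G ω ≤
      (Real.exp (U ω ^ 2 / (4 * c)) + Real.exp (V ω ^ 2 / (4 * c))) / 2 := fun ω => by
    have h1 : a * |U ω * V ω| ≤ (U ω ^ 2 / (4 * c) + V ω ^ 2 / (4 * c)) / 2 := by
      have h2 : |U ω * V ω| ≤ (U ω ^ 2 + V ω ^ 2) / 2 := by
        rw [abs_mul, ← sq_abs (U ω), ← sq_abs (V ω)]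
        nlinarith [sq_nonneg (|U ω| - |V ω|)]
      have h3 := mul_le_mul_of_nonneg_left h2 ha0.le
      refine h3.trans (le_of_eq ?_)
      rw [ha]; field_simp
    refine (Real.exp_le_exp.2 h1).trans ?_
    have e1 : (U ω ^ 2 / (4 * c) + V ω ^ 2 / (4 * c)) / 2 =
      U ω ^ 2 / (4 * c) / 2 + V ω ^ 2 / (4 * c) / 2 := by ring
    rw [e1, Real.exp_add]
    have e2 : ∀ x : ℝ, Real.exp x = Real.exp (x / 2) ^ 2 := fun x => by
      rw [← Real.exp_nat_mul]; congr 1; push_cast; ring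
    rw [e2 (U ω ^ 2 / (4 * c)), e2 (V ω ^ 2 / (4 * c))]
    nlinarith [sq_nonneg (Real.exp (U ω ^ 2 / (4 * c) / 2) - Real.exp (V ω ^ 2 / (4 * c) / 2))]
  have hGlint : ∫⁻ ω, ENNReal.ofReal (G ω) ∂P ≤ ENNReal.ofReal 2 := by
    have hUl := subgaussian_exp_sq_le hU hUm hc
    have hVl := subgaussian_exp_sq_le hV hVm hc
    calc ∫⁻ ω, ENNReal.ofReal (G ω) ∂P
        ≤ ∫⁻ ω, ENNReal.ofReal (1 / 2) * (ENNReal.ofReal (Real.exp (U ω ^ 2 / (4 * c))) +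
            ENNReal.ofReal (Real.exp (V ω ^ 2 / (4 * c)))) ∂P := lintegral_mono fun ω => by
          rw [← ENNReal.ofReal_add (Real.exp_pos _).le (Real.exp_pos _).le,
            ← ENNReal.ofReal_mul (by norm_num)]
          exact ENNReal.ofReal_le_ofReal ((hGle ω).trans (le_of_eq (by ring)))
      _ = ENNReal.ofReal (1 / 2) * (∫⁻ ω, ENNReal.ofReal (Real.exp (U ω ^ 2 / (4 * c))) ∂P +
            ∫⁻ ω, ENNReal.ofReal (Real.exp (V ω ^ 2 / (4 * c))) ∂P) := by
          rw [lintegral_const_mul _ (by fun_prop), lintegral_add_left (by fun_prop)]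
      _ ≤ ENNReal.ofReal (1 / 2) * (ENNReal.ofReal 2 + ENNReal.ofReal 2) := by gcongr
      _ = ENNReal.ofReal 2 := by
          rw [← ENNReal.ofReal_add (by norm_num) (by norm_num), ← ENNReal.ofReal_mul (by norm_num)]
          norm_num
  have hGint : Integrable G P := by
    refine ⟨hGm.aestronglyMeasurable, ?_⟩
    rw [hasFiniteIntegral_iff_ofReal (ae_of_all _ fun ω => (Real.exp_pos _).le)]
    exact hGlint.trans_lt ENNReal.ofReal_lt_top
  have hGE : ∫ ω, G ω ∂P ≤ 2 := by
    rw [← ofReal_integral_eq_lintegral_ofReal hGint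
      (ae_of_all _ fun ω => (Real.exp_pos _).le)] at hGlint
    exact (ENNReal.ofReal_le_ofReal_iff (by norm_num)).1 hGlint
  have hUVint : Integrable (fun ω => U ω * V ω) P := by
    refine (hGint.const_mul (1 / a)).mono' (by fun_prop) (ae_of_all _ fun ω => ?_)
    rw [Real.norm_eq_abs, one_div, ← div_eq_inv_mul, le_div_iff₀ ha0, mul_comm]
    exact (by linarith [Real.add_one_le_exp (a * |U ω * V ω|)])
  set m := ∫ ω, U ω * V ω ∂P with hm
  have ham : a * |m| ≤ 1 := by
    have h1 : |m| ≤ ∫ ω, |U ω * V ω| ∂P := abs_integral_le_integral_abs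
    have h2 : ∫ ω, (a * |U ω * V ω| + 1) ∂P ≤ ∫ ω, G ω ∂P :=
      integral_mono ((hUVint.abs.const_mul a).add (integrable_const _)) hGint
        fun ω => Real.add_one_le_exp _
    rw [integral_add (hUVint.abs.const_mul a) (integrable_const _), integral_const_mul,
      integral_const, probReal_univ, one_smul] at h2
    have := mul_le_mul_of_nonneg_left h1 ha0.le
    linarith
  have hta : |t| ≤ a / 2 := by rw [ha]; refine ht.trans (le_of_eq ?_); field_simp; norm_num
  -- The constant is `22 = 8 * 2.75`, where `2.75` bounds the factor `exp 1` lost in centring, as `a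
  -- * |m| ≤ 1`. Then `704 = 22 * 2 * 16`, from the mean of `G` and `a = 1 / (4 * c)`.
  have hpt : ∀ ω, Real.exp (t * (U ω * V ω - m)) ≤
      1 + t * (U ω * V ω - m) + 22 * (t / a) ^ 2 * G ω := fun ω => by
    set Z := U ω * V ω - m with hZ
    have h1 := exp_le_quadratic (t * Z)
    set y := a * |Z| / 2 with hy
    have hy0 : 0 ≤ y := by positivity
    have h2 : y ^ 2 ≤ 2 * Real.exp y := by
      have := Real.quadratic_le_exp_of_nonneg hy0; nlinarith
    have h3 : |t * Z| ≤ y := by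
      rw [abs_mul, hy]
      have := mul_le_mul_of_nonneg_right hta (abs_nonneg Z); linarith
    have h4 : (t * Z) ^ 2 = 4 * (t / a) ^ 2 * y ^ 2 := by
      rw [mul_pow, ← sq_abs Z, hy]; field_simp; norm_num
    have h5 : Real.exp |t * Z| ≤ Real.exp y := Real.exp_le_exp.2 h3
    have h6 : Real.exp y * Real.exp y ≤ G ω * Real.exp 1 := by
      rw [← Real.exp_add, hG, ← Real.exp_add]
      refine Real.exp_le_exp.2 ?_
      have h7 : |Z| ≤ |U ω * V ω| + |m| := abs_sub _ _
      have := mul_le_mul_of_nonneg_left h7 ha0.le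
      rw [hy]; linarith
    have h7 : (t * Z) ^ 2 * Real.exp |t * Z| ≤ 22 * (t / a) ^ 2 * G ω := by
      have h8 : Real.exp 1 ≤ 2.75 := by linarith [Real.exp_one_lt_d9]
      have hGpos : 0 < G ω := Real.exp_pos _
      calc (t * Z) ^ 2 * Real.exp |t * Z| ≤ 4 * (t / a) ^ 2 * (2 * Real.exp y) * Real.exp y := by
            rw [h4]; gcongr
        _ = 8 * (t / a) ^ 2 * (Real.exp y * Real.exp y) := by ring
        _ ≤ 8 * (t / a) ^ 2 * (G ω * 2.75) := by
            refine mul_le_mul_of_nonneg_left (h6.trans ?_) (by positivity)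
            gcongr
        _ = _ := by ring
    linarith
  have hRint : Integrable (fun ω => 1 + t * (U ω * V ω - m) + 22 * (t / a) ^ 2 * G ω) P :=
    ((integrable_const _).add ((hUVint.sub (integrable_const _)).const_mul _)).add
      (hGint.const_mul _)
  refine ⟨hRint.mono' (by fun_prop) (ae_of_all _ fun ω => ?_), ?_⟩
  · rw [Real.norm_eq_abs, abs_of_pos (Real.exp_pos _)]; exact hpt ω
  · have h1 : mgf (fun ω => U ω * V ω - m) P t ≤
        ∫ ω, (1 + t * (U ω * V ω - m) + 22 * (t / a) ^ 2 * G ω) ∂P :=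
      integral_mono_of_nonneg (ae_of_all _ fun ω => (Real.exp_pos _).le) hRint (ae_of_all _ hpt)
    have hi1 : Integrable (fun ω => t * (U ω * V ω - m)) P :=
      (hUVint.sub (integrable_const _)).const_mul _
    have hi2 : Integrable (fun ω => 1 + t * (U ω * V ω - m)) P := (integrable_const _).add hi1
    rw [integral_add hi2 (hGint.const_mul _), integral_add (integrable_const _) hi1,
      integral_const_mul, integral_const_mul, integral_sub hUVint (integrable_const _), ← hm] at h1
    simp only [integral_const, probReal_univ, smul_eq_mul, one_mul, sub_self, mul_zero,
      add_zero] at h1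
    refine h1.trans ?_
    have h2 : 22 * (t / a) ^ 2 * ∫ ω, G ω ∂P ≤ 22 * (t / a) ^ 2 * 2 := by gcongr
    have h3 : 22 * (t / a) ^ 2 * 2 = 704 * c ^ 2 * t ^ 2 := by rw [ha]; field_simp; ring
    linarith [Real.add_one_le_exp (704 * c ^ 2 * t ^ 2)]

/-- Bernstein inequality. -/
lemma bernstein_upper {ι : Type*} {Z : ι → Ω → ℝ} (hind : iIndepFun Z P)
    (hZm : ∀ i, Measurable (Z i)) {c : ℝ} (hc : 0 < c)
    (hZ : ∀ i t, |t| ≤ 1 / (8 * c) → Integrable (fun ω => Real.exp (t * Z i ω)) P ∧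
      mgf (Z i) P t ≤ Real.exp (704 * c ^ 2 * t ^ 2))
    (s : Finset ι) {n : ℕ} (hs : s.card = n) {x : ℝ} (hx : 0 < x) :
    P.real {ω | 64 * c * (√(n * x) + x) ≤ ∑ i ∈ s, Z i ω} ≤ Real.exp (-x) := by
  rcases Nat.eq_zero_or_pos n with hn | hn
  · have : s = ∅ := Finset.card_eq_zero.1 (hs.trans hn)
    subst this
    have hempty : {ω : Ω | 64 * c * (√(n * x) + x) ≤ ∑ i ∈ (∅ : Finset ι), Z i ω} = ∅ := by
      ext ω
      simp only [Finset.sum_empty, Set.mem_ofPred_eq, Set.mem_empty_iff_false, iff_false, not_le]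
      have := Real.sqrt_nonneg (n * x)
      positivity
    rw [hempty, measureReal_empty]; exact (Real.exp_pos _).le
  have hn0 : (0 : ℝ) < n := by exact_mod_cast hn
  -- The Chernoff parameter is of order `√(x / n) / c` in the Gaussian regime; the cap at `1` keeps
  -- it in the range where the moment bound holds.
  set r := min √(x / n) 1 with hr
  have hr0 : 0 ≤ r := le_min (Real.sqrt_nonneg _) zero_le_one
  have hr1 : r ≤ 1 := min_le_right _ _
  set t := r / (32 * c) with ht
  have ht0 : 0 ≤ t := by positivity
  have ht8 : |t| ≤ 1 / (8 * c) := by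
    rw [abs_of_nonneg ht0, ht, div_le_div_iff₀ (by positivity) (by positivity)]
    nlinarith
  have hint : Integrable (fun ω => Real.exp (t * (∑ i ∈ s, Z i) ω)) P :=
    hind.integrable_exp_mul_sum hZm fun i _ => (hZ i t ht8).1
  have h1 := measure_ge_le_exp_mul_mgf (64 * c * (√(n * x) + x)) ht0 hint
  rw [hind.mgf_sum hZm] at h1
  have h2 : ∏ i ∈ s, mgf (Z i) P t ≤ Real.exp (n * (704 * c ^ 2 * t ^ 2)) := by
    calc ∏ i ∈ s, mgf (Z i) P t ≤ ∏ _i ∈ s, Real.exp (704 * c ^ 2 * t ^ 2) :=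
          Finset.prod_le_prod (fun i _ => mgf_nonneg) fun i _ => (hZ i t ht8).2
      _ = _ := by rw [Finset.prod_const, hs, ← Real.exp_nat_mul]
  simp only [Finset.sum_apply] at h1
  refine h1.trans ((mul_le_mul_of_nonneg_left h2 (Real.exp_pos _).le).trans ?_)
  rw [← Real.exp_add]
  refine Real.exp_le_exp.2 ?_
  have h3 : x ≤ r * (√(n * x) + x) := by
    rcases le_total x n with h | h
    · have e1 : r = √(x / n) := min_eq_left (Real.sqrt_le_one.2 ((div_le_one hn0).2 h))
      have e2 : √(x / n) * √(n * x) = x := by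
        rw [← Real.sqrt_mul (by positivity), show x / n * (n * x) = x ^ 2 by field_simp,
          Real.sqrt_sq hx.le]
      rw [e1, mul_add, e2]
      have := mul_nonneg (Real.sqrt_nonneg (x / n)) hx.le
      linarith
    · have e1 : r = 1 := min_eq_right (Real.one_le_sqrt.2 ((one_le_div hn0).2 h))
      rw [e1, one_mul]; linarith [Real.sqrt_nonneg (n * x)]
  have h4 : n * r ^ 2 ≤ x := by
    have h5 : r ^ 2 ≤ x / n := by
      have := pow_le_pow_left₀ hr0 (min_le_left √(x / n) 1) 2
      rwa [Real.sq_sqrt (by positivity)] at this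
    calc n * r ^ 2 ≤ n * (x / n) := by gcongr
      _ = x := by field_simp
  have e1 : -t * (64 * c * (√(n * x) + x)) = -2 * (r * (√(n * x) + x)) := by
    rw [ht]; field_simp; ring
  have e2 : n * (704 * c ^ 2 * t ^ 2) = 11 / 16 * (n * r ^ 2) := by
    rw [ht]; field_simp; ring
  rw [e1, e2]
  linarith

lemma bernstein {ι : Type*} {Z : ι → Ω → ℝ} (hind : iIndepFun Z P)
    (hZm : ∀ i, Measurable (Z i)) {c : ℝ} (hc : 0 < c)
    (hZ : ∀ i t, |t| ≤ 1 / (8 * c) → Integrable (fun ω => Real.exp (t * Z i ω)) P ∧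
      mgf (Z i) P t ≤ Real.exp (704 * c ^ 2 * t ^ 2))
    (s : Finset ι) {n : ℕ} (hs : s.card = n) {x : ℝ} (hx : 0 < x) :
    P {ω | 64 * c * (√(n * x) + x) < |∑ i ∈ s, Z i ω|} ≤ ENNReal.ofReal (2 * Real.exp (-x)) := by
  refine measure_le_ofReal ?_
  have h1 := bernstein_upper hind hZm hc hZ s hs hx
  have hneg : iIndepFun (fun i => -Z i) P := hind.comp (fun _ => fun y => -y) fun _ =>
      measurable_neg
  have h2 := bernstein_upper hneg (fun i => (hZm i).neg) hc (fun i t ht => by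
    have := hZ i (-t) (by rwa [abs_neg])
    rw [neg_sq] at this
    refine ⟨by simpa using this.1, ?_⟩
    rw [mgf_neg]; exact this.2) s hs hx
  calc _ ≤ P.real ({ω | 64 * c * (√(n * x) + x) ≤ ∑ i ∈ s, Z i ω} ∪
        {ω | 64 * c * (√(n * x) + x) ≤ ∑ i ∈ s, (-Z i) ω}) := by
        refine measureReal_mono (fun ω hω => ?_)
        have hω' : 64 * c * (√(n * x) + x) < |∑ i ∈ s, Z i ω| := hω
        rcases lt_abs.1 hω' with h | h
        · exact Or.inl h.le
        · right
          simp only [Set.mem_ofPred_eq, Pi.neg_apply, Finset.sum_neg_distrib]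
          exact h.le
    _ ≤ _ := measureReal_union_le _ _
    _ ≤ 2 * Real.exp (-x) := by linarith

end SubExponential

end TransFusion

namespace TransFusion

/-! ## Linear forms in the errors -/

section Errors

variable {Ω : Type*} [MeasurableSpace Ω] {P : Measure Ω}

/-- Grouping by the first index: currying carries a product measure over pairs to a product of
product measures. It gives independence between sources. -/
lemma iIndepFun_curry [IsProbabilityMeasure P]
    {ι κ 𝓧 : Type*} [MeasurableSpace 𝓧] {X : ι × κ → Ω → 𝓧}
    (hm : ∀ q, Measurable (X q)) (h : iIndepFun X P) :
    iIndepFun (fun i ω j => X (i, j) ω) P := by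
  have hp : ∀ q, IsProbabilityMeasure (P.map (X q)) :=
    fun q => Measure.isProbabilityMeasure_map (hm q).aemeasurable
  have h1 := h.map_fun_eq_infinitePi_map hm
  rw [iIndepFun_iff_map_fun_eq_infinitePi_map (fun i => by fun_prop)]
  have h2 : ∀ i, P.map (fun ω j => X (i, j) ω) =
      Measure.infinitePi fun j => P.map (X (i, j)) := fun i =>
    (h.precomp (g := fun j => (i, j)) (fun a b hab => by simpa using hab)).map_fun_eq_infinitePi_map
      fun j => hm (i, j)
  simp_rw [h2]
  rw [← Measure.infinitePi_map_curry (fun i j => P.map (X (i, j))), ← h1,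
    Measure.map_map (by fun_prop) (by fun_prop)]
  rfl

lemma gaussian_hasSubgaussianMGF {X : Ω → ℝ} {v σ2 : ℝ≥0} (h : HasLaw X (gaussianReal 0 v) P)
    (hv : v ≤ σ2) : HasSubgaussianMGF X σ2 P := by
  refine HasSubgaussianMGF.mono ⟨fun t => ?_, fun t => ?_⟩ hv
  · have := integrable_exp_mul_gaussianReal (μ := 0) (v := v) t
    rw [← h.map_eq] at this
    exact this.comp_aemeasurable h.aemeasurable
  · rw [mgf_gaussianReal h.map_eq]; simp

lemma gaussian_identDistrib_neg {X : Ω → ℝ} {v : ℝ≥0} (h : HasLaw X (gaussianReal 0 v) P) :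
    IdentDistrib X (fun ω => -X ω) P P where
  aemeasurable_fst := h.aemeasurable
  aemeasurable_snd := h.aemeasurable.neg
  map_eq := by
    have := (gaussianReal_neg h).map_eq
    rw [neg_zero] at this
    rw [h.map_eq]; exact this.symm

variable {ι : Type*} [Fintype ι] {e : ι → Ω → ℝ} {σ2 : ℝ≥0}

lemma linear_form_subgaussian (hind : iIndepFun e P) (hsub : ∀ o, HasSubgaussianMGF (e o) σ2 P)
    (w : ι → ℝ) {V : ℝ≥0} (hV : σ2 * ∑ o, w o ^ 2 ≤ V) :
    HasSubgaussianMGF (fun ω => ∑ o, w o * e o ω) V P := by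
  have hind' : iIndepFun (fun o ω => w o * e o ω) P :=
    hind.comp (fun o y => w o * y) fun o => by fun_prop
  have h := HasSubgaussianMGF.sum_of_iIndepFun hind' (s := Finset.univ)
    (fun o _ => (hsub o).const_mul (w o))
  refine HasSubgaussianMGF.mono h ?_
  rw [← NNReal.coe_le_coe, NNReal.coe_sum]
  refine (le_of_eq ?_).trans hV
  rw [Finset.mul_sum]
  refine Finset.sum_congr rfl fun o _ => ?_
  rw [mul_comm]
  rfl

/-- The joint law is a product of symmetric laws, hence invariant under a global change of sign. -/
lemma linear_form_identDistrib_neg (hind : iIndepFun e P) (hm : ∀ o, Measurable (e o))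
    (hsym : ∀ o, IdentDistrib (e o) (fun ω => -e o ω) P P) (w : ι → ℝ) :
    IdentDistrib (fun ω => ∑ o, w o * e o ω) (fun ω => -∑ o, w o * e o ω) P P := by
  have hneg : iIndepFun (fun o ω => -e o ω) P :=
    hind.comp (fun _ y => -y) fun _ => measurable_neg
  have hpi : P.map (fun ω o => -e o ω) = Measure.pi fun o => P.map (fun ω => -e o ω) :=
    hneg.map_fun_eq_pi_map fun o => (hm o).neg.aemeasurable
  have hlaw : IdentDistrib (fun ω o => e o ω) (fun ω o => -e o ω) P P :=
    ⟨by fun_prop, by fun_prop, by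
      rw [hind.map_fun_eq_pi_map fun o => (hm o).aemeasurable, hpi]
      congr 1
      funext o
      exact (hsym o).map_eq⟩
  have := hlaw.comp (u := fun y : ι → ℝ => ∑ o, w o * y o) (by fun_prop)
  have hcomp : (fun ω => -∑ o, w o * e o ω) =
      (fun y : ι → ℝ => ∑ o, w o * y o) ∘ fun ω o => -e o ω := by
    funext ω
    simp
  rw [hcomp]
  exact this

/-- Odd contractions of symmetric sub-Gaussian variables are sub-Gaussian with the same
parameter. -/
lemma odd_contraction_subgaussian {g : Ω → ℝ} {V : ℝ≥0} (hg : HasSubgaussianMGF g V P)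
    (hsym : IdentDistrib g (fun ω => -g ω) P P) {φ : ℝ → ℝ} (hφm : Measurable φ)
    (hodd : ∀ x, φ (-x) = -φ x) (hφ : ∀ x, |φ x| ≤ |x|) :
    HasSubgaussianMGF (fun ω => φ (g ω)) V P := by
  have hint : ∀ t : ℝ, Integrable (fun ω => Real.exp (t * φ (g ω))) P := fun t => by
    have h1 := (hg.integrable_exp_mul t).add (hg.integrable_exp_mul (-t))
    have hgm := hg.aemeasurable
    refine h1.mono' (Real.measurable_exp.comp_aemeasurable
      ((hφm.comp_aemeasurable hgm).const_mul t)).aestronglyMeasurable (ae_of_all _ fun ω => ?_)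
    rw [Real.norm_eq_abs, abs_of_pos (Real.exp_pos _), Pi.add_apply]
    have h2 : t * φ (g ω) ≤ |t * g ω| := by
      refine (le_abs_self _).trans ?_
      rw [abs_mul, abs_mul]; exact mul_le_mul_of_nonneg_left (hφ _) (abs_nonneg _)
    refine (Real.exp_le_exp.2 h2).trans ?_
    rcases abs_cases (t * g ω) with ⟨h, -⟩ | ⟨h, -⟩
    · rw [h]; linarith [Real.exp_pos (-t * g ω)]
    · rw [h, ← neg_mul]; linarith [Real.exp_pos (t * g ω)]
  refine ⟨hint, fun t => ?_⟩
  -- By symmetry the moment generating function is even, so it is the mean of `cosh (t * φ g)`, and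
  -- `cosh` increases with the absolute value.
  have hswap : mgf (fun ω => φ (g ω)) P t = mgf (fun ω => φ (g ω)) P (-t) := by
    have h1 := (hsym.comp (u := fun y => Real.exp (t * φ y)) (by fun_prop)).integral_eq
    simp only [Function.comp_def, hodd] at h1
    simp only [mgf, h1]
    congr 1; funext ω; congr 1; ring
  have hpt : ∀ ω, Real.exp (t * φ (g ω)) + Real.exp (-t * φ (g ω)) ≤
      Real.exp (t * g ω) + Real.exp (-t * g ω) := fun ω => by
    have h1 : Real.cosh (t * φ (g ω)) ≤ Real.cosh (t * g ω) := by
      rw [Real.cosh_le_cosh, abs_mul, abs_mul]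
      exact mul_le_mul_of_nonneg_left (hφ _) (abs_nonneg _)
    rw [Real.cosh_eq, Real.cosh_eq] at h1
    rw [neg_mul, neg_mul]
    linarith
  have h2 := integral_mono ((hint t).add (hint (-t)))
    ((hg.integrable_exp_mul t).add (hg.integrable_exp_mul (-t))) hpt
  rw [integral_add' (hint t) (hint (-t)), integral_add' (hg.integrable_exp_mul t)
    (hg.integrable_exp_mul (-t))] at h2
  have h3 := hg.mgf_le t
  have h4 := hg.mgf_le (-t)
  rw [neg_sq] at h4
  simp only [mgf] at hswap h3 h4 ⊢
  linarith

/-- Chernoff-type bound: `y ^ 2 ≤ 2 * exp y` for `y = a * (|g| - t) ≥ 0`, with `a` free. -/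
lemma exceedance_sq_integral_le {g : Ω → ℝ} {V : ℝ≥0} (hg : HasSubgaussianMGF g V P)
    {t a : ℝ} (ht : 0 ≤ t) (ha : 0 < a) :
    ∫ ω, (g ω - clip t (g ω)) ^ 2 ∂P ≤ 4 / a ^ 2 * Real.exp (a ^ 2 * V / 2 - a * t) := by
  have hpt : ∀ ω, (g ω - clip t (g ω)) ^ 2 ≤
      2 / a ^ 2 * Real.exp (-(a * t)) * (Real.exp (a * g ω) + Real.exp (-a * g ω)) := fun ω => by
    rw [← sq_abs, abs_sub_clip ht]
    rcases le_total (|g ω| - t) 0 with h | h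
    · rw [max_eq_right h, zero_pow two_ne_zero]
      have := Real.exp_pos (a * g ω)
      have := Real.exp_pos (-a * g ω)
      positivity
    · rw [max_eq_left h]
      have h1 : (a * (|g ω| - t)) ^ 2 ≤ 2 * Real.exp (a * (|g ω| - t)) := by
        have h2 : 0 ≤ a * (|g ω| - t) := by positivity
        have := Real.quadratic_le_exp_of_nonneg h2
        linarith
      have h2 : Real.exp (a * (|g ω| - t)) = Real.exp (-(a * t)) * Real.exp (a * |g ω|) := by
        rw [← Real.exp_add]; congr 1; ring
      have h3 : Real.exp (a * |g ω|) ≤ Real.exp (a * g ω) + Real.exp (-a * g ω) := by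
        rcases abs_cases (g ω) with ⟨h, -⟩ | ⟨h, -⟩
        · rw [h]; linarith [Real.exp_pos (-a * g ω)]
        · rw [h, mul_neg, ← neg_mul]; linarith [Real.exp_pos (a * g ω)]
      have h4 : (|g ω| - t) ^ 2 = (a * (|g ω| - t)) ^ 2 / a ^ 2 := by field_simp
      rw [h4, div_le_iff₀ (by positivity)]
      calc (a * (|g ω| - t)) ^ 2 ≤ 2 * (Real.exp (-(a * t)) * Real.exp (a * |g ω|)) := by
            rw [← h2]; exact h1
        _ ≤ 2 * (Real.exp (-(a * t)) * (Real.exp (a * g ω) + Real.exp (-a * g ω))) := by gcongr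
        _ = _ := by field_simp
  have hadd : Integrable (fun ω => Real.exp (a * g ω) + Real.exp (-a * g ω)) P :=
    (hg.integrable_exp_mul a).add (hg.integrable_exp_mul (-a))
  have h1 := integral_mono_of_nonneg (ae_of_all P fun ω => sq_nonneg (g ω - clip t (g ω)))
    (hadd.const_mul (2 / a ^ 2 * Real.exp (-(a * t)))) (ae_of_all _ hpt)
  rw [integral_const_mul, integral_add (hg.integrable_exp_mul a) (hg.integrable_exp_mul (-a))] at h1
  have h2 := hg.mgf_le a
  have h3 := hg.mgf_le (-a)
  rw [neg_sq] at h3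
  simp only [mgf] at h2 h3
  calc _ ≤ _ := h1
    _ ≤ 2 / a ^ 2 * Real.exp (-(a * t)) *
        (Real.exp (V * a ^ 2 / 2) + Real.exp (V * a ^ 2 / 2)) := by gcongr
    _ = 4 / a ^ 2 * (Real.exp (-(a * t)) * Real.exp (V * a ^ 2 / 2)) := by ring
    _ = _ := by rw [← Real.exp_add]; congr 2; ring

/-- Second moment of a sum of exceedances of independent symmetric sub-Gaussian variables. -/
lemma sum_exceedance_sq_le [IsProbabilityMeasure P]
    {κ : Type*} [Fintype κ] {g : κ → Ω → ℝ} {V : ℝ≥0}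
    (hind : iIndepFun g P) (hm : ∀ k, Measurable (g k))
    (hg : ∀ k, HasSubgaussianMGF (g k) V P)
    (hsym : ∀ k, IdentDistrib (g k) (fun ω => -g k ω) P P) {t : κ → ℝ} {T a : ℝ}
    (hT : 0 ≤ T) (ht : ∀ k, T ≤ t k) (ha : 0 < a) :
    ∫⁻ ω, ENNReal.ofReal ((∑ k, (g k ω - clip (t k) (g k ω))) ^ 2) ∂P ≤
      ENNReal.ofReal (Fintype.card κ * (4 / a ^ 2 * Real.exp (a ^ 2 * V / 2 - a * T))) := by
  set φ : κ → Ω → ℝ := fun k ω => g k ω - clip (t k) (g k ω) with hφ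
  have hcm := fun k => measurable_clip (t k)
  have ht0 : ∀ k, 0 ≤ t k := fun k => hT.trans (ht k)
  have hφm : ∀ k, Measurable (φ k) := fun k => by
    have := hm k; have := hcm k; fun_prop
  have hφind : iIndepFun φ P := hind.comp (fun k y => y - clip (t k) y) fun k => by
    have := hcm k; fun_prop
  have hφle : ∀ k ω, |φ k ω| ≤ |g k ω| := fun k ω => by
    simp only [hφ]
    rw [abs_sub_clip (ht0 k)]
    exact max_le (by linarith [ht0 k]) (abs_nonneg _)
  have hmem : ∀ k, MemLp (φ k) 2 P := fun k =>
    ((hg k).memLp 2).mono (hφm k).aestronglyMeasurable (ae_of_all _ fun ω => hφle k ω)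
  -- The excess is an odd function of a symmetric variable. Being centred, the independent excesses
  -- have a sum whose second moment is linear in the number of terms.
  have hmean : ∀ k, ∫ ω, φ k ω ∂P = 0 := fun k => by
    have h1 := ((hsym k).comp (u := fun y => y - clip (t k) y)
      (by have := hcm k; fun_prop)).integral_eq
    simp only [Function.comp_def, clip_neg (ht0 k)] at h1
    have h2 : ∀ ω, -g k ω - -clip (t k) (g k ω) = -φ k ω := fun ω => by simp only [hφ]; ring
    simp only [h2, integral_neg] at h1
    change ∫ ω, φ k ω ∂P = _ at h1
    linarith
  have hsum : MemLp (∑ k, φ k) 2 P := memLp_finsetSum' _ fun k _ => hmem k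
  have hsum0 : ∫ ω, (∑ k, φ k) ω ∂P = 0 := by
    simp only [Finset.sum_apply]
    rw [integral_finsetSum _ fun k _ => (hmem k).integrable (by norm_num)]
    simp [hmean]
  have hvar := IndepFun.variance_sum (s := Finset.univ) (fun k _ => hmem k)
    (fun i _ j _ hij => hφind.indepFun hij)
  rw [variance_of_integral_eq_zero hsum.aemeasurable hsum0] at hvar
  have hvar2 : ∀ k, variance (φ k) P ≤ 4 / a ^ 2 * Real.exp (a ^ 2 * V / 2 - a * T) := fun k => by
    rw [variance_of_integral_eq_zero (hφm k).aemeasurable (hmean k)]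
    refine (exceedance_sq_integral_le (hg k) (ht0 k) ha).trans ?_
    gcongr
    exact ht k
  have hint : Integrable (fun ω => (∑ k, φ k ω) ^ 2) P := by
    have := hsum.integrable_sq
    simpa only [Finset.sum_apply] using this
  rw [← ofReal_integral_eq_lintegral_ofReal hint (ae_of_all _ fun ω => sq_nonneg _)]
  refine ENNReal.ofReal_le_ofReal ?_
  simp only [Finset.sum_apply] at hvar
  rw [hvar]
  refine (Finset.sum_le_sum fun k _ => hvar2 k).trans ?_
  rw [Finset.sum_const, nsmul_eq_mul, Finset.card_univ]

lemma sum_clip_tail [IsProbabilityMeasure P]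
    {κ : Type*} [Fintype κ] {g : κ → Ω → ℝ} {V : ℝ≥0}
    (hind : iIndepFun g P) (hg : ∀ k, HasSubgaussianMGF (g k) V P)
    (hsym : ∀ k, IdentDistrib (g k) (fun ω => -g k ω) P P) {t : κ → ℝ} (ht : ∀ k, 0 ≤ t k)
    {W x : ℝ} (hW : Fintype.card κ * (V : ℝ) ≤ W) (hx : 0 < x) :
    P {ω | √(2 * W * x) < |∑ k, clip (t k) (g k ω)|} ≤ ENNReal.ofReal (2 * Real.exp (-x)) := by
  have hind' : iIndepFun (fun k ω => clip (t k) (g k ω)) P :=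
    hind.comp (fun k y => clip (t k) y) fun k => measurable_clip (t k)
  have h := HasSubgaussianMGF.sum_of_iIndepFun hind' (s := Finset.univ) (fun k _ =>
    odd_contraction_subgaussian (hg k) (hsym k) (measurable_clip (t k)) (clip_neg (ht k))
      (abs_clip_le_abs (ht k)))
  refine subgaussian_abs_tail h ?_ hx
  simpa using hW

/-- Bounds for the conditional law given an independent variable hold unconditionally. -/
lemma measure_le_of_forall_section [IsProbabilityMeasure P]
    {A B : Type*} [MeasurableSpace A] [MeasurableSpace B]
    {X : Ω → A} {Y : Ω → B} (hX : Measurable X) (hY : Measurable Y) (hind : IndepFun X Y P)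
    {S : Set (A × B)} (hS : MeasurableSet S) {ε : ℝ≥0∞}
    (h : ∀ a, P {ω | (a, Y ω) ∈ S} ≤ ε) : P {ω | (X ω, Y ω) ∈ S} ≤ ε := by
  have h1 := (indepFun_iff_map_prod_eq_prod_map_map hX.aemeasurable hY.aemeasurable).1 hind
  have hpX : IsProbabilityMeasure (P.map X) := Measure.isProbabilityMeasure_map hX.aemeasurable
  have hpY : IsProbabilityMeasure (P.map Y) := Measure.isProbabilityMeasure_map hY.aemeasurable
  have h2 : P {ω | (X ω, Y ω) ∈ S} = (P.map fun ω => (X ω, Y ω)) S :=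
    (Measure.map_apply (hX.prodMk hY) hS).symm
  rw [h2, h1, Measure.prod_apply hS]
  calc ∫⁻ a, P.map Y (Prod.mk a ⁻¹' S) ∂P.map X ≤ ∫⁻ _a, ε ∂P.map X := lintegral_mono fun a => by
        rw [Measure.map_apply hY (measurable_prodMk_left hS)]; exact h a
    _ = ε := by simp

lemma markov_ofReal {f : Ω → ℝ} (hf : Measurable f) {b c : ℝ} (hc : 0 < c)
    (h : ∫⁻ ω, ENNReal.ofReal (f ω) ∂P ≤ ENNReal.ofReal b) :
    P {ω | c < f ω} ≤ ENNReal.ofReal (b / c) := by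
  have h1 := mul_meas_ge_le_lintegral (μ := P) (f := fun ω => ENNReal.ofReal (f ω)) (by fun_prop)
    (ENNReal.ofReal c)
  rw [ENNReal.ofReal_div_of_pos hc, ENNReal.le_div_iff_mul_le (by simp [hc]) (by simp)]
  rw [mul_comm]
  refine le_trans ?_ (h1.trans h)
  gcongr
  intro hω
  exact ENNReal.ofReal_le_ofReal (le_of_lt hω)

end Errors

end TransFusion

namespace TransFusion

/-! ## Linear forms in the errors with coefficients that depend on the design -/

section Conditional

variable {Ω : Type*} [MeasurableSpace Ω] {P : Measure Ω} [IsProbabilityMeasure P]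
  {A : Type*} [MeasurableSpace A] {D : Ω → A} {σ2 : ℝ≥0}

/-- The bound on the coefficients belongs to the event because it holds for some designs only; for
the others the section is empty. -/
lemma conditional_linear_form_tail {ι : Type*} [Fintype ι] {e : ι → Ω → ℝ} (hD : Measurable D)
    (he : ∀ i, Measurable (e i)) (hDe : IndepFun D (fun ω i => e i ω) P) (hind : iIndepFun e P)
    (hsub : ∀ i, HasSubgaussianMGF (e i) σ2 P) {w : A → ι → ℝ} (hw : Measurable w)
    (V : ℝ) {x : ℝ} (hx : 0 < x) :
    P {ω | ∑ i, w (D ω) i ^ 2 ≤ V ∧ √(2 * (σ2 * V) * x) < |∑ i, w (D ω) i * e i ω|} ≤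
      ENNReal.ofReal (2 * Real.exp (-x)) := by
  have hwi : ∀ i, Measurable fun a => w a i := fun i => (measurable_pi_apply i).comp hw
  let S : Set (A × (ι → ℝ)) :=
    {q | ∑ i, w q.1 i ^ 2 ≤ V ∧ √(2 * (σ2 * V) * x) < |∑ i, w q.1 i * q.2 i|}
  have hS : MeasurableSet S := by
    have h1 : MeasurableSet {q : A × (ι → ℝ) | ∑ i, w q.1 i ^ 2 ≤ V} := by
      refine measurableSet_le ?_ measurable_const
      exact Finset.measurable_fun_sum _ fun i _ => ((hwi i).comp measurable_fst).pow_const 2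
    have h2 : MeasurableSet
        {q : A × (ι → ℝ) | √(2 * (σ2 * V) * x) < |∑ i, w q.1 i * q.2 i|} := by
      refine measurableSet_lt measurable_const ?_
      exact (Finset.measurable_fun_sum _ fun i _ => ((hwi i).comp measurable_fst).mul
        ((measurable_pi_apply i).comp measurable_snd)).abs
    exact h1.inter h2
  refine measure_le_of_forall_section hD (by fun_prop) hDe hS fun a => ?_
  by_cases ha : ∑ i, w a i ^ 2 ≤ V
  · have hV : 0 ≤ V := (Finset.sum_nonneg fun i _ => sq_nonneg (w a i)).trans ha
    have h := linear_form_subgaussian hind hsub (w a) (V := σ2 * V.toNNReal) (by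
      rw [NNReal.coe_mul, Real.coe_toNNReal _ hV]; exact mul_le_mul_of_nonneg_left ha σ2.2)
    refine le_trans (measure_mono ?_) (subgaussian_abs_tail h (V := σ2 * V)
      (by rw [NNReal.coe_mul, Real.coe_toNNReal _ hV]) hx)
    exact fun ω hω => hω.2
  · have : {ω : Ω | (a, fun i => e i ω) ∈ S} = ∅ := by
      ext ω; simp only [S, Set.mem_ofPred_eq, Set.mem_empty_iff_false, iff_false]; tauto
    rw [this]; simp

variable {κ ι : Type*} [Fintype κ] [Fintype ι] {e : κ × ι → Ω → ℝ}

lemma iIndepFun_linear_forms {κ ι : Type*} [Fintype ι] {e : κ × ι → Ω → ℝ}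
    (he : ∀ q, Measurable (e q)) (hind : iIndepFun e P)
    (w : κ → ι → ℝ) : iIndepFun (fun k ω => ∑ i, w k i * e (k, i) ω) P :=
  (iIndepFun_curry he hind).comp (fun k y => ∑ i, w k i * y i) fun k => by fun_prop

/-- Here the coefficients are bounded for every design; `scoreDirection` is truncated for this
reason. -/
lemma conditional_sum_clip_tail (hD : Measurable D) (he : ∀ q, Measurable (e q))
    (hDe : IndepFun D (fun ω q => e q ω) P) (hind : iIndepFun e P)
    (hsub : ∀ q, HasSubgaussianMGF (e q) σ2 P)
    (hsym : ∀ q, IdentDistrib (e q) (fun ω => -e q ω) P P)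
    {w : A → κ → ι → ℝ} (hw : Measurable w) {V : ℝ} (hV : ∀ a k, ∑ i, w a k i ^ 2 ≤ V)
    {t : κ → ℝ} (ht : ∀ k, 0 ≤ t k) {x : ℝ} (hx : 0 < x) :
    P {ω | √(2 * (Fintype.card κ * (σ2 * V)) * x) <
        |∑ k, clip (t k) (∑ i, w (D ω) k i * e (k, i) ω)|} ≤
      ENNReal.ofReal (2 * Real.exp (-x)) := by
  have hwi : ∀ k i, Measurable fun a => w a k i := fun k i => by fun_prop
  let S : Set (A × (κ × ι → ℝ)) := {q | √(2 * (Fintype.card κ * (σ2 * V)) * x) <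
    |∑ k, clip (t k) (∑ i, w q.1 k i * q.2 (k, i))|}
  have hS : MeasurableSet S := by
    refine measurableSet_lt measurable_const ?_
    exact (Finset.measurable_fun_sum _ fun k _ => (measurable_clip (t k)).comp
      (Finset.measurable_fun_sum _ fun i _ => ((hwi k i).comp measurable_fst).mul
        ((measurable_pi_apply (k, i)).comp measurable_snd))).abs
  refine measure_le_of_forall_section hD (by fun_prop) hDe hS fun a => ?_
  rcases isEmpty_or_nonempty κ with hκ | ⟨⟨k0⟩⟩
  · have : {ω : Ω | (a, fun q => e q ω) ∈ S} = ∅ := by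
      ext ω; simp [S]
    rw [this]; simp
  have hV0 : 0 ≤ V := (Finset.sum_nonneg fun i _ => sq_nonneg (w a k0 i)).trans (hV a k0)
  have hindk : ∀ k, iIndepFun (fun i => e (k, i)) P := fun k =>
    hind.precomp (g := fun i => (k, i)) fun i j hij => by simpa using hij
  exact sum_clip_tail (V := σ2 * V.toNNReal) (iIndepFun_linear_forms he hind (w a))
    (fun k => linear_form_subgaussian (hindk k) (fun i => hsub _) (w a k) (by
      rw [NNReal.coe_mul, Real.coe_toNNReal _ hV0]; exact mul_le_mul_of_nonneg_left (hV a k) σ2.2))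
    (fun k => linear_form_identDistrib_neg (hindk k) (fun i => he _) (fun i => hsym _) (w a k))
    ht (by rw [NNReal.coe_mul, Real.coe_toNNReal _ hV0]) hx

lemma conditional_sum_exceedance_tail {p : ℕ} (hD : Measurable D) (he : ∀ q, Measurable (e q))
    (hDe : IndepFun D (fun ω q => e q ω) P) (hind : iIndepFun e P)
    (hsub : ∀ q, HasSubgaussianMGF (e q) σ2 P)
    (hsym : ∀ q, IdentDistrib (e q) (fun ω => -e q ω) P P)
    {w : A → Fin p → κ → ι → ℝ} (hw : Measurable w) {V : ℝ} (hV0 : 0 ≤ V)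
    (hV : ∀ a j k, ∑ i, w a j k i ^ 2 ≤ V)
    {t : κ → ℝ} {T a c : ℝ} (hT : 0 ≤ T) (ht : ∀ k, T ≤ t k) (ha : 0 < a) (hc : 0 < c) :
    P {ω | c < ∑ j, (∑ k, (∑ i, w (D ω) j k i * e (k, i) ω -
        clip (t k) (∑ i, w (D ω) j k i * e (k, i) ω))) ^ 2} ≤
      ENNReal.ofReal (p * (Fintype.card κ *
        (4 / a ^ 2 * Real.exp (a ^ 2 * (σ2 * V) / 2 - a * T))) / c) := by
  have hwi : ∀ j k i, Measurable fun a => w a j k i := fun j k i => by fun_prop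
  have hcm := fun k => measurable_clip (t k)
  let S : Set (A × (κ × ι → ℝ)) := {q | c < ∑ j, (∑ k, (∑ i, w q.1 j k i * q.2 (k, i) -
        clip (t k) (∑ i, w q.1 j k i * q.2 (k, i)))) ^ 2}
  have hS : MeasurableSet S := by
    refine measurableSet_lt measurable_const ?_
    have hlin : ∀ j k, Measurable fun q : A × (κ × ι → ℝ) => ∑ i, w q.1 j k i * q.2 (k, i) :=
      fun j k => Finset.measurable_fun_sum _ fun i _ => ((hwi j k i).comp measurable_fst).mul
        ((measurable_pi_apply (k, i)).comp measurable_snd)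
    exact Finset.measurable_fun_sum _ fun j _ => (Finset.measurable_fun_sum _ fun k _ =>
      (hlin j k).sub ((hcm k).comp (hlin j k))).pow_const 2
  refine measure_le_of_forall_section hD (by fun_prop) hDe hS fun b => ?_
  have hindk : ∀ k, iIndepFun (fun i => e (k, i)) P := fun k =>
    hind.precomp (g := fun i => (k, i)) fun i j hij => by simpa using hij
  have hm : ∀ j k, Measurable fun ω => ∑ i, w b j k i * e (k, i) ω := fun j k => by fun_prop
  have hm2 : ∀ j, Measurable fun ω => (∑ k, (∑ i, w b j k i * e (k, i) ω -
      clip (t k) (∑ i, w b j k i * e (k, i) ω))) ^ 2 := fun j =>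
    (Finset.measurable_fun_sum _ fun k _ => (hm j k).sub ((hcm k).comp (hm j k))).pow_const 2
  refine markov_ofReal (Finset.measurable_fun_sum _ fun j _ => hm2 j) hc ?_
  have hsum : ∀ ω, ENNReal.ofReal (∑ j, (∑ k, (∑ i, w b j k i * e (k, i) ω -
      clip (t k) (∑ i, w b j k i * e (k, i) ω))) ^ 2) =
      ∑ j, ENNReal.ofReal ((∑ k, (∑ i, w b j k i * e (k, i) ω -
      clip (t k) (∑ i, w b j k i * e (k, i) ω))) ^ 2) := fun ω =>
    ENNReal.ofReal_sum_of_nonneg fun j _ => sq_nonneg _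
  simp only [hsum]
  rw [lintegral_finsetSum _ fun j _ => (hm2 j).ennreal_ofReal]
  have hj := fun j => sum_exceedance_sq_le (V := σ2 * V.toNNReal)
    (iIndepFun_linear_forms he hind (w b j)) (hm j)
    (fun k => linear_form_subgaussian (hindk k) (fun i => hsub _) (w b j k) (by
      rw [NNReal.coe_mul, Real.coe_toNNReal _ hV0]; exact mul_le_mul_of_nonneg_left (hV b j k)
          σ2.2))
    (fun k => linear_form_identDistrib_neg (hindk k) (fun i => he _) (fun i => hsym _) (w b j k))
    hT ht ha
  refine (Finset.sum_le_sum fun j _ => hj j).trans ?_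
  rw [Finset.sum_const, Finset.card_univ, Fintype.card_fin, nsmul_eq_mul,
    ENNReal.ofReal_mul (Nat.cast_nonneg p), ENNReal.ofReal_natCast, NNReal.coe_mul,
        Real.coe_toNNReal _ hV0]

lemma conditional_sum_sq_tail {J : Type*} [Fintype J] (hD : Measurable D) {e : J → ι → Ω → ℝ}
    (he : ∀ j i, Measurable (e j i)) (hDe : IndepFun D (fun ω j i => e j i ω) P)
    (hind : ∀ j, iIndepFun (e j) P)
    (hsub : ∀ j i, HasSubgaussianMGF (e j i) σ2 P) {w : A → J → ι → ℝ} (hw : Measurable w)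
    {V c : ℝ} (hV0 : 0 ≤ V) (hc : 0 < c) :
    P {ω | (∀ j, ∑ i, w (D ω) j i ^ 2 ≤ V) ∧ c < ∑ j, (∑ i, w (D ω) j i * e j i ω) ^ 2} ≤
      ENNReal.ofReal (Fintype.card J * (4 * (σ2 * V)) / c) := by
  have hwi : ∀ j i, Measurable fun a => w a j i := fun j i => by fun_prop
  let S : Set (A × (J → ι → ℝ)) := {q | (∀ j, ∑ i, w q.1 j i ^ 2 ≤ V) ∧
    c < ∑ j, (∑ i, w q.1 j i * q.2 j i) ^ 2}
  have hS : MeasurableSet S := by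
    have h2 : MeasurableSet {q : A × (J → ι → ℝ) | c < ∑ j, (∑ i, w q.1 j i * q.2 j i) ^ 2} := by
      refine measurableSet_lt measurable_const ?_
      exact Finset.measurable_fun_sum _ fun j _ => (Finset.measurable_fun_sum _ fun i _ =>
        ((hwi j i).comp measurable_fst).mul ((measurable_pi_apply i).comp
          ((measurable_pi_apply j).comp measurable_snd))).pow_const 2
    have h1 : MeasurableSet {q : A × (J → ι → ℝ) | ∀ j, ∑ i, w q.1 j i ^ 2 ≤ V} := by
      have h : MeasurableSet (⋂ j, {q : A × (J → ι → ℝ) | ∑ i, w q.1 j i ^ 2 ≤ V}) :=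
        MeasurableSet.iInter fun j => measurableSet_le (Finset.measurable_fun_sum _ fun i _ =>
          ((hwi j i).comp measurable_fst).pow_const 2) measurable_const
      rwa [← Set.ofPred_forall] at h
    exact h1.inter h2
  refine measure_le_of_forall_section hD (by fun_prop) hDe hS fun a => ?_
  by_cases ha : ∀ j, ∑ i, w a j i ^ 2 ≤ V
  swap
  · have : {ω : Ω | (a, fun j i => e j i ω) ∈ S} = ∅ := by
      ext ω; simp only [S, Set.mem_ofPred_eq, Set.mem_empty_iff_false, iff_false]; tauto
    rw [this]; simp
  have hm : ∀ j, Measurable fun ω => (∑ i, w a j i * e j i ω) ^ 2 := fun j => by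
    have := he j; fun_prop
  refine le_trans (measure_mono fun ω hω => hω.2) (markov_ofReal
    (f := fun ω => ∑ j, (∑ i, w a j i * e j i ω) ^ 2)
    (Finset.measurable_fun_sum _ fun j _ => hm j) hc ?_)
  have hsum : ∀ ω, ENNReal.ofReal (∑ j, (∑ i, w a j i * e j i ω) ^ 2) =
      ∑ j, ENNReal.ofReal ((∑ i, w a j i * e j i ω) ^ 2) := fun ω =>
    ENNReal.ofReal_sum_of_nonneg fun j _ => sq_nonneg _
  simp only [hsum]
  rw [lintegral_finsetSum _ fun j _ => (hm j).ennreal_ofReal]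
  have hj := fun j => subgaussian_sq_integral_le
    (linear_form_subgaussian (hind j) (hsub j) (w a j) (V := σ2 * V.toNNReal) (by
      rw [NNReal.coe_mul, Real.coe_toNNReal _ hV0]; exact mul_le_mul_of_nonneg_left (ha j) σ2.2))
  refine (Finset.sum_le_sum fun j _ => hj j).trans ?_
  rw [Finset.sum_const, Finset.card_univ, nsmul_eq_mul,
    ENNReal.ofReal_mul (Nat.cast_nonneg _), ENNReal.ofReal_natCast, NNReal.coe_mul,
        Real.coe_toNNReal _ hV0]

end Conditional

end TransFusion

namespace TransFusion

/-! ## Matrices with bounded eigenvalues -/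

section Matrices

variable {p : ℕ} {A : Matrix (Fin p) (Fin p) ℝ}

lemma posSemidef_of_spectrum (hA : A.IsHermitian) (h : ∀ r ∈ spectrum ℝ A, 0 ≤ r)
    (u : Fin p → ℝ) : 0 ≤ u ⬝ᵥ (A *ᵥ u) := by
  have h1 : A.PosSemidef := hA.posSemidef_iff_eigenvalues_nonneg.2 fun i =>
    h _ (hA.eigenvalues_mem_spectrum_real i)
  simpa using (Matrix.posSemidef_iff_dotProduct_mulVec.1 h1).2 u

/-- Shifting by `-a` moves the spectrum into the nonnegative reals, and a Hermitian matrix with such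
a spectrum is positive semidefinite. -/
lemma quadForm_ge_of_spectrum (hA : Aᵀ = A) {a b : ℝ} (h : spectrum ℝ A ⊆ Set.Icc a b)
    (u : Fin p → ℝ) : a * sqNorm u ≤ u ⬝ᵥ (A *ᵥ u) := by
  have hA' : A.IsHermitian := by rwa [Matrix.IsHermitian,
      Matrix.conjTranspose_eq_transpose_of_trivial]
  have hs : (algebraMap ℝ (Matrix (Fin p) (Fin p) ℝ) (-a)).IsHermitian := by
    rw [Matrix.IsHermitian, Matrix.conjTranspose_eq_transpose_of_trivial,
        Matrix.algebraMap_eq_diagonal]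
    exact Matrix.diagonal_transpose _
  have h1 := posSemidef_of_spectrum (hs.add hA') (fun r hr => by
    rw [← spectrum.singleton_add_eq] at hr
    obtain ⟨_, rfl, t, ht, rfl⟩ := hr
    have := (h ht).1
    simp only
    linarith) u
  rw [Matrix.add_mulVec, dotProduct_add, Algebra.algebraMap_eq_smul_one, Matrix.smul_mulVec,
    Matrix.one_mulVec, dotProduct_smul, dotProduct_self_eq, smul_eq_mul] at h1
  linarith

/-- Solutions of `A θ = eⱼ` for coercive `A`. -/
lemma exists_mulVec_eq_single {c : ℝ} (hc : 0 < c)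
    (h : ∀ u, 1 / c * sqNorm u ≤ u ⬝ᵥ (A *ᵥ u)) (j : Fin p) :
    ∃ θ : Fin p → ℝ, A *ᵥ θ = Pi.single j 1 ∧ sqNorm θ ≤ c ^ 2 ∧ θ ⬝ᵥ (A *ᵥ θ) ≤ c := by
  have hinj : Function.Injective A.mulVecLin := by
    rw [← LinearMap.ker_eq_bot, LinearMap.ker_eq_bot']
    intro u hu
    have h1 := h u
    rw [Matrix.mulVecLin_apply] at hu
    rw [hu, dotProduct_zero] at h1
    refine sqNorm_eq_zero (le_antisymm ?_ (sqNorm_nonneg u))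
    have : 0 < 1 / c := by positivity
    nlinarith
  obtain ⟨θ, hθ⟩ := (LinearMap.injective_iff_surjective.1 hinj) (Pi.single j 1)
  rw [Matrix.mulVecLin_apply] at hθ
  have h1 := h θ
  -- Coercivity gives `θ j ^ 2 ≤ sqNorm θ ≤ c * θ j`, hence `θ j ≤ c`, and both bounds follow.
  have h2 : θ ⬝ᵥ (A *ᵥ θ) = θ j := by rw [hθ]; simp
  have h3 : θ j ^ 2 ≤ sqNorm θ := sq_apply_le_sqNorm θ j
  rw [h2] at h1
  have h4 : sqNorm θ ≤ c * θ j := by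
    have := mul_le_mul_of_nonneg_left h1 hc.le
    rwa [← mul_assoc, mul_one_div_cancel hc.ne', one_mul] at this
  have h0 := sqNorm_nonneg θ
  have h5 : θ j ≤ c := by
    by_contra hlt
    rw [not_le] at hlt
    nlinarith
  refine ⟨θ, hθ, ?_, by rw [h2]; exact h5⟩
  nlinarith

end Matrices

/-! ## Unions of events -/

section Unions

variable {Ω : Type*} [MeasurableSpace Ω] {P : Measure Ω}

lemma measure_exists_le {ι : Type*} [Fintype ι] {S : ι → Set Ω} {a : ℝ}
    (h : ∀ i, P (S i) ≤ ENNReal.ofReal a) :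
    P {ω | ∃ i, ω ∈ S i} ≤ ENNReal.ofReal (Fintype.card ι * a) := by
  have : {ω | ∃ i, ω ∈ S i} = ⋃ i, S i := by ext; simp
  rw [this, ENNReal.ofReal_mul (Nat.cast_nonneg _), ENNReal.ofReal_natCast]
  refine (measure_iUnion_fintype_le P S).trans ((Finset.sum_le_sum fun i _ => h i).trans ?_)
  rw [Finset.sum_const, Finset.card_univ, nsmul_eq_mul]

lemma measure_le_add {S T U : Set Ω} {a b : ℝ} (hS : P S ≤ ENNReal.ofReal a)
    (hT : P T ≤ ENNReal.ofReal b) (ha : 0 ≤ a) (hb : 0 ≤ b) (hU : U ⊆ S ∪ T) :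
    P U ≤ ENNReal.ofReal (a + b) := by
  rw [ENNReal.ofReal_add ha hb]
  exact (measure_mono hU).trans ((measure_union_le _ _).trans (add_le_add hS hT))

/-- With probability at least `1 - ε / r`, at most `r K` of `K` events of probability at most `ε`
occur. -/
lemma measure_card_gt_le {K : ℕ} {S : Fin K → Set Ω} {ε r : ℝ} (hr : 0 < r) (hK : 0 < K)
    (h : ∀ k, P (S k) ≤ ENNReal.ofReal ε) :
    P {ω | ¬ ∃ good : Finset (Fin K), (goodᶜ.card : ℝ) ≤ r * K ∧ ∀ k ∈ good, ω ∉ S k} ≤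
      ENNReal.ofReal (ε / r) := by
  classical
  -- Markov's inequality for the number of events that occur. No measurability is assumed, so the
  -- events are replaced by measurable hulls of the same measure.
  let f : Ω → ℝ≥0∞ := fun ω => ∑ k, (toMeasurable P (S k)).indicator 1 ω
  have hf : Measurable f := Finset.measurable_fun_sum _ fun k _ =>
    measurable_one.indicator (measurableSet_toMeasurable _ _)
  have h1 : ∫⁻ ω, f ω ∂P ≤ K * ENNReal.ofReal ε := by
    simp only [f]
    rw [lintegral_finsetSum _ fun k _ => measurable_one.indicator (measurableSet_toMeasurable _ _)]
    simp only [lintegral_indicator_one (measurableSet_toMeasurable P _), measure_toMeasurable]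
    refine (Finset.sum_le_sum fun k _ => h k).trans (le_of_eq ?_)
    simp
  have h2 := mul_meas_ge_le_lintegral (μ := P) hf (ENNReal.ofReal (r * K))
  have hrK : 0 < r * K := by positivity
  have h3 : {ω | ¬ ∃ good : Finset (Fin K), (goodᶜ.card : ℝ) ≤ r * K ∧ ∀ k ∈ good, ω ∉ S k} ⊆
      {ω | ENNReal.ofReal (r * K) ≤ f ω} := by
    intro ω hω
    simp only [Set.mem_ofPred_eq] at hω ⊢
    by_contra hlt
    refine hω ⟨Finset.univ.filter fun k => ω ∉ S k, ?_, fun k hk => (Finset.mem_filter.1 hk).2⟩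
    have h4 : ((Finset.univ.filter fun k => ω ∉ S k)ᶜ.card : ℝ≥0∞) ≤ f ω := by
      rw [Finset.card_eq_sum_ones, Nat.cast_sum]
      simp only [f, Nat.cast_one]
      refine (Finset.sum_le_sum fun k hk => ?_).trans
        (Finset.sum_le_sum_of_subset (Finset.subset_univ _))
      have hk' : ω ∈ S k := by simpa using hk
      rw [Set.indicator_of_mem (subset_toMeasurable P _ hk')]
      rfl
    have h5 := h4.trans (not_le.1 hlt).le
    rw [← ENNReal.ofReal_natCast] at h5
    exact (ENNReal.ofReal_le_ofReal_iff hrK.le).1 h5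
  refine (measure_mono h3).trans ?_
  have h6 := h2.trans h1
  have h7 : ε / r = K * ε / (r * K) := by field_simp
  rw [h7, ENNReal.ofReal_div_of_pos hrK, ENNReal.le_div_iff_mul_le (by simp [hrK]) (by simp),
    mul_comm, ENNReal.ofReal_mul (Nat.cast_nonneg _), ENNReal.ofReal_natCast]
  exact h6

end Unions

/-! ## Sub-Gaussian designs -/

section Designs

variable {Ω : Type*} [MeasurableSpace Ω] {P : Measure Ω} {p K nS nT : ℕ}
  {x : Obs K nS nT → Ω → Fin p → ℝ} {Sig : Fin (K + 1) → Matrix (Fin p) (Fin p) ℝ} {B : ℝ≥0}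

lemma SubGaussianDesigns.mono {cL : ℝ} {κ : ℝ≥0} (h : SubGaussianDesigns P x Sig cL κ)
    (h0 : 0 < cL) (hc : cL ≤ B) (hκ : κ ≤ B) : SubGaussianDesigns P x Sig B B where
  measurable := h.measurable
  indep := h.indep
  subgaussian o u hu := HasSubgaussianMGF.mono (h.subgaussian o u hu) hκ
  mean := h.mean
  cov := h.cov
  eigenvalues k := (h.eigenvalues k).trans
    (Set.Icc_subset_Icc (one_div_le_one_div_of_le h0 hc) hc)

lemma GaussianErrors.mono {e : Obs K nS nT → Ω → ℝ} {σ2 : ℝ≥0} (h : GaussianErrors P x e σ2)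
    (hσ : σ2 ≤ B) : GaussianErrors P x e B where
  measurable := h.measurable
  indep := h.indep
  gaussian o := by obtain ⟨v, hv, hl⟩ := h.gaussian o; exact ⟨v, hv.trans hσ, hl⟩
  indep_design := h.indep_design

lemma SubGaussianDesigns.transpose_eq (hx : SubGaussianDesigns P x Sig B B) (o : Obs K nS nT) :
    (Sig (task o))ᵀ = Sig (task o) := by
  ext i j
  rw [Matrix.transpose_apply, ← hx.cov, ← hx.cov]
  simp only [mul_comm]

/-- The symmetry of `Sig (task o)` is read off from the second moments of the observation `o`; a
task without observations would not provide it. -/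
lemma SubGaussianDesigns.quadForm_ge (hx : SubGaussianDesigns P x Sig B B) (o : Obs K nS nT)
    (u : Fin p → ℝ) : 1 / (B : ℝ) * sqNorm u ≤ u ⬝ᵥ (Sig (task o) *ᵥ u) :=
  quadForm_ge_of_spectrum (hx.transpose_eq o) (hx.eigenvalues _) u

variable [IsProbabilityMeasure P]

lemma SubGaussianDesigns.form_subgaussian (hx : SubGaussianDesigns P x Sig B B) (o : Obs K nS nT)
    {u : Fin p → ℝ} {q : ℝ≥0}
    (hu : sqNorm u ≤ q) : HasSubgaussianMGF (fun ω => u ⬝ᵥ x o ω) (B * q) P := by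
  rcases eq_or_lt_of_le (sqNorm_nonneg u) with h0 | h0
  · have hu0 : u = 0 := sqNorm_eq_zero h0.symm
    subst hu0
    simp only [zero_dotProduct]
    exact HasSubgaussianMGF.mono HasSubgaussianMGF.fun_zero (by positivity)
  · set r := √(sqNorm u) with hr
    have hr0 : 0 < r := Real.sqrt_pos.2 h0
    have hr2 : r ^ 2 = sqNorm u := Real.sq_sqrt h0.le
    have h1 := (hx.subgaussian o (r⁻¹ • u) (by
      rw [sqNorm_smul, ← hr2, inv_pow, inv_mul_cancel₀ (by positivity)])).const_mul r
    have h2 : (fun ω => r * ((r⁻¹ • u) ⬝ᵥ x o ω)) = fun ω => u ⬝ᵥ x o ω := by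
      funext ω
      rw [smul_dotProduct, smul_eq_mul, mul_inv_cancel_left₀ hr0.ne']
    rw [h2] at h1
    refine HasSubgaussianMGF.mono h1 ?_
    refine (mul_comm _ _).le.trans (mul_le_mul_of_nonneg_left ?_ (zero_le (a := B)))
    exact (show r ^ 2 ≤ (q : ℝ) by rw [hr2]; exact hu)

lemma SubGaussianDesigns.integrable_mul (hx : SubGaussianDesigns P x Sig B B) (o : Obs K nS nT)
    (i j : Fin p) :
    Integrable (fun ω => x o ω i * x o ω j) P := by
  have h : ∀ i, MemLp (fun ω => x o ω i) 2 P := fun i => by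
    have := (hx.form_subgaussian o (u := Pi.single i 1) (q := 1) (by
      simp [sqNorm, Pi.single_apply])).memLp 2
    simpa using this
  exact (h i).integrable_mul (h j)

lemma SubGaussianDesigns.integral_form_mul (hx : SubGaussianDesigns P x Sig B B) (o : Obs K nS nT)
    (u v : Fin p → ℝ) :
    ∫ ω, (u ⬝ᵥ x o ω) * (v ⬝ᵥ x o ω) ∂P = u ⬝ᵥ (Sig (task o) *ᵥ v) := by
  have h1 : ∀ ω, (u ⬝ᵥ x o ω) * (v ⬝ᵥ x o ω) = ∑ i, ∑ j, u i * v j * (x o ω i * x o ω j) :=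
    fun ω => by
      simp only [dotProduct, Finset.sum_mul_sum]
      exact Finset.sum_congr rfl fun i _ => Finset.sum_congr rfl fun j _ => by ring
  simp only [h1]
  rw [integral_finsetSum _ fun i _ => integrable_finsetSum _ fun j _ =>
    (hx.integrable_mul o i j).const_mul _]
  simp only [dotProduct, Matrix.mulVec]
  refine Finset.sum_congr rfl fun i _ => ?_
  rw [integral_finsetSum _ fun j _ => (hx.integrable_mul o i j).const_mul _, Finset.mul_sum]
  refine Finset.sum_congr rfl fun j _ => ?_
  rw [integral_const_mul, hx.cov]
  ring

/-- Diagonal entries of the covariance matrices: a crude bound from sub-Gaussianity. -/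
lemma SubGaussianDesigns.diag_le (hx : SubGaussianDesigns P x Sig B B) (o : Obs K nS nT)
    (j : Fin p) :
    Sig (task o) j j ≤ 4 * B := by
  have h := subgaussian_sq_integral_le (hx.form_subgaussian o (u := Pi.single j 1) (q := 1) (by
      simp [sqNorm, Pi.single_apply]))
  rw [mul_one] at h
  simp only [single_dotProduct, one_mul] at h
  rw [← hx.cov o]
  have hi := hx.integrable_mul o j j
  simp only [← sq] at hi ⊢
  rw [← ofReal_integral_eq_lintegral_ofReal hi (ae_of_all _ fun ω => sq_nonneg _)] at h
  exact (ENNReal.ofReal_le_ofReal_iff (by positivity)).1 h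

/-- A product of two sub-Gaussian forms is sub-exponential, so this is Bernstein's inequality around
the population form. -/
lemma SubGaussianDesigns.form_deviation (hx : SubGaussianDesigns P x Sig B B) 
    {m : ℕ} {f : Fin m → Obs K nS nT}
    (hf : Function.Injective f) {k : Fin (K + 1)} (hk : ∀ i, task (f i) = k)
    {u v : Fin p → ℝ} {q : ℝ≥0} (hu : sqNorm u ≤ q) (hv : sqNorm v ≤ q) (hB : 0 < B) (hq : 0 < q)
    {y : ℝ} (hy : 0 < y) :
    P {ω | 64 * (B * q) * (√(m * y) + y) <
        |∑ i, (u ⬝ᵥ x (f i) ω) * (v ⬝ᵥ x (f i) ω) - m * (u ⬝ᵥ (Sig k *ᵥ v))|} ≤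
      ENNReal.ofReal (2 * Real.exp (-y)) := by
  have hxm := hx.measurable
  have hmeas : ∀ (u : Fin p → ℝ) o, Measurable fun ω => u ⬝ᵥ x o ω := fun u o => by
    have := hxm o
    unfold dotProduct
    fun_prop
  have hint : ∀ i, ∫ ω, (u ⬝ᵥ x (f i) ω) * (v ⬝ᵥ x (f i) ω) ∂P = u ⬝ᵥ (Sig k *ᵥ v) :=
    fun i => by rw [hx.integral_form_mul, hk]
  have hind : iIndepFun (fun i ω => (u ⬝ᵥ x (f i) ω) * (v ⬝ᵥ x (f i) ω) -
      u ⬝ᵥ (Sig k *ᵥ v)) P :=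
    (hx.indep.precomp hf).comp (fun _ z => (u ⬝ᵥ z) * (v ⬝ᵥ z) - u ⬝ᵥ (Sig k *ᵥ v)) fun _ => by
      unfold dotProduct; fun_prop
  have h := bernstein hind (fun i => ((hmeas u _).mul (hmeas v _)).sub_const _)
    (c := B * q) (by positivity) (fun i t ht => by
      have := product_mgf_le (hx.form_subgaussian (f i) hu) (hx.form_subgaussian (f i) hv)
        (hmeas u _) (hmeas v _) (by positivity) (t := t) (by push_cast; exact ht)
      rw [hint] at this
      push_cast at this
      exact this) Finset.univ (Finset.card_fin m) hy
  refine le_trans (measure_mono fun ω hω => ?_) h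
  simp only [Set.mem_ofPred_eq, Finset.sum_sub_distrib, Finset.sum_const, Finset.card_fin,
    nsmul_eq_mul] at hω ⊢
  exact hω

end Designs

end TransFusion

namespace TransFusion

/-! ## Regular source samples -/

section Score

variable {n p : ℕ}

/-- The vector `X θ` for the debiasing direction `θ`, replaced by `0` if it is too long. -/
noncomputable def scoreDirection (c : ℝ) (X : Fin n → Fin p → ℝ) (μ : ℝ) (j : Fin p) : Fin n → ℝ :=
  if sqNorm (debiasDirection X μ j) ≤ n * c then debiasDirection X μ j else 0

lemma sqNorm_scoreDirection_le {c : ℝ} (hc : 0 ≤ c) (X : Fin n → Fin p → ℝ) (μ : ℝ) (j : Fin p) :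
    sqNorm (scoreDirection c X μ j) ≤ n * c := by
  unfold scoreDirection
  split_ifs with h
  · exact h
  · simp only [sqNorm, Pi.zero_apply, ne_eq, OfNat.ofNat_ne_zero, not_false_eq_true, zero_pow,
      Finset.sum_const_zero]
    positivity

lemma measurable_scoreDirection (c μ : ℝ) (j : Fin p) :
    Measurable fun X : Fin n → Fin p → ℝ => scoreDirection c X μ j := by
  have h := measurable_debiasDirection (n := n) μ j
  exact Measurable.ite (measurableSet_le (continuous_sqNorm.measurable.comp h) measurable_const)
    h measurable_const

/-- The debiased noise, with the truncated direction. -/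
noncomputable def score (c : ℝ) (X : Fin n → Fin p → ℝ) (μ : ℝ) (e : Fin n → ℝ) (j : Fin p) : ℝ :=
  1 / (n : ℝ) * (scoreDirection c X μ j ⬝ᵥ e)

lemma gram_form (X : Matrix (Fin n) (Fin p) ℝ) (u v : Fin p → ℝ) :
    u ⬝ᵥ (gram X *ᵥ v) = 1 / (n : ℝ) * ∑ i, (u ⬝ᵥ X i) * (v ⬝ᵥ X i) := by
  rw [gram_mulVec, dotProduct_smul, dotProduct_transpose_mulVec, smul_eq_mul]
  congr 1
  simp only [dotProduct, Matrix.mulVec]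
  refine Finset.sum_congr rfl fun i _ => ?_
  congr 1 <;> exact Finset.sum_congr rfl fun j _ => mul_comm _ _

/-- The properties of a sample with covariance matrix `S` on which the local estimators are
accurate, `r` being of the order `√(log p / n)`. -/
structure RegularSample (B r : ℝ) (S : Matrix (Fin p) (Fin p) ℝ) (X : Matrix (Fin n) (Fin p) ℝ)
    (e : Fin n → ℝ) : Prop where
  gram_close : ∀ i j, |gram X i j - S i j| ≤ 448 * B * r
  feasible : ∀ j, ∃ θ ∈ debiasFeasible X (512 * B ^ 3 * r) j, θ ⬝ᵥ (gram X *ᵥ θ) ≤ 129 * B ^ 3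
  noise : ∀ j, |((1 / (n : ℝ)) • (Xᵀ *ᵥ e)) j| ≤ 57 * B * r
  score_le : ∀ j, |score (129 * B ^ 3) X (512 * B ^ 3 * r) e j| ≤ 56 * B ^ 2 * r

end Score

/-! ### Probability that one source sample is irregular. -/

section Sources

variable {Ω : Type*} [MeasurableSpace Ω] {P : Measure Ω} {p K nS nT : ℕ}
  {x : Obs K nS nT → Ω → Fin p → ℝ} {e : Obs K nS nT → Ω → ℝ}
  {Sig : Fin (K + 1) → Matrix (Fin p) (Fin p) ℝ} {B : ℝ≥0}

lemma GaussianErrors.indep_reindex {ι : Type*} (he : GaussianErrors P x e B)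
    (f : ι → Obs K nS nT) : IndepFun (fun ω o => x o ω) (fun ω i => e (f i) ω) P :=
  he.indep_design.comp (ψ := fun (y : Obs K nS nT → ℝ) i => y (f i)) measurable_id (by fun_prop)

lemma sourceIndex_injective (k : Fin K) :
    Function.Injective fun i : Fin nS => (Sum.inr (k, i) : Obs K nS nT) := fun i j h => by
  simpa using h

lemma GaussianErrors.subgaussian (he : GaussianErrors P x e B) (o : Obs K nS nT) :
    HasSubgaussianMGF (e o) B P := by
  obtain ⟨v, hv, hl⟩ := he.gaussian o
  exact gaussian_hasSubgaussianMGF hl hv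

lemma GaussianErrors.symmetric (he : GaussianErrors P x e B) (o : Obs K nS nT) :
    IdentDistrib (e o) (fun ω => -e o ω) P P := by
  obtain ⟨v, hv, hl⟩ := he.gaussian o
  exact gaussian_identDistrib_neg hl

variable [IsProbabilityMeasure P]

/-- For `y ≤ nS` one has `y ≤ √(nS * y)`, so the Gaussian term of Bernstein's inequality dominates
and the constant doubles to `128`. -/
lemma SubGaussianDesigns.source_form_deviation (hx : SubGaussianDesigns P x Sig B B)
    (k : Fin K) {u v : Fin p → ℝ} {q : ℝ≥0} (hu : sqNorm u ≤ q) (hv : sqNorm v ≤ q) (hB : 0 < B)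
    (hq : 0 < q) {y : ℝ} (hy : 0 < y) (hyn : y ≤ nS) :
    P {ω | 128 * (B * q) * √(y / nS) <
        |u ⬝ᵥ (gram (sourceX (fun o => x o ω) k) *ᵥ v) - u ⬝ᵥ (Sig k.succ *ᵥ v)|} ≤
      ENNReal.ofReal (2 * Real.exp (-y)) := by
  have hn : (0 : ℝ) < nS := hy.trans_le hyn
  refine le_trans (measure_mono fun ω hω => ?_)
    (hx.form_deviation (sourceIndex_injective k) (k := k.succ) (fun i => rfl) hu hv hB hq hy)
  simp only [Set.mem_ofPred_eq] at hω ⊢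
  rw [gram_form] at hω
  have h1 : 1 / (nS : ℝ) * ∑ i, (u ⬝ᵥ sourceX (fun o => x o ω) k i) *
      (v ⬝ᵥ sourceX (fun o => x o ω) k i) - u ⬝ᵥ (Sig k.succ *ᵥ v) =
      (∑ i, (u ⬝ᵥ x (Sum.inr (k, i)) ω) * (v ⬝ᵥ x (Sum.inr (k, i)) ω) -
        nS * (u ⬝ᵥ (Sig k.succ *ᵥ v))) / nS := by
    field_simp
    rfl
  rw [h1, abs_div, abs_of_pos hn, lt_div_iff₀ hn] at hω
  refine lt_of_le_of_lt ?_ hω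
  have h2 : y ≤ √(nS * y) := Real.le_sqrt_of_sq_le (by nlinarith)
  have h3 : √(y / nS) * nS = √(nS * y) := by
    rw [show (nS : ℝ) * y = (y / nS) * nS ^ 2 by field_simp, Real.sqrt_mul (by positivity),
      Real.sqrt_sq hn.le]
  have h4 : (0 : ℝ) ≤ B * q := by positivity
  calc 64 * (B * q : ℝ) * (√(nS * y) + y) ≤ 64 * (B * q) * (√(nS * y) + √(nS * y)) := by gcongr
    _ = 128 * (B * q) * √(y / nS) * nS := by rw [mul_assoc _ (√(y / nS)), h3]; ring

lemma measurable_sourceX (k : Fin K) :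
    Measurable fun (a : Obs K nS nT → Fin p → ℝ) (i : Fin nS) => sourceX a k i := by
  change Measurable fun (a : Obs K nS nT → Fin p → ℝ) (i : Fin nS) => a (Sum.inr (k, i))
  fun_prop

lemma sqNorm_single_one (j : Fin p) : sqNorm (Pi.single j 1 : Fin p → ℝ) = 1 := by
  simp [sqNorm, Pi.single_apply]

lemma single_form (A : Matrix (Fin p) (Fin p) ℝ) (i j : Fin p) :
    (Pi.single i 1 : Fin p → ℝ) ⬝ᵥ (A *ᵥ (Pi.single j 1)) = A i j := by
  simp

lemma SubGaussianDesigns.source_gram_deviation (hx : SubGaussianDesigns P x Sig B B)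
    (k : Fin K) (hB : 0 < B) {y : ℝ} (hy : 0 < y) (hyn : y ≤ nS) :
    P {ω | ∃ q : Fin p × Fin p, 128 * B * √(y / nS) <
        |gram (sourceX (fun o => x o ω) k) q.1 q.2 - Sig k.succ q.1 q.2|} ≤
      ENNReal.ofReal (p ^ 2 * (2 * Real.exp (-y))) := by
  refine (measure_exists_le (a := 2 * Real.exp (-y)) fun q : Fin p × Fin p => ?_).trans
    (le_of_eq ?_)
  · have h := hx.source_form_deviation k (u := Pi.single q.1 1) (v := Pi.single q.2 1) (q := 1)
      (by simp [sqNorm_single_one]) (by simp [sqNorm_single_one]) hB one_pos hy hyn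
    simp only [single_form, NNReal.coe_one, mul_one] at h
    exact h
  · simp [sq]

lemma sqrt_twelve_mul_le (t : ℝ) : √(12 * t) ≤ 7 / 2 * √t := by
  rw [Real.sqrt_mul (by norm_num)]
  gcongr
  rw [Real.sqrt_le_left (by norm_num)]
  norm_num

/-- The event that a source sample is not regular. -/
lemma measure_not_regularSample_le (hx : SubGaussianDesigns P x Sig B B)
    (he : GaussianErrors P x e B) (hB : 1 ≤ B) (hp : 2 ≤ p) (hn : 12 * Real.log p ≤ nS)
    (k : Fin K) :
    P {ω | ¬ RegularSample B (√(Real.log p / nS)) (Sig k.succ) (sourceX (fun o => x o ω) k)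
        (fun i => e (Sum.inr (k, i)) ω)} ≤ ENNReal.ofReal (10 * Real.exp (-(10 * Real.log p))) := by
  have hp1 : (1 : ℝ) < p := by exact_mod_cast hp
  have hL : 0 < Real.log p := Real.log_pos hp1
  set L := Real.log p with hLdef
  have hn0 : (0 : ℝ) < nS := by linarith
  have hnn : 0 < nS := by exact_mod_cast hn0
  set r := √(L / nS) with hr
  have hr0 : 0 ≤ r := Real.sqrt_nonneg _
  have hB0 : 0 < B := one_pos.trans_le hB
  have hB1 : (1 : ℝ) ≤ B := hB
  have h12 : √(12 * L / nS) ≤ 7 / 2 * r := by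
    rw [mul_div_assoc]; exact sqrt_twelve_mul_le _
  have h12' : √(12 * L / nS) ≤ 1 := by
    rw [Real.sqrt_le_one]; exact (div_le_one hn0).2 hn
  -- A single deviation has probability `2 * p ^ (-12)`: after union bounds over at most `p ^ 2`
  -- pairs, `p ^ (-10)` is left for each of the five events.
  set ε := 2 * Real.exp (-(12 * L)) with hε
  have hε0 : 0 < ε := by positivity
  have hp0 : (0 : ℝ) < p := by linarith
  -- the directions that solve the population version of the debiasing program
  have hnk : Nonempty (Fin nS) := ⟨⟨0, hnn⟩⟩
  obtain ⟨i0⟩ := hnk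
  have hq : ∀ u, 1 / (B : ℝ) * sqNorm u ≤ u ⬝ᵥ (Sig k.succ *ᵥ u) :=
    hx.quadForm_ge (Sum.inr (k, i0))
  have hdiag : ∀ j, Sig k.succ j j ≤ 4 * B := hx.diag_le (Sum.inr (k, i0))
  choose θ hθ1 hθ2 hθ3 using exists_mulVec_eq_single (by positivity : (0 : ℝ) < B) hq
  have hB2 : (0 : ℝ≥0) < B ^ 2 := by positivity
  -- the four exceptional events
  have hE1 := hx.source_gram_deviation k hB0 (y := 12 * L) (by positivity) hn
  have hE2 : P {ω | ∃ q : Fin p × Fin p, 128 * (B * B ^ 2) * √(12 * L / nS) <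
      |(Pi.single q.1 1 : Fin p → ℝ) ⬝ᵥ (gram (sourceX (fun o => x o ω) k) *ᵥ (θ q.2)) -
        (Pi.single q.1 1 : Fin p → ℝ) ⬝ᵥ (Sig k.succ *ᵥ (θ q.2))|} ≤
      ENNReal.ofReal (p ^ 2 * ε) := by
    refine (measure_exists_le (a := ε) fun q : Fin p × Fin p => ?_).trans (le_of_eq (by simp [sq]))
    have h := hx.source_form_deviation k (u := Pi.single q.1 1) (v := θ q.2) (q := B ^ 2)
      (by rw [sqNorm_single_one]; push_cast; nlinarith) (by push_cast; exact hθ2 q.2) hB0 hB2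
      (y := 12 * L) (by positivity) hn
    push_cast at h
    exact h
  have hE3 : P {ω | ∃ j : Fin p, 128 * (B * B ^ 2) * √(12 * L / nS) <
      |θ j ⬝ᵥ (gram (sourceX (fun o => x o ω) k) *ᵥ (θ j)) -
        θ j ⬝ᵥ (Sig k.succ *ᵥ (θ j))|} ≤ ENNReal.ofReal (p * ε) := by
    refine (measure_exists_le (a := ε) fun j : Fin p => ?_).trans (le_of_eq (by simp))
    have h := hx.source_form_deviation k (u := θ j) (v := θ j) (q := B ^ 2)
      (by push_cast; exact hθ2 j) (by push_cast; exact hθ2 j) hB0 hB2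
      (y := 12 * L) (by positivity) hn
    push_cast at h
    exact h
  have hDm : Measurable fun ω o => x o ω := measurable_pi_iff.2 hx.measurable
  have hek : iIndepFun (fun i => e (Sum.inr (k, i))) P := he.indep.precomp (sourceIndex_injective k)
  have hE4 : P {ω | ∃ j : Fin p, ∑ i, (x (Sum.inr (k, i)) ω j) ^ 2 ≤ 132 * B * nS ∧
      √(2 * (B * (132 * B * nS)) * (12 * L)) <
        |∑ i, x (Sum.inr (k, i)) ω j * e (Sum.inr (k, i)) ω|} ≤ ENNReal.ofReal (p * ε) := by
    refine (measure_exists_le (a := ε) fun j : Fin p => ?_).trans (le_of_eq (by simp))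
    exact conditional_linear_form_tail hDm (fun i => he.measurable (Sum.inr (k, i)))
      (he.indep_reindex fun i => Sum.inr (k, i)) hek (fun i => he.subgaussian _)
      (w := fun a i => a (Sum.inr (k, i)) j) (by fun_prop) (132 * B * nS) (by positivity)
  have hE5 : P {ω | ∃ j : Fin p,
      ∑ i, (scoreDirection (129 * B ^ 3) (sourceX (fun o => x o ω) k) (512 * B ^ 3 * r) j i) ^ 2
        ≤ nS * (129 * B ^ 3) ∧ √(2 * (B * (nS * (129 * B ^ 3))) * (12 * L)) <
      |∑ i, scoreDirection (129 * B ^ 3) (sourceX (fun o => x o ω) k) (512 * B ^ 3 * r) j i *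
        e (Sum.inr (k, i)) ω|} ≤ ENNReal.ofReal (p * ε) := by
    refine (measure_exists_le (a := ε) fun j : Fin p => ?_).trans (le_of_eq (by simp))
    exact conditional_linear_form_tail hDm (fun i => he.measurable (Sum.inr (k, i)))
      (he.indep_reindex fun i => Sum.inr (k, i)) hek (fun i => he.subgaussian _)
      (w := fun a i => scoreDirection (129 * B ^ 3) (sourceX a k) (512 * B ^ 3 * r) j i)
      (measurable_pi_iff.2 fun i => (measurable_pi_apply i).comp
        ((measurable_scoreDirection _ _ j).comp (measurable_sourceX k))) _ (by positivity)
  have hp2 : (p : ℝ) ≤ p ^ 2 := by nlinarith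
  have hsum := measure_le_add hE1 (measure_le_add hE2 (measure_le_add hE3 (measure_le_add hE4 hE5
    (by positivity) (by positivity) subset_rfl) (by positivity) (by positivity) subset_rfl)
    (by positivity) (by positivity) subset_rfl) (by positivity) (by positivity) subset_rfl
  refine le_trans (measure_mono fun ω hω => ?_) (hsum.trans (ENNReal.ofReal_le_ofReal ?_))
  swap
  · have hexp : (p : ℝ) ^ 2 * Real.exp (-(12 * L)) = Real.exp (-(10 * L)) := by
      have : (p : ℝ) = Real.exp L := (Real.exp_log hp0).symm
      rw [this, ← Real.exp_nat_mul, ← Real.exp_add]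
      congr 1
      push_cast
      ring
    calc _ ≤ p ^ 2 * ε + (p ^ 2 * ε + (p ^ 2 * ε + (p ^ 2 * ε + p ^ 2 * ε))) := by gcongr
      _ = _ := by rw [hε]; linear_combination 10 * hexp
  by_contra hnot
  simp only [Set.mem_union, Set.mem_ofPred_eq, not_or, not_exists, not_lt, not_and] at hnot
  obtain ⟨f1, f2, f3, f4, f5⟩ := hnot
  apply hω
  set X := sourceX (fun o => x o ω) k with hX
  have hgram1 : ∀ i j, |gram X i j - Sig k.succ i j| ≤ 128 * B * √(12 * L / nS) :=
    fun i j => f1 (i, j)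
  -- `132 = 4 + 128`: population variance plus deviation.
  have hcol : ∀ j, ∑ i, (x (Sum.inr (k, i)) ω j) ^ 2 ≤ 132 * B * nS := fun j => by
    have h1 := (abs_le.1 (hgram1 j j)).2
    have h2 : gram X j j = 1 / (nS : ℝ) * ∑ i, (x (Sum.inr (k, i)) ω j) ^ 2 := by
      rw [gram_apply]; simp only [sq]; rfl
    have h3 : 128 * (B : ℝ) * √(12 * L / nS) ≤ 128 * B := by nlinarith
    have h4 : 1 / (nS : ℝ) * ∑ i, (x (Sum.inr (k, i)) ω j) ^ 2 ≤ 132 * B := by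
      rw [← h2]; linarith [hdiag j]
    rwa [one_div, inv_mul_le_iff₀ hn0, mul_comm] at h4
  have hnoise_aux : ∀ {c c' S : ℝ}, 0 ≤ c' → c * L * nS ≤ c' ^ 2 * (L * nS) → |S| ≤ √(c * L * nS) →
      |1 / (nS : ℝ) * S| ≤ c' * r := fun {c c' S} hc' hcc hS => by
    have h1 : √(c * L * nS) ≤ c' * √(L * nS) := by
      rw [Real.sqrt_le_left (by positivity), mul_pow, Real.sq_sqrt (by positivity)]
      exact hcc
    have h2 : √(L * nS) = nS * r := by
      rw [hr, show L * nS = (L / nS) * nS ^ 2 by field_simp, Real.sqrt_mul (by positivity),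
        Real.sqrt_sq hn0.le, mul_comm]
    rw [abs_mul, abs_of_pos (by positivity), one_div, inv_mul_le_iff₀ hn0]
    calc |S| ≤ _ := hS
      _ ≤ _ := h1
      _ = _ := by rw [h2]; ring
  refine ⟨fun i j => (hgram1 i j).trans ?_, fun j => ⟨θ j, fun i => ?_, ?_⟩, fun j => ?_,
    fun j => ?_⟩
  · nlinarith
  · have h1 := f2 (i, j)
    simp only [hθ1, single_dotProduct, one_mul] at h1
    refine h1.trans ?_
    have h3 : (0 : ℝ) ≤ B ^ 3 := by positivity
    nlinarith
  · have h1 := (abs_le.1 (f3 j)).2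
    have h3 : (B : ℝ) ≤ B ^ 3 := by nlinarith [mul_nonneg (sub_nonneg.2 hB1) (sub_nonneg.2 hB1)]
    have h4 : 128 * ((B : ℝ) * B ^ 2) * √(12 * L / nS) ≤ 128 * (B * B ^ 2) := by
      have : (0 : ℝ) ≤ B * B ^ 2 := by positivity
      nlinarith
    linarith [hθ3 j]
  · have h1 := f4 j (hcol j)
    have h2 : ((1 / (nS : ℝ)) • (Xᵀ *ᵥ fun i => e (Sum.inr (k, i)) ω)) j =
        1 / (nS : ℝ) * ∑ i, x (Sum.inr (k, i)) ω j * e (Sum.inr (k, i)) ω := rfl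
    rw [h2]
    -- `3168 = 2 * 132 * 12 ≤ 57 ^ 2`; in the last case `3096 = 2 * 129 * 12 ≤ 56 ^ 2`.
    refine hnoise_aux (c := 3168 * B ^ 2) (by positivity) ?_ (h1.trans (le_of_eq ?_))
    · have : (0 : ℝ) ≤ B ^ 2 * (L * nS) := by positivity
      nlinarith
    · congr 1; ring
  · have h1 := f5 j (sqNorm_scoreDirection_le (by positivity) _ _ _)
    refine hnoise_aux (c := 3096 * B ^ 4) (by positivity) ?_ (h1.trans (le_of_eq ?_))
    · have : (0 : ℝ) ≤ B ^ 4 * (L * nS) := by positivity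
      nlinarith
    · congr 1; ring

end Sources

end TransFusion

namespace TransFusion

/-! ## Typical data -/

section Typical

/-- The truncated debiased noise of source `k`. -/
noncomputable def sourceScore {p K nS nT : ℕ} (B : ℝ) (x : Obs K nS nT → Fin p → ℝ)
    (e : Obs K nS nT → ℝ) (k : Fin K) (j : Fin p) : ℝ :=
  score (129 * B ^ 3) (sourceX x k) (512 * B ^ 3 * √(Real.log p / nS))
    (fun i => e (Sum.inr (k, i))) j

/-- The gradient of the least squares objective of source `k` at the true parameter. -/
noncomputable def sourceNoise {p K nS nT : ℕ} (x : Obs K nS nT → Fin p → ℝ)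
    (e : Obs K nS nT → ℝ) (k : Fin K) : Fin p → ℝ :=
  (1 / (nS : ℝ)) • ((sourceX x k)ᵀ *ᵥ fun i => e (Sum.inr (k, i)))

/-- The properties of the data on which the estimator is accurate, `t` being the levels at which
the errors of the sources are clipped. -/
structure TypicalData {p K nS nT : ℕ} (B : ℝ) (Sig : Fin (K + 1) → Matrix (Fin p) (Fin p) ℝ)
    (t : Fin K → ℝ) (x : Obs K nS nT → Fin p → ℝ) (e : Obs K nS nT → ℝ) : Prop where
  regular : ∃ good : Finset (Fin K), (goodᶜ.card : ℝ) ≤ 1 / (p : ℝ) ^ 8 * K ∧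
    ∀ k ∈ good, RegularSample B (√(Real.log p / nS)) (Sig k.succ) (sourceX x k)
      (fun i => e (Sum.inr (k, i)))
  gram_close : (p : ℝ) ^ 5 < K →
    ∀ k i j, |gram (sourceX x k) i j - Sig k.succ i j| ≤ 1 / (2 * B * p)
  noise_sum : (p : ℝ) ^ 5 < K → ∑ k, sqNorm (sourceNoise x e k) ≤ 20 * B ^ 2 * K * p ^ 2 / nS
  clip_sum : ∀ j, |(nS : ℝ) / totalSize K nS nT * ∑ k, clip (t k) (sourceScore B x e k j)| ≤
    23 * B ^ 2 * √(Real.log p / totalSize K nS nT)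
  exceedance_sum : sqNorm (fun j => (nS : ℝ) / totalSize K nS nT *
    ∑ k, (sourceScore B x e k j - clip (t k) (sourceScore B x e k j))) ≤
      4 * (Real.log p / totalSize K nS nT)
  target_gram : ∀ i j, |1 / totalSize K nS nT * ∑ o, x (Sum.inl o) i * x (Sum.inl o) j -
    nT / totalSize K nS nT * Sig 0 i j| ≤ 384 * B * √(Real.log p / totalSize K nS nT)
  target_noise : ∀ j, |1 / totalSize K nS nT * ((targetX x)ᵀ *ᵥ fun i => e (Sum.inl i)) j| ≤
    40 * B * √(Real.log p / totalSize K nS nT)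

variable {Ω : Type*} [MeasurableSpace Ω] {P : Measure Ω} [IsProbabilityMeasure P] {p K nS nT : ℕ}
  {x : Obs K nS nT → Ω → Fin p → ℝ} {e : Obs K nS nT → Ω → ℝ}
  {Sig : Fin (K + 1) → Matrix (Fin p) (Fin p) ℝ} {B : ℝ≥0}

lemma two_le_of_one_le_log (h : 1 ≤ Real.log p) : 2 ≤ p := by
  by_contra hlt
  have : p = 0 ∨ p = 1 := by omega
  rcases this with rfl | rfl <;> norm_num at h

lemma cast_mul_exp_neg_log (hp : 2 ≤ p) (m : ℕ) :
    (p : ℝ) ^ m * Real.exp (-((m + 1 : ℕ) * Real.log p)) = Real.exp (-Real.log p) := by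
  have h1 : (p : ℝ) = Real.exp (Real.log p) := (Real.exp_log (by positivity)).symm
  nth_rw 1 [h1]
  rw [← Real.exp_nat_mul, ← Real.exp_add]
  congr 1
  push_cast
  ring

/-- Each source is irregular with probability at most `10 * p ^ (-10)`, so demanding more than a
fraction `p ^ (-8)` of irregular ones still costs only `10 * p ^ (-2)`. -/
lemma measure_regular_compl_le (hx : SubGaussianDesigns P x Sig B B)
    (he : GaussianErrors P x e B) (hB : 1 ≤ B) (hL : 1 ≤ Real.log p)
    (hn : 12 * Real.log p ≤ nS) (hK : 1 ≤ K) :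
    P {ω | ¬ ∃ good : Finset (Fin K), (goodᶜ.card : ℝ) ≤ 1 / (p : ℝ) ^ 8 * K ∧
      ∀ k ∈ good, RegularSample B (√(Real.log p / nS)) (Sig k.succ) (sourceX (fun o => x o ω) k)
        (fun i => e (Sum.inr (k, i)) ω)} ≤ ENNReal.ofReal (10 * Real.exp (-Real.log p)) := by
  have hp := two_le_of_one_le_log hL
  have h := measure_card_gt_le (P := P) (r := 1 / (p : ℝ) ^ 8) (by positivity) hK
    (measure_not_regularSample_le hx he hB hp hn)
  simp only [Set.mem_ofPred_eq, not_not] at h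
  refine h.trans (ENNReal.ofReal_le_ofReal ?_)
  have h1 := cast_mul_exp_neg_log hp 9
  have hp1 : (1 : ℝ) ≤ p := by exact_mod_cast (by omega : 1 ≤ p)
  rw [div_div_eq_mul_div, div_one, ← h1]
  have h2 : (p : ℝ) ^ 8 ≤ p ^ 9 := pow_le_pow_right₀ hp1 (by norm_num)
  norm_num
  rw [mul_assoc, mul_comm (Real.exp _)]
  gcongr

/-- The required precision `1 / (2 * B * p)` does not shrink with `nS`, so each failure probability
is exponentially small in a quantity of at least `u = K * p ^ 2`. This beats the union over all `K`
sources and `p ^ 2` entries. -/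
lemma measure_gram_close_compl_le (hx : SubGaussianDesigns P x Sig B B)
    (hB : 1 ≤ B) (hL : 1 ≤ Real.log p)
    (hreg : (p : ℝ) ^ 5 < K → K * (p : ℝ) ^ 2 * (256 * B ^ 2 * p) ^ 2 ≤ nS) :
    P {ω | ¬ ((p : ℝ) ^ 5 < K → ∀ k i j,
      |gram (sourceX (fun o => x o ω) k) i j - Sig k.succ i j| ≤ 1 / (2 * B * p))} ≤
      ENNReal.ofReal (4 * Real.exp (-Real.log p)) := by
  have hp := two_le_of_one_le_log hL
  by_cases hK : (p : ℝ) ^ 5 < K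
  swap
  · simp [hK]
  have hn := hreg hK
  have hp0 : (2 : ℝ) ≤ p := by exact_mod_cast hp
  have hB1 : (1 : ℝ) ≤ B := hB
  have hK1 : (1 : ℝ) ≤ K := by
    have : (1 : ℝ) ≤ (p : ℝ) ^ 5 := one_le_pow₀ (by linarith)
    linarith
  set u := (K : ℝ) * (p : ℝ) ^ 2 with hu
  have hu1 : 1 ≤ u := by nlinarith
  have hc1 : 1 ≤ (256 * (B : ℝ) ^ 2 * p) ^ 2 := by
    refine one_le_pow₀ ?_
    have : (1 : ℝ) ≤ (B : ℝ) ^ 2 := one_le_pow₀ hB1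
    nlinarith
  set y := (nS : ℝ) / (256 * (B : ℝ) ^ 2 * p) ^ 2 with hy
  have huy : u ≤ y := by rwa [hy, le_div_iff₀ (by linarith)]
  have hy0 : 0 < y := by linarith
  have hn0 : (0 : ℝ) < nS := by nlinarith
  have hyn : y ≤ nS := div_le_self hn0.le hc1
  have hsq : √(y / nS) = 1 / (256 * (B : ℝ) ^ 2 * p) := by
    rw [hy, div_div, mul_comm, ← div_div, div_self hn0.ne',
      Real.sqrt_div zero_le_one, Real.sqrt_one, Real.sqrt_sq (by positivity)]
  have hk := fun k => hx.source_gram_deviation k (one_pos.trans_le hB) hy0 hyn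
  refine le_trans (measure_mono ?_) ((measure_exists_le hk).trans (ENNReal.ofReal_le_ofReal ?_))
  · intro ω hω
    simp only [hK, forall_const, not_forall, not_le, Set.mem_ofPred_eq] at hω ⊢
    obtain ⟨k, i, j, h⟩ := hω
    refine ⟨k, (i, j), lt_of_eq_of_lt ?_ h⟩
    rw [hsq]
    field_simp
    norm_num
  · rw [Fintype.card_fin]
    have h1 : Real.exp (-y) ≤ 2 / u ^ 2 := by
      have h2 := Real.quadratic_le_exp_of_nonneg (by linarith : 0 ≤ u)
      have h3 : Real.exp (-y) ≤ Real.exp (-u) := Real.exp_le_exp.2 (by linarith)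
      rw [Real.exp_neg u] at h3
      refine h3.trans ?_
      rw [inv_le_comm₀ (Real.exp_pos u) (by positivity), inv_div]
      linarith
    calc (K : ℝ) * (p ^ 2 * (2 * Real.exp (-y))) = 2 * u * Real.exp (-y) := by rw [hu]; ring
      _ ≤ 2 * u * (2 / u ^ 2) := by gcongr
      _ = 4 / u := by field_simp; ring
      _ ≤ 4 / p := by gcongr; nlinarith
      _ = _ := by rw [Real.exp_neg, Real.exp_log (by linarith)]; rfl

/-- Second moments and Markov's inequality: the threshold exceeds the mean bound by the factor `p`.
The premise on the sample covariances bounds the columns of the designs. -/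
lemma measure_noise_sum_compl_le (hx : SubGaussianDesigns P x Sig B B)
    (he : GaussianErrors P x e B) (hB : 1 ≤ B) (hL : 1 ≤ Real.log p) (hn : 12 * Real.log p ≤ nS)
    (hK : 1 ≤ K) :
    P {ω | ¬ ((∀ k i j,
      |gram (sourceX (fun o => x o ω) k) i j - Sig k.succ i j| ≤ 1 / (2 * B * p)) →
      ∑ k, sqNorm (sourceNoise (fun o => x o ω) (fun o => e o ω) k) ≤
        20 * B ^ 2 * K * p ^ 2 / nS)} ≤
      ENNReal.ofReal (Real.exp (-Real.log p)) := by
  have hp := two_le_of_one_le_log hL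
  have hn0 : (0 : ℝ) < nS := by linarith
  have hB1 : (1 : ℝ) ≤ B := hB
  have hp0 : (2 : ℝ) ≤ p := by exact_mod_cast hp
  have hK0 : (0 : ℝ) < K := by exact_mod_cast hK
  have hDm : Measurable fun ω o => x o ω := measurable_pi_iff.2 hx.measurable
  have h := conditional_sum_sq_tail (J := Fin K × Fin p) (ι := Fin nS) (σ2 := B) hDm
    (e := fun q i => e (Sum.inr (q.1, i))) (fun q i => he.measurable _)
    (he.indep_design.comp (ψ := fun (y : Obs K nS nT → ℝ) (q : Fin K × Fin p) (i : Fin nS) =>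
      y (Sum.inr (q.1, i))) measurable_id (by fun_prop))
    (fun q => he.indep.precomp (sourceIndex_injective q.1)) (fun q i => he.subgaussian _)
    (w := fun a q i => 1 / (nS : ℝ) * a (Sum.inr (q.1, i)) q.2) (by fun_prop)
    (V := 5 * B / nS) (c := 20 * B ^ 2 * K * p ^ 2 / nS) (by positivity) (by positivity)
  refine le_trans (measure_mono fun ω hω => ?_) (h.trans (ENNReal.ofReal_le_ofReal ?_))
  · simp only [Set.mem_ofPred_eq, Classical.not_imp, not_le] at hω ⊢
    obtain ⟨hg, hs⟩ := hω
    refine ⟨fun q => ?_, lt_of_lt_of_eq hs ?_⟩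
    · have hnn : 0 < nS := by exact_mod_cast hn0
      have hd : Sig q.1.succ q.2 q.2 ≤ 4 * B := hx.diag_le (Sum.inr (q.1, ⟨0, hnn⟩)) q.2
      have h1 := (abs_le.1 (hg q.1 q.2 q.2)).2
      rw [gram_apply] at h1
      have h2 : 1 / (2 * (B : ℝ) * p) ≤ B := by
        rw [div_le_iff₀ (by positivity)]
        have : 1 ≤ (B : ℝ) * B := by nlinarith
        nlinarith
      have h3 : ∑ i, (1 / (nS : ℝ) * x (Sum.inr (q.1, i)) ω q.2) ^ 2 =
          1 / (nS : ℝ) * (1 / (nS : ℝ) * ∑ o, sourceX (fun o => x o ω) q.1 o q.2 *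
            sourceX (fun o => x o ω) q.1 o q.2) := by
        simp only [mul_pow, ← Finset.mul_sum, ← sq]
        rw [← mul_assoc, ← sq]; rfl
      rw [h3]
      calc _ ≤ 1 / (nS : ℝ) * (5 * B) := mul_le_mul_of_nonneg_left (by linarith) (by positivity)
        _ = _ := by ring
    · rw [Fintype.sum_prod_type]
      refine Finset.sum_congr rfl fun k _ => Finset.sum_congr rfl fun j _ => ?_
      congr 1
      simp only [sourceNoise, Pi.smul_apply, smul_eq_mul, mul_assoc, ← Finset.mul_sum]
      rfl
  · rw [Fintype.card_prod, Fintype.card_fin, Fintype.card_fin, Real.exp_neg,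
      Real.exp_log (by linarith)]
    push_cast
    refine le_of_eq ?_
    field_simp
    norm_num

lemma sourceScore_eq (x : Obs K nS nT → Fin p → ℝ) (e : Obs K nS nT → ℝ) (B : ℝ) (k : Fin K)
    (j : Fin p) : sourceScore B x e k j = ∑ i, 1 / (nS : ℝ) * scoreDirection (129 * B ^ 3)
      (sourceX x k) (512 * B ^ 3 * √(Real.log p / nS)) j i * e (Sum.inr (k, i)) := by
  simp only [sourceScore, score, dotProduct, Finset.mul_sum, mul_assoc]

lemma sum_sq_scoreDirection_le (hn : 0 < nS) (x : Obs K nS nT → Fin p → ℝ) {c : ℝ} (hc : 0 ≤ c)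
    (μ : ℝ) (k : Fin K) (j : Fin p) :
    ∑ i, (1 / (nS : ℝ) * scoreDirection c (sourceX x k) μ j i) ^ 2 ≤ c / nS := by
  have hn0 : (0 : ℝ) < nS := by exact_mod_cast hn
  have h := sqNorm_scoreDirection_le hc (sourceX x k) μ j
  simp only [mul_pow, ← Finset.mul_sum]
  change (1 / (nS : ℝ)) ^ 2 * sqNorm _ ≤ _
  calc (1 / (nS : ℝ)) ^ 2 * sqNorm _ ≤ (1 / (nS : ℝ)) ^ 2 * (nS * c) := by gcongr
    _ = c / nS := by field_simp

lemma measurable_score_weight (c μ : ℝ) (k : Fin K) (j : Fin p) (i : Fin nS) :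
    Measurable fun a : Obs K nS nT → Fin p → ℝ =>
      1 / (nS : ℝ) * scoreDirection c (sourceX a k) μ j i :=
  ((measurable_pi_apply i).comp
    ((measurable_scoreDirection c μ j).comp (measurable_sourceX k))).const_mul _

lemma sourcePair_injective :
    Function.Injective fun q : Fin K × Fin nS => (Sum.inr q : Obs K nS nT) :=
  Sum.inr_injective

lemma cast_mul_le_totalSize : (K : ℝ) * nS ≤ totalSize K nS nT := by
  unfold totalSize; linarith [(Nat.cast_nonneg nT : (0 : ℝ) ≤ nT)]

/-- The sum of `K` clipped scores has variance proxy `K * 129 * B ^ 4 / nS`, whatever the designs.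
The constant comes from `2 * 129 * 2 = 516 ≤ 23 ^ 2`. -/
lemma measure_clip_sum_compl_le (hx : SubGaussianDesigns P x Sig B B)
    (he : GaussianErrors P x e B) (hL : 1 ≤ Real.log p) (hn : 0 < nS)
    (hK : 1 ≤ K) {t : Fin K → ℝ} (ht : ∀ k, 0 ≤ t k) :
    P {ω | ¬ ∀ j, |(nS : ℝ) / totalSize K nS nT *
      ∑ k, clip (t k) (sourceScore B (fun o => x o ω) (fun o => e o ω) k j)| ≤
        23 * B ^ 2 * √(Real.log p / totalSize K nS nT)} ≤
      ENNReal.ofReal (2 * Real.exp (-Real.log p)) := by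
  have hp := two_le_of_one_le_log hL
  set L := Real.log p with hLdef
  have hn0 : (0 : ℝ) < nS := by exact_mod_cast hn
  have hK0 : (0 : ℝ) < K := by exact_mod_cast hK
  have hKN : (K : ℝ) * nS ≤ totalSize K nS nT := cast_mul_le_totalSize
  set N := totalSize K nS nT
  have hN : 0 < N := lt_of_lt_of_le (by positivity) hKN
  have hDm : Measurable fun ω o => x o ω := measurable_pi_iff.2 hx.measurable
  have h := measure_exists_le fun j : Fin p =>
    conditional_sum_clip_tail (κ := Fin K) (ι := Fin nS) (σ2 := B) hDm
    (e := fun q => e (Sum.inr q)) (fun q => he.measurable _)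
    (he.indep_reindex _) (he.indep.precomp sourcePair_injective) (fun q => he.subgaussian _)
    (fun q => he.symmetric _)
    (w := fun a k i => 1 / (nS : ℝ) * scoreDirection (129 * B ^ 3) (sourceX a k)
      (512 * B ^ 3 * √(L / nS)) j i)
    (measurable_pi_iff.2 fun k => measurable_pi_iff.2 fun i => measurable_score_weight _ _ k j i)
    (fun a k => sum_sq_scoreDirection_le hn a (by positivity) _ k j) ht
    (x := 2 * L) (by positivity)
  refine le_trans (measure_mono fun ω hω => ?_) (h.trans (ENNReal.ofReal_le_ofReal ?_))
  · simp only [Set.mem_ofPred_eq, not_forall, not_le] at hω ⊢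
    obtain ⟨j, hj⟩ := hω
    refine ⟨j, ?_⟩
    simp only [sourceScore_eq] at hj
    rw [abs_mul, abs_of_pos (by positivity)] at hj
    rw [Fintype.card_fin]
    refine lt_of_mul_lt_mul_left (lt_of_le_of_lt ?_ hj) (by positivity : 0 ≤ (nS : ℝ) / N)
    rw [← Real.sqrt_sq (by positivity : 0 ≤ (nS : ℝ) / N),
      ← Real.sqrt_sq (by positivity : 0 ≤ 23 * (B : ℝ) ^ 2), ← Real.sqrt_mul (by positivity),
      ← Real.sqrt_mul (by positivity)]
    refine Real.sqrt_le_sqrt ?_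
    have e1 : ((nS : ℝ) / N) ^ 2 * (2 * (K * (B * (129 * B ^ 3 / nS))) * (2 * L)) =
        516 * B ^ 4 * (L / N) * (K * nS / N) := by field_simp; ring
    have h2 : K * nS / N ≤ 1 := (div_le_one hN).2 hKN
    rw [e1]
    have h3 : 0 ≤ (B : ℝ) ^ 4 * (L / N) := by positivity
    nlinarith
  · rw [Fintype.card_fin]
    have := cast_mul_exp_neg_log hp 1
    norm_num at this ⊢
    linarith

/-- With `a = √(nS * log p)` the exponent of the excess moment is `(129 / 2 * B ^ 4 - (65 * B ^ 4 +
2)) * log p ≤ -2 * log p`. Summing over `p` coordinates and dividing by the threshold leaves at most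
`1 / p`. -/
lemma measure_exceedance_sum_compl_le (hx : SubGaussianDesigns P x Sig B B)
    (he : GaussianErrors P x e B) (hL : 1 ≤ Real.log p) (hn : 0 < nS)
    (hK : 1 ≤ K) {t : Fin K → ℝ} (ht : ∀ k, (65 * B ^ 4 + 2) * √(Real.log p / nS) ≤ t k) :
    P {ω | ¬ sqNorm (fun j => (nS : ℝ) / totalSize K nS nT *
      ∑ k, (sourceScore B (fun o => x o ω) (fun o => e o ω) k j -
        clip (t k) (sourceScore B (fun o => x o ω) (fun o => e o ω) k j))) ≤
        4 * (Real.log p / totalSize K nS nT)} ≤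
      ENNReal.ofReal (Real.exp (-Real.log p)) := by
  have hp := two_le_of_one_le_log hL
  set L := Real.log p with hLdef
  have hn0 : (0 : ℝ) < nS := by exact_mod_cast hn
  have hK0 : (0 : ℝ) < K := by exact_mod_cast hK
  have hp0 : (0 : ℝ) < p := by exact_mod_cast (by omega : 0 < p)
  have hKN : (K : ℝ) * nS ≤ totalSize K nS nT := cast_mul_le_totalSize
  set N := totalSize K nS nT
  have hN : 0 < N := lt_of_lt_of_le (by positivity) hKN
  have hDm : Measurable fun ω o => x o ω := measurable_pi_iff.2 hx.measurable
  have h := conditional_sum_exceedance_tail (p := p) (κ := Fin K) (ι := Fin nS) (σ2 := B) hDm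
    (e := fun q => e (Sum.inr q)) (fun q => he.measurable _)
    (he.indep_reindex _) (he.indep.precomp sourcePair_injective) (fun q => he.subgaussian _)
    (fun q => he.symmetric _)
    (w := fun a j k i => 1 / (nS : ℝ) * scoreDirection (129 * B ^ 3) (sourceX a k)
      (512 * B ^ 3 * √(L / nS)) j i)
    (measurable_pi_iff.2 fun j => measurable_pi_iff.2 fun k => measurable_pi_iff.2 fun i =>
      measurable_score_weight _ _ k j i) (V := 129 * B ^ 3 / nS) (by positivity)
    (fun a j k => sum_sq_scoreDirection_le hn a (by positivity) _ k j)
    (T := (65 * B ^ 4 + 2) * √(L / nS)) (by positivity) ht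
    (a := √(nS * L)) (c := 4 * L * N / nS ^ 2) (by positivity) (by positivity)
  refine le_trans (measure_mono fun ω hω => ?_) (h.trans (ENNReal.ofReal_le_ofReal ?_))
  · simp only [Set.mem_ofPred_eq, not_le, sqNorm, mul_pow, ← Finset.mul_sum,
      sourceScore_eq] at hω ⊢
    refine lt_of_mul_lt_mul_left (lt_of_le_of_lt (le_of_eq ?_) hω)
      (by positivity : 0 ≤ ((nS : ℝ) / N) ^ 2)
    field_simp
  · have e1 : √(nS * L) ^ 2 = nS * L := Real.sq_sqrt (by positivity)
    have e2 : √(nS * L) * ((65 * B ^ 4 + 2) * √(L / nS)) = (65 * B ^ 4 + 2) * L := by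
      rw [mul_left_comm, ← Real.sqrt_mul (by positivity),
        show (nS : ℝ) * L * (L / nS) = L ^ 2 by field_simp, Real.sqrt_sq (by positivity)]
    rw [e1, e2, Fintype.card_fin]
    have e3 : (nS : ℝ) * L * (B * (129 * B ^ 3 / nS)) / 2 = 129 / 2 * (B ^ 4 * L) := by field_simp
    have h1 : Real.exp (nS * L * (B * (129 * B ^ 3 / nS)) / 2 - (65 * B ^ 4 + 2) * L) ≤
        Real.exp (-(2 * L)) := by
      rw [e3]
      refine Real.exp_le_exp.2 ?_
      have : 0 ≤ (B : ℝ) ^ 4 * L := by positivity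
      linarith
    have h2 := cast_mul_exp_neg_log hp 1
    norm_num at h2
    have h4 : K * nS / N ≤ 1 := (div_le_one hN).2 hKN
    have h5 : 0 ≤ 1 / L ^ 2 := by positivity
    have h6 : 1 / L ^ 2 ≤ 1 := by
      rw [div_le_one (by positivity)]; exact one_le_pow₀ hL
    calc _ ≤ p * (K * (4 / (nS * L) * Real.exp (-(2 * L)))) / (4 * L * N / nS ^ 2) := by gcongr
      _ = (K * nS / N) * (1 / L ^ 2) * (p * Real.exp (-(2 * L))) := by field_simp
      _ ≤ 1 * 1 * (p * Real.exp (-(2 * L))) := by gcongr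
      _ = _ := by rw [one_mul, one_mul]; exact h2

/-- Normalizing by the total size keeps the bound valid for target samples smaller than `log p`:
both Bernstein terms are compared with `N * √(log p / N)`, and `384 = 64 * (2 + 4)`. -/
lemma measure_target_gram_compl_le (hx : SubGaussianDesigns P x Sig B B) (hB : 1 ≤ B)
    (hL : 1 ≤ Real.log p) (hN : Real.log p ≤ totalSize K nS nT) :
    P {ω | ¬ ∀ i j, |1 / totalSize K nS nT * ∑ o, x (Sum.inl o) ω i * x (Sum.inl o) ω j -
      nT / totalSize K nS nT * Sig 0 i j| ≤ 384 * B * √(Real.log p / totalSize K nS nT)} ≤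
      ENNReal.ofReal (2 * Real.exp (-Real.log p)) := by
  have hp := two_le_of_one_le_log hL
  set L := Real.log p with hLdef
  have hnT : (nT : ℝ) ≤ totalSize K nS nT := by unfold totalSize; linarith [
    (by positivity : (0 : ℝ) ≤ K * nS)]
  set N := totalSize K nS nT
  have hN0 : 0 < N := by linarith
  have hB0 : 0 < B := one_pos.trans_le hB
  have h := measure_exists_le (P := P) (a := 2 * Real.exp (-(4 * L)))
    (S := fun q : Fin p × Fin p => {ω | 64 * B * (√(nT * (4 * L)) + 4 * L) <
      |∑ o, x (Sum.inl o) ω q.1 * x (Sum.inl o) ω q.2 - nT * Sig 0 q.1 q.2|}) fun q => by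
    have := hx.form_deviation (f := fun i : Fin nT => Sum.inl i) (k := 0) Sum.inl_injective
      (fun i => rfl) (u := Pi.single q.1 1) (v := Pi.single q.2 1) (q := 1)
      (by simp [sqNorm_single_one]) (by simp [sqNorm_single_one]) hB0 one_pos (y := 4 * L)
      (by positivity)
    simp only [single_form, NNReal.coe_one, mul_one] at this
    simp only [single_dotProduct, one_mul] at this
    exact this
  refine le_trans (measure_mono fun ω hω => ?_) (h.trans (ENNReal.ofReal_le_ofReal ?_))
  · simp only [Set.mem_ofPred_eq, not_forall, not_le] at hω ⊢
    obtain ⟨i, j, hij⟩ := hω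
    refine ⟨(i, j), ?_⟩
    have e1 : 1 / N * ∑ o, x (Sum.inl o) ω i * x (Sum.inl o) ω j - nT / N * Sig 0 i j =
        1 / N * (∑ o, x (Sum.inl o) ω i * x (Sum.inl o) ω j - nT * Sig 0 i j) := by ring
    rw [e1, abs_mul, abs_of_pos (by positivity), one_div, lt_inv_mul_iff₀ hN0] at hij
    refine lt_of_le_of_lt ?_ hij
    have h1 : √(nT * (4 * L)) ≤ 2 * (N * √(L / N)) := by
      rw [Real.sqrt_le_left (by positivity), mul_pow, mul_pow, Real.sq_sqrt (by positivity)]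
      have : N ^ 2 * (L / N) = N * L := by field_simp
      rw [this]
      nlinarith
    have h2 : L ≤ N * √(L / N) := by
      have : N * √(L / N) = √(N * L) := by
        rw [← Real.sqrt_sq hN0.le, ← Real.sqrt_mul (by positivity), Real.sqrt_sq hN0.le]
        congr 1; field_simp
      rw [this]
      exact Real.le_sqrt_of_sq_le (by nlinarith)
    calc 64 * B * (√(nT * (4 * L)) + 4 * L) ≤
        64 * B * (2 * (N * √(L / N)) + 4 * (N * √(L / N))) := by gcongr
      _ = _ := by ring
  · have h1 := cast_mul_exp_neg_log hp 3
    have hp1 : (1 : ℝ) ≤ p := by exact_mod_cast (by omega : 1 ≤ p)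
    have h2 : (p : ℝ) ^ 2 ≤ p ^ 3 := pow_le_pow_right₀ hp1 (by norm_num)
    norm_num at h1 ⊢
    rw [← h1]
    calc (p : ℝ) * p * (2 * Real.exp (-(4 * L))) = 2 * (p ^ 2 * Real.exp (-(4 * L))) := by ring
      _ ≤ _ := by gcongr

lemma measure_target_noise_compl_le (hx : SubGaussianDesigns P x Sig B B)
    (he : GaussianErrors P x e B) (hL : 1 ≤ Real.log p)
    (hN : Real.log p ≤ totalSize K nS nT) (hnT : 0 < nT) :
    P {ω | ¬ ((∀ i j, |1 / totalSize K nS nT * ∑ o, x (Sum.inl o) ω i * x (Sum.inl o) ω j -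
      nT / totalSize K nS nT * Sig 0 i j| ≤ 384 * B * √(Real.log p / totalSize K nS nT)) →
      ∀ j, |1 / totalSize K nS nT * ((targetX fun o => x o ω)ᵀ *ᵥ fun i => e (Sum.inl i) ω) j| ≤
        40 * B * √(Real.log p / totalSize K nS nT))} ≤
      ENNReal.ofReal (2 * Real.exp (-Real.log p)) := by
  have hp := two_le_of_one_le_log hL
  set L := Real.log p with hLdef
  have hnTN : (nT : ℝ) ≤ totalSize K nS nT := by unfold totalSize; linarith [
    (by positivity : (0 : ℝ) ≤ K * nS)]
  set N := totalSize K nS nT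
  have hN0 : 0 < N := by linarith
  have hDm : Measurable fun ω o => x o ω := measurable_pi_iff.2 hx.measurable
  have h := measure_exists_le fun j : Fin p =>
    conditional_linear_form_tail (σ2 := B) hDm (fun i : Fin nT => he.measurable (Sum.inl i))
      (he.indep_reindex fun i => Sum.inl i) (he.indep.precomp Sum.inl_injective)
      (fun i => he.subgaussian _) (w := fun a i => a (Sum.inl i) j) (by fun_prop) (388 * B * N)
      (x := 2 * L) (by positivity)
  refine le_trans (measure_mono fun ω hω => ?_) (h.trans (ENNReal.ofReal_le_ofReal ?_))
  · simp only [Set.mem_ofPred_eq, Classical.not_imp, not_forall, not_le] at hω ⊢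
    obtain ⟨hg, j, hj⟩ := hω
    refine ⟨j, ?_, ?_⟩
    · have h1 := (abs_le.1 (hg j j)).2
      have hd : Sig 0 j j ≤ 4 * B := hx.diag_le (Sum.inl ⟨0, hnT⟩) j
      have h2 : √(L / N) ≤ 1 := by rw [Real.sqrt_le_one]; exact (div_le_one hN0).2 hN
      have h3 : (nT : ℝ) / N * Sig 0 j j ≤ 4 * B := by
        have h4 : (nT : ℝ) / N ≤ 1 := (div_le_one hN0).2 hnTN
        have h5 : (0 : ℝ) ≤ nT / N := by positivity
        calc (nT : ℝ) / N * Sig 0 j j ≤ nT / N * (4 * B) := by gcongr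
          _ ≤ 1 * (4 * B) := by gcongr
          _ = _ := one_mul _
      have h6 : 384 * (B : ℝ) * √(L / N) ≤ 384 * B := by
        have : (0 : ℝ) ≤ B := B.2
        nlinarith
      have h7 : 1 / N * ∑ o, x (Sum.inl o) ω j * x (Sum.inl o) ω j ≤ 388 * B := by linarith
      rw [one_div, inv_mul_le_iff₀ hN0] at h7
      simp only [sq]
      linarith
    · rw [abs_mul, abs_of_pos (by positivity), one_div, lt_inv_mul_iff₀ hN0] at hj
      refine lt_of_le_of_lt ?_ hj
      rw [Real.sqrt_le_left (by positivity), mul_pow, mul_pow, Real.sq_sqrt (by positivity)]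
      have e1 : N ^ 2 * ((40 * (B : ℝ)) ^ 2 * (L / N)) = 1600 * (B ^ 2 * (N * L)) := by
        field_simp; ring
      rw [e1]
      have : 0 ≤ (B : ℝ) ^ 2 * (N * L) := by positivity
      nlinarith
  · rw [Fintype.card_fin]
    have := cast_mul_exp_neg_log hp 1
    norm_num at this ⊢
    linarith

/-- The data are typical with high probability. -/
lemma measure_typicalData_compl_le (hx : SubGaussianDesigns P x Sig B B)
    (he : GaussianErrors P x e B) (hB : 1 ≤ B) (hL : 1 ≤ Real.log p)
    (hn : 12 * Real.log p ≤ nS) (hK : 1 ≤ K) (hnT : 0 < nT)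
    (hreg : (p : ℝ) ^ 5 < K → K * (p : ℝ) ^ 2 * (256 * B ^ 2 * p) ^ 2 ≤ nS)
    {t : Fin K → ℝ} (ht : ∀ k, (65 * B ^ 4 + 2) * √(Real.log p / nS) ≤ t k) :
    P {ω | ¬ TypicalData B Sig t (fun o => x o ω) (fun o => e o ω)} ≤
      ENNReal.ofReal (22 * Real.exp (-Real.log p)) := by
  have hn0 : (0 : ℝ) < nS := by linarith
  have hnn : 0 < nS := by exact_mod_cast hn0
  have hK1 : (1 : ℝ) ≤ K := by exact_mod_cast hK
  have hN : Real.log p ≤ totalSize K nS nT := by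
    have := cast_mul_le_totalSize (K := K) (nS := nS) (nT := nT)
    nlinarith
  have h1 := measure_regular_compl_le hx he hB hL hn hK
  have h2 := measure_gram_close_compl_le hx hB hL hreg
  have h3 := measure_noise_sum_compl_le hx he hB hL hn hK
  have h4 := measure_clip_sum_compl_le hx he hL hnn hK
    (t := t) (fun k => le_trans (by positivity) (ht k))
  have h5 := measure_exceedance_sum_compl_le hx he hL hnn hK ht
  have h6 := measure_target_gram_compl_le hx hB hL hN
  have h7 := measure_target_noise_compl_le hx he hL hN hnT
  have hE := Real.exp_pos (-Real.log p)
  have hsum := measure_le_add h1 (measure_le_add h2 (measure_le_add h3 (measure_le_add h4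
    (measure_le_add h5 (measure_le_add h6 h7
    (by positivity) (by positivity) subset_rfl) (by positivity) (by positivity) subset_rfl)
    (by positivity) (by positivity) subset_rfl) (by positivity) (by positivity) subset_rfl)
    (by positivity) (by positivity) subset_rfl) (by positivity) (by positivity) subset_rfl
  refine le_trans (measure_mono fun ω hω => ?_) (hsum.trans
      (ENNReal.ofReal_le_ofReal (by linarith)))
  by_contra hnot
  simp only [Set.mem_union, Set.mem_ofPred_eq, not_or, not_not] at hnot
  obtain ⟨f1, f2, f3, f4, f5, f6, f7⟩ := hnot
  exact hω ⟨f1, f2, fun h => f3 (f2 h), f4, f5, f6, f7 f6⟩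

end Typical

end TransFusion

namespace TransFusion

/-! ## Tuning parameters and rates -/

/-- The assumptions of the theorem on sample sizes, dimension, sparsity and contrasts. -/
structure Scaling (M Ch Cn : ℝ) {K : ℕ} (p nS nT s : ℕ) (h : Fin K → ℝ) : Prop where
  one_le_K : 1 ≤ K
  one_le_s : 1 ≤ s
  h_nonneg : ∀ k, 0 ≤ h k
  one_le_log : 1 ≤ Real.log p
  one_le_M : 1 ≤ M
  sample_sparsity : M * (K * (s : ℝ) ^ 2 * Real.log p) ≤ nS
  sample_shift : max (hbar nS nT h ^ 2) ((K : ℝ) ^ 2) * s * Real.log p ≤ Cn * nS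
  balance : ∀ k, h k ≤ Ch * hbar nS nT h ∧ hbar nS nT h ≤ Ch * h k

namespace Scaling

variable {M Ch Cn : ℝ} {K p nS nT s : ℕ} {h : Fin K → ℝ}

lemma cast_one_le_K (S : Scaling M Ch Cn p nS nT s h) : (1 : ℝ) ≤ K := by
  exact_mod_cast S.one_le_K

lemma cast_one_le_s (S : Scaling M Ch Cn p nS nT s h) : (1 : ℝ) ≤ s := by
  exact_mod_cast S.one_le_s

lemma log_pos (S : Scaling M Ch Cn p nS nT s h) : 0 < Real.log p :=
  one_pos.trans_le S.one_le_log

lemma mul_log_le (S : Scaling M Ch Cn p nS nT s h) : M * Real.log p ≤ nS := by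
  refine le_trans ?_ S.sample_sparsity
  have h1 := S.cast_one_le_K
  have h2 : (1 : ℝ) ≤ (s : ℝ) ^ 2 := one_le_pow₀ S.cast_one_le_s
  have h3 := S.log_pos
  have h4 := S.one_le_M
  have h5 : (1 : ℝ) ≤ K * (s : ℝ) ^ 2 := by nlinarith
  gcongr
  nlinarith

lemma nS_pos (S : Scaling M Ch Cn p nS nT s h) : (0 : ℝ) < nS := by
  have h1 := S.mul_log_le
  have h2 := S.log_pos
  have h3 := S.one_le_M
  nlinarith

lemma nS_le_totalSize (S : Scaling M Ch Cn p nS nT s h) : (nS : ℝ) ≤ totalSize K nS nT := by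
  have h1 := cast_mul_le_totalSize (K := K) (nS := nS) (nT := nT)
  have h2 := S.cast_one_le_K
  have h3 := S.nS_pos
  nlinarith

lemma totalSize_pos (S : Scaling M Ch Cn p nS nT s h) : 0 < totalSize K nS nT :=
  S.nS_pos.trans_le S.nS_le_totalSize

lemma hbar_nonneg (S : Scaling M Ch Cn p nS nT s h) : 0 ≤ hbar nS nT h := by
  have h1 := S.totalSize_pos
  have h2 : 0 ≤ ∑ k, h k := Finset.sum_nonneg fun k _ => S.h_nonneg k
  unfold hbar
  positivity

lemma r_sq (S : Scaling M Ch Cn p nS nT s h) : √(Real.log p / nS) ^ 2 = Real.log p / nS :=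
  Real.sq_sqrt (div_nonneg S.log_pos.le S.nS_pos.le)

lemma q_sq (S : Scaling M Ch Cn p nS nT s h) :
    √(Real.log p / totalSize K nS nT) ^ 2 = Real.log p / totalSize K nS nT :=
  Real.sq_sqrt (div_nonneg S.log_pos.le S.totalSize_pos.le)

lemma r_pos (S : Scaling M Ch Cn p nS nT s h) : 0 < √(Real.log p / nS) :=
  Real.sqrt_pos.2 (div_pos S.log_pos S.nS_pos)

lemma q_pos (S : Scaling M Ch Cn p nS nT s h) : 0 < √(Real.log p / totalSize K nS nT) :=
  Real.sqrt_pos.2 (div_pos S.log_pos S.totalSize_pos)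

lemma q_le_r (S : Scaling M Ch Cn p nS nT s h) :
    √(Real.log p / totalSize K nS nT) ≤ √(Real.log p / nS) :=
  Real.sqrt_le_sqrt (div_le_div_of_nonneg_left S.log_pos.le S.nS_pos S.nS_le_totalSize)

lemma weight_mul_r_sq (S : Scaling M Ch Cn p nS nT s h) :
    (nS : ℝ) / totalSize K nS nT * √(Real.log p / nS) ^ 2 = Real.log p / totalSize K nS nT := by
  have h1 := S.nS_pos
  have h2 := S.totalSize_pos
  rw [S.r_sq]
  field_simp

lemma sqrt_weight (S : Scaling M Ch Cn p nS nT s h) :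
    √((nS : ℝ) / totalSize K nS nT * (Real.log p / totalSize K nS nT)) =
      (nS : ℝ) / totalSize K nS nT * √(Real.log p / nS) := by
  have h1 := S.nS_pos
  have h2 := S.totalSize_pos
  rw [← S.weight_mul_r_sq, ← mul_assoc, ← sq, ← mul_pow]
  exact Real.sqrt_sq (by positivity)

lemma card_mul_weight_le (S : Scaling M Ch Cn p nS nT s h) :
    (K : ℝ) * ((nS : ℝ) / totalSize K nS nT) ≤ 1 := by
  rw [← mul_div_assoc]
  exact (div_le_one S.totalSize_pos).2 cast_mul_le_totalSize

lemma sparsity_mul_r_le (S : Scaling M Ch Cn p nS nT s h) {m : ℝ} (hm0 : 0 ≤ m)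
    (hm : m ^ 2 ≤ M) : m * (s * √(Real.log p / nS)) ≤ 1 := by
  have h1 := S.nS_pos
  have h2 := S.sample_sparsity
  have h3 := S.cast_one_le_K
  have h4 := S.log_pos
  have h5 := S.one_le_M
  have h6 : (m * (s * √(Real.log p / nS))) ^ 2 ≤ 1 := by
    rw [mul_pow, mul_pow, S.r_sq, ← mul_div_assoc, ← mul_div_assoc, div_le_one h1]
    refine le_trans ?_ h2
    have : (s : ℝ) ^ 2 * Real.log p ≤ K * (s : ℝ) ^ 2 * Real.log p := by
      rw [mul_assoc]; exact le_mul_of_one_le_left (by positivity) h3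
    calc _ ≤ M * ((s : ℝ) ^ 2 * Real.log p) := by gcongr
      _ ≤ _ := by gcongr
  exact (sq_le_one_iff₀ (by positivity)).1 h6

lemma card_mul_r_sq_le (S : Scaling M Ch Cn p nS nT s h) :
    ((K : ℝ) * √(Real.log p / nS)) ^ 2 ≤ Cn := by
  have h1 := S.nS_pos
  have h2 := S.sample_shift
  have h3 := S.cast_one_le_s
  have h4 := S.log_pos
  rw [mul_pow, S.r_sq, ← mul_div_assoc, div_le_iff₀ h1]
  refine le_trans ?_ h2
  have h5 : (K : ℝ) ^ 2 ≤ max (hbar nS nT h ^ 2) ((K : ℝ) ^ 2) := le_max_right _ _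
  have h6 : (0 : ℝ) ≤ (K : ℝ) ^ 2 := by positivity
  calc (K : ℝ) ^ 2 * Real.log p ≤ max (hbar nS nT h ^ 2) ((K : ℝ) ^ 2) * Real.log p := by gcongr
    _ ≤ _ := by
      gcongr
      exact le_mul_of_one_le_right (h6.trans h5) h3

lemma card_mul_r_le (S : Scaling M Ch Cn p nS nT s h) :
    (K : ℝ) * √(Real.log p / nS) ≤ 1 + Cn := by
  have h1 := S.card_mul_r_sq_le
  nlinarith [sq_nonneg ((K : ℝ) * √(Real.log p / nS) - 1)]

lemma delta_nonneg (S : Scaling M Ch Cn p nS nT s h) (k : Fin K) : 0 ≤ delta p nS nT s h k := by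
  have h1 := S.nS_pos
  have h2 := S.totalSize_pos
  have h3 := S.log_pos
  have h4 := S.h_nonneg k
  unfold delta
  positivity

lemma sum_delta :
    ∑ k, delta p nS nT s h k = delta0 p nS nT s h := by
  simp only [delta, delta0, hbar, Finset.sum_add_distrib, Finset.sum_const, Finset.card_univ,
    Fintype.card_fin, nsmul_eq_mul, ← Finset.mul_sum]
  ring

lemma r_mul_hbar_le (S : Scaling M Ch Cn p nS nT s h) :
    √(Real.log p / nS) * hbar nS nT h ≤ delta0 p nS nT s h := by
  have h1 := S.totalSize_pos
  have h2 := S.log_pos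
  unfold delta0
  have : 0 ≤ K * s * Real.log p / totalSize K nS nT := by positivity
  linarith

lemma delta0_nonneg (S : Scaling M Ch Cn p nS nT s h) : 0 ≤ delta0 p nS nT s h :=
  (mul_nonneg (Real.sqrt_nonneg _) S.hbar_nonneg).trans S.r_mul_hbar_le

lemma lambda0_pos (S : Scaling M Ch Cn p nS nT s h) {c0 : ℝ} (hc0 : 0 < c0) :
    0 < lambda0 c0 p nS nT s h := by
  have h1 := S.q_pos
  have h2 := S.delta0_nonneg
  unfold lambda0
  positivity

lemma weight_mul_lambda0 (S : Scaling M Ch Cn p nS nT s h) {c0 : ℝ} (hc0 : 0 < c0) (k : Fin K) :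
    weight c0 p nS nT s h k * lambda0 c0 p nS nT s h = c0 * max 8 (hbar nS nT h / h k) *
      ((nS : ℝ) / totalSize K nS nT * √(Real.log p / nS) + delta p nS nT s h k) := by
  rw [weight, div_mul_cancel₀ _ (S.lambda0_pos hc0).ne', S.sqrt_weight]

lemma base_pos (S : Scaling M Ch Cn p nS nT s h) (k : Fin K) :
    0 < (nS : ℝ) / totalSize K nS nT * √(Real.log p / nS) + delta p nS nT s h k := by
  have h1 := S.nS_pos
  have h2 := S.totalSize_pos
  have h3 := S.r_pos
  have h4 := S.delta_nonneg k
  positivity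

lemma weight_mul_lambda0_ge (S : Scaling M Ch Cn p nS nT s h) {c0 : ℝ} (hc0 : 0 < c0)
    (k : Fin K) :
    8 * c0 * ((nS : ℝ) / totalSize K nS nT * √(Real.log p / nS) + delta p nS nT s h k) ≤
      weight c0 p nS nT s h k * lambda0 c0 p nS nT s h := by
  rw [S.weight_mul_lambda0 hc0, mul_comm 8 c0]
  have := S.base_pos k
  gcongr
  exact le_max_left _ _

lemma weight_mul_lambda0_le (S : Scaling M Ch Cn p nS nT s h) (hCh : 0 < Ch) {c0 : ℝ}
    (hc0 : 0 < c0) (k : Fin K) :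
    weight c0 p nS nT s h k * lambda0 c0 p nS nT s h ≤
      c0 * (8 + Ch) * ((nS : ℝ) / totalSize K nS nT * √(Real.log p / nS) +
        delta p nS nT s h k) := by
  rw [S.weight_mul_lambda0 hc0]
  have := S.base_pos k
  gcongr
  refine max_le (by linarith) ?_
  -- For `h k = 0` the quotient in the weight is `0` by the convention for division by zero.
  rcases eq_or_lt_of_le (S.h_nonneg k) with h0 | h0
  · rw [← h0, div_zero]; linarith
  · rw [div_le_iff₀ h0]
    have := (S.balance k).2
    nlinarith

lemma weight_pos (S : Scaling M Ch Cn p nS nT s h) {c0 : ℝ} (hc0 : 0 < c0) (k : Fin K) :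
    0 < weight c0 p nS nT s h k := by
  have h1 := S.weight_mul_lambda0_ge hc0 k
  have h2 := S.base_pos k
  have h3 := S.lambda0_pos hc0
  have h4 : 0 < weight c0 p nS nT s h k * lambda0 c0 p nS nT s h :=
    lt_of_lt_of_le (by positivity) h1
  exact pos_of_mul_pos_left h4 h3.le

lemma base_le (S : Scaling M Ch Cn p nS nT s h) (hCh : 0 < Ch) (k j : Fin K) :
    (nS : ℝ) / totalSize K nS nT * √(Real.log p / nS) + delta p nS nT s h k ≤
      (1 + Ch ^ 2) * ((nS : ℝ) / totalSize K nS nT * √(Real.log p / nS) +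
        delta p nS nT s h j) := by
  have h1 := S.nS_pos
  have h2 := S.totalSize_pos
  have h3 := S.r_pos
  have h4 := S.log_pos
  have h5 : h k ≤ Ch ^ 2 * h j := by
    calc h k ≤ Ch * hbar nS nT h := (S.balance k).1
      _ ≤ Ch * (Ch * h j) := by gcongr; exact (S.balance j).2
      _ = _ := by ring
  unfold delta
  set w := (nS : ℝ) / totalSize K nS nT * √(Real.log p / nS)
  set l := (s : ℝ) * Real.log p / totalSize K nS nT
  have hw : 0 < w := by positivity
  have hl : 0 ≤ l := by positivity
  have h6 : w * h k ≤ w * (Ch ^ 2 * h j) := by gcongr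
  have h7 : 0 ≤ w * h j := mul_nonneg hw.le (S.h_nonneg j)
  nlinarith [mul_nonneg (sq_nonneg Ch) (add_nonneg hw.le hl)]

lemma weight_ratio (S : Scaling M Ch Cn p nS nT s h) (hCh : 0 < Ch) {c0 : ℝ}
    (hc0 : 0 < c0) (k j : Fin K) :
    weight c0 p nS nT s h k ≤ (8 + Ch) * (1 + Ch ^ 2) * weight c0 p nS nT s h j := by
  have h1 := S.weight_mul_lambda0_le hCh hc0 k
  have h2 := S.weight_mul_lambda0_ge hc0 j
  have h3 := S.base_le hCh k j
  have h4 := S.base_pos j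
  refine le_of_mul_le_mul_right ?_ (S.lambda0_pos hc0)
  set b := (nS : ℝ) / totalSize K nS nT * √(Real.log p / nS) + delta p nS nT s h j
  calc _ ≤ _ := h1
    _ ≤ c0 * (8 + Ch) * ((1 + Ch ^ 2) * b) := by gcongr
    _ = (8 + Ch) * (1 + Ch ^ 2) * (c0 * b) := by ring
    _ ≤ (8 + Ch) * (1 + Ch ^ 2) *
        (weight c0 p nS nT s h j * lambda0 c0 p nS nT s h) := by
      have : 0 < c0 * b := by positivity
      exact mul_le_mul_of_nonneg_left (by linarith) (by positivity)
    _ = _ := by ring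

lemma sum_weight_ge (S : Scaling M Ch Cn p nS nT s h) {c0 : ℝ} (hc0 : 0 < c0) :
    8 * lambda0 c0 p nS nT s h * (1 - nT / totalSize K nS nT) ≤
      ∑ k, weight c0 p nS nT s h k * lambda0 c0 p nS nT s h := by
  have hN := S.totalSize_pos
  have hK := S.card_mul_weight_le
  have hτ : 1 - nT / totalSize K nS nT = K * ((nS : ℝ) / totalSize K nS nT) := by
    have : (nT : ℝ) = totalSize K nS nT - K * nS := by unfold totalSize; ring
    rw [this]
    field_simp
    ring
  refine le_trans ?_ (Finset.sum_le_sum fun k _ => S.weight_mul_lambda0_ge hc0 k)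
  rw [← Finset.mul_sum, Finset.sum_add_distrib, sum_delta, Finset.sum_const, Finset.card_univ,
    Fintype.card_fin, nsmul_eq_mul, hτ, lambda0]
  have h1 := S.q_le_r
  have h2 := S.delta0_nonneg
  have h3 := S.nS_pos
  set w := (K : ℝ) * ((nS : ℝ) / totalSize K nS nT) with hw
  have hw0 : 0 ≤ w := by positivity
  rw [← mul_assoc (K : ℝ), ← hw]
  have h4 : w * √(Real.log p / totalSize K nS nT) ≤ w * √(Real.log p / nS) := by gcongr
  have h5 : w * delta0 p nS nT s h ≤ delta0 p nS nT s h := mul_le_of_le_one_left h2 hK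
  nlinarith

lemma clip_level_ge (S : Scaling M Ch Cn p nS nT s h) {c0 : ℝ} (hc0 : 0 < c0) (k : Fin K) :
    8 * c0 * √(Real.log p / nS) ≤ weight c0 p nS nT s h k * lambda0 c0 p nS nT s h /
      ((nS : ℝ) / totalSize K nS nT) := by
  have h1 := S.nS_pos
  have h2 := S.totalSize_pos
  have h3 := S.delta_nonneg k
  rw [le_div_iff₀ (by positivity)]
  refine le_trans ?_ (S.weight_mul_lambda0_ge hc0 k)
  have : 0 ≤ 8 * c0 * delta p nS nT s h k := by positivity
  linarith

lemma sum_delta_mul_le (S : Scaling M Ch Cn p nS nT s h) :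
    ∑ k, delta p nS nT s h k * h k ≤ Ch * hbar nS nT h * delta0 p nS nT s h := by
  rw [← sum_delta, Finset.mul_sum]
  refine Finset.sum_le_sum fun k _ => ?_
  rw [mul_comm]
  exact mul_le_mul_of_nonneg_right (S.balance k).1 (S.delta_nonneg k)

lemma sum_delta_mul_nonneg (S : Scaling M Ch Cn p nS nT s h) :
    0 ≤ ∑ k, delta p nS nT s h k * h k :=
  Finset.sum_nonneg fun k _ => mul_nonneg (S.delta_nonneg k) (S.h_nonneg k)

/-- For bounded `h̄` the rate of the distributed estimator is the rate of the central one. -/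
lemma distributedRate_le (S : Scaling M Ch Cn p nS nT s h) (hCh : 0 < Ch) {H : ℝ}
    (hH : hbar nS nT h ≤ H) (εD : ℝ) :
    distributedRate p nS nT s h εD ≤ (4 + 2 * H + Ch * H) * centralRate p nS nT s h εD := by
  have hN := S.totalSize_pos
  have hn := S.nS_pos
  have hL := S.log_pos
  have hb := S.hbar_nonneg
  have hr := S.r_pos
  have hK := S.cast_one_le_K
  have hs := S.cast_one_le_s
  have hr2 := S.r_sq
  have hsr := S.sparsity_mul_r_le (m := 1) zero_le_one (by simpa using S.one_le_M)
  rw [one_mul] at hsr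
  have hC : s * Real.log p / totalSize K nS nT + √(Real.log p / nS) * hbar nS nT h ≤
      centralRate p nS nT s h εD := by
    unfold centralRate; linarith [sq_nonneg εD]
  have h1 : s * delta0 p nS nT s h ^ 2 ≤
      2 * (s * Real.log p / totalSize K nS nT) + 2 * H * (√(Real.log p / nS) * hbar nS nT h) := by
    have h2 : delta0 p nS nT s h ^ 2 ≤ 2 * (K * s * Real.log p / totalSize K nS nT) ^ 2 +
        2 * (√(Real.log p / nS) * hbar nS nT h) ^ 2 := by
      unfold delta0
      nlinarith [sq_nonneg (K * s * Real.log p / totalSize K nS nT -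
        √(Real.log p / nS) * hbar nS nT h)]
    -- The extra factor is `K * (K * s ^ 2 * log p) / N`, and `K * s ^ 2 * log p ≤ nS` while `K * nS
    -- ≤ N`.
    have h3 : s * (K * s * Real.log p / totalSize K nS nT) ^ 2 ≤
        s * Real.log p / totalSize K nS nT := by
      have e1 : s * (K * s * Real.log p / totalSize K nS nT) ^ 2 =
          (s * Real.log p / totalSize K nS nT) *
            (K * (K * (s : ℝ) ^ 2 * Real.log p) / totalSize K nS nT) := by
        field_simp
      rw [e1]
      refine mul_le_of_le_one_right (by positivity) ((div_le_one hN).2 ?_)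
      refine le_trans ?_ cast_mul_le_totalSize
      gcongr
      refine le_trans ?_ S.sample_sparsity
      exact le_mul_of_one_le_left (by positivity) S.one_le_M
    have h4 : s * (√(Real.log p / nS) * hbar nS nT h) ^ 2 ≤
        H * (√(Real.log p / nS) * hbar nS nT h) := by
      have e1 : s * (√(Real.log p / nS) * hbar nS nT h) ^ 2 =
          (s * √(Real.log p / nS)) * (hbar nS nT h * (√(Real.log p / nS) * hbar nS nT h)) := by
        ring
      rw [e1]
      refine (mul_le_of_le_one_left (by positivity) hsr).trans ?_
      gcongr
    have h5 : s * delta0 p nS nT s h ^ 2 ≤ s * (2 * (K * s * Real.log p / totalSize K nS nT) ^ 2 +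
        2 * (√(Real.log p / nS) * hbar nS nT h) ^ 2) := by gcongr
    linarith
  have h2 : ∑ k, delta p nS nT s h k * h k ≤
      (1 + Ch * H) * (√(Real.log p / nS) * hbar nS nT h) := by
    have h3 : ∀ k, delta p nS nT s h k * h k ≤ (s * √(Real.log p / nS)) * √(Real.log p / nS) *
        ((nS : ℝ) / totalSize K nS nT * h k) +
        √(Real.log p / nS) * (Ch * H) * ((nS : ℝ) / totalSize K nS nT * h k) := fun k => by
      have h4 : h k ≤ Ch * H := (S.balance k).1.trans (by gcongr)
      have h0 := S.h_nonneg k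
      have e1 : s * √(Real.log p / nS) * √(Real.log p / nS) * ((nS : ℝ) / totalSize K nS nT * h k) =
          s * Real.log p / totalSize K nS nT * h k := by
        rw [mul_assoc (s : ℝ), ← sq, hr2]; field_simp
      rw [e1, delta, add_mul]
      refine add_le_add le_rfl ?_
      calc (nS : ℝ) / totalSize K nS nT * √(Real.log p / nS) * h k * h k ≤
          (nS : ℝ) / totalSize K nS nT * √(Real.log p / nS) * h k * (Ch * H) := by gcongr
        _ = _ := by ring
    refine (Finset.sum_le_sum fun k _ => h3 k).trans ?_
    simp only [Finset.sum_add_distrib, ← Finset.mul_sum]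
    rw [show (nS : ℝ) / totalSize K nS nT * ∑ k, h k = hbar nS nT h from rfl]
    have : s * √(Real.log p / nS) * √(Real.log p / nS) * hbar nS nT h ≤
        √(Real.log p / nS) * hbar nS nT h := by
      rw [mul_assoc]
      exact mul_le_of_le_one_left (by positivity) hsr
    linarith
  have hH0 : 0 ≤ H := hb.trans hH
  have h6 : 0 ≤ s * Real.log p / totalSize K nS nT := by positivity
  have h7 : 0 ≤ √(Real.log p / nS) * hbar nS nT h := by positivity
  have h8 : 0 ≤ Ch * H := by positivity
  unfold distributedRate
  nlinarith [mul_nonneg hH0 h6, mul_nonneg h8 h6]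

end Scaling

end TransFusion

namespace TransFusion

/-! ## Errors of the local estimators -/

section Local

variable {n p : ℕ}

/-- A feasible direction of bounded quadratic form makes the optimal one short, so the truncation in
`score` is inactive. -/
lemma IsDebiasedLasso.score_error {X : Matrix (Fin n) (Fin p) ℝ} {β bt : Fin p → ℝ}
    {e : Fin n → ℝ} {lam μ c : ℝ} (hn : 0 < n)
    (hX : ∀ j, ∃ θ ∈ debiasFeasible X μ j, θ ⬝ᵥ (gram X *ᵥ θ) ≤ c)
    (h : IsDebiasedLasso X (X *ᵥ β + e) lam μ bt) :
    ∃ b, IsLasso X (X *ᵥ β + e) lam b ∧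
      ∀ j, |bt j - β j - score c X μ e j| ≤ μ * l1 (b - β) := by
  obtain ⟨b, Th, hb, hTh, rfl⟩ := h
  refine ⟨b, hb, fun j => ?_⟩
  obtain ⟨θ, hθ, hθc⟩ := hX j
  have h1 := debiased_error X β b e Th (fun j => (hTh j).1) j
  rw [hTh.mulVec_eq hn j] at h1
  have h2 : score c X μ e j = 1 / (n : ℝ) * (debiasDirection X μ j ⬝ᵥ e) := by
    have h3 : scoreDirection c X μ j = debiasDirection X μ j :=
      if_pos (sqNorm_debiasDirection_le hθ hθc hn)
    change 1 / (n : ℝ) * (scoreDirection c X μ j ⬝ᵥ e) = _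
    rw [h3]
  rw [h2]
  exact h1

lemma RegularSample.debiased_error {X : Matrix (Fin n) (Fin p) ℝ} {S : Matrix (Fin p) (Fin p) ℝ}
    {β0 d bt : Fin p → ℝ} {e : Fin n → ℝ} {B r h : ℝ} {s : ℕ} (hreg : RegularSample B r S X e)
    (hn : 0 < n) (hB : 1 ≤ B) (hr : 0 < r) (hS : ∀ u, 1 / B * sqNorm u ≤ u ⬝ᵥ (S *ᵥ u))
    (hs : l0 β0 ≤ s) (hd : l1 d ≤ h) (hsr : 28672 * B ^ 2 * (s * r) ≤ 1)
    (hbt : IsDebiasedLasso X (X *ᵥ (β0 + d) + e) (512 * B ^ 3 * r) (512 * B ^ 3 * r) bt)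
    (j : Fin p) :
    |bt j - (β0 + d) j - score (129 * B ^ 3) X (512 * B ^ 3 * r) e j| ≤
      512 * B ^ 3 * r * (32 * B * (512 * B ^ 3 * r) * s + 8 * h) := by
  obtain ⟨b, hb, hbj⟩ := hbt.score_error hn hreg.feasible
  have hB2 : B ≤ B ^ 3 := by nlinarith [mul_nonneg (sub_nonneg.2 hB) (sub_nonneg.2 hB)]
  have h1 := lasso_l1_error X β0 d b e (by positivity) (by linarith) hb hs hd hS hreg.gram_close
    (by positivity) (le_of_eq_of_le (by ring) hsr)
    (fun j => (hreg.noise j).trans (by nlinarith))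
  exact (hbj j).trans (mul_le_mul_of_nonneg_left h1 (by positivity))

/-- Since `l1 u ^ 2 ≤ p * sqNorm u`, the perturbation takes away at most half of the curvature. -/
lemma coercive_of_gram_close {X : Matrix (Fin n) (Fin p) ℝ} {S : Matrix (Fin p) (Fin p) ℝ}
    {B : ℝ} (hB : 0 < B) (hS : ∀ u, 1 / B * sqNorm u ≤ u ⬝ᵥ (S *ᵥ u)) (hp : 0 < p)
    (hX : ∀ i j, |gram X i j - S i j| ≤ 1 / (2 * B * p)) (u : Fin p → ℝ) :
    1 / (2 * B) * sqNorm u ≤ u ⬝ᵥ (gram X *ᵥ u) := by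
  have hp0 : (0 : ℝ) < p := by exact_mod_cast hp
  have h1 := TransFusion.quadForm_ge hS hX u
  have h2 : 1 / (2 * B * p) * l1 u ^ 2 ≤ 1 / (2 * B * p) * (p * sqNorm u) := by
    gcongr; exact l1_sq_le u
  have h3 : 1 / (2 * B * p) * (p * sqNorm u) = 1 / (2 * B) * sqNorm u := by field_simp
  have h4 : 1 / B * sqNorm u = 1 / (2 * B) * sqNorm u + 1 / (2 * B) * sqNorm u := by
    field_simp; ring
  linarith

lemma exists_feasible_of_coercive {X : Matrix (Fin n) (Fin p) ℝ} {B μ : ℝ} (hB : 0 < B)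
    (hμ : 0 ≤ μ) (hX : ∀ u, 1 / B * sqNorm u ≤ u ⬝ᵥ (gram X *ᵥ u)) (j : Fin p) :
    ∃ θ ∈ debiasFeasible X μ j, θ ⬝ᵥ (gram X *ᵥ θ) ≤ B := by
  obtain ⟨θ, h1, -, h2⟩ := exists_mulVec_eq_single hB hX j
  refine ⟨θ, fun i => ?_, h2⟩
  rw [h1, sub_self, abs_zero]
  exact hμ

lemma l1_debiased_error_of_coercive {X : Matrix (Fin n) (Fin p) ℝ} {β bt : Fin p → ℝ}
    {e : Fin n → ℝ} {B c μ : ℝ} (hn : 0 < n) (hB : 0 < B) (hμ : 0 ≤ μ) (hc : B ≤ c)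
    (hX : ∀ u, 1 / B * sqNorm u ≤ u ⬝ᵥ (gram X *ᵥ u))
    (hbt : IsDebiasedLasso X (X *ᵥ β + e) μ μ bt) :
    l1 (bt - β - score c X μ e) ≤
      p * (μ * (2 * B * √p * (√(sqNorm ((1 / (n : ℝ)) • (Xᵀ *ᵥ e))) + μ * √p))) := by
  obtain ⟨b, hb, hbj⟩ := hbt.score_error hn fun j => by
    obtain ⟨θ, h1, h2⟩ := exists_feasible_of_coercive hB hμ hX j
    exact ⟨θ, h1, h2.trans hc⟩
  have h1 := lasso_l1_error_of_posDef X β b e hμ hB hb hX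
  unfold l1 at h1 ⊢
  refine (Finset.sum_le_sum fun j _ => (hbj j).trans (mul_le_mul_of_nonneg_left h1 hμ)).trans ?_
  rw [Finset.sum_const, Finset.card_univ, Fintype.card_fin, nsmul_eq_mul]

end Local

/-! ## Typical data: the source estimators -/

section SourceErrors

variable {M Ch Cn B : ℝ} {K p nS nT s : ℕ} {h : Fin K → ℝ} {t : Fin K → ℝ}
  {Sig : Fin (K + 1) → Matrix (Fin p) (Fin p) ℝ} {x : Obs K nS nT → Fin p → ℝ}
  {e : Obs K nS nT → ℝ} {β : Fin (K + 1) → Fin p → ℝ}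

/-- A single irregular source forces `1 ≤ K / p ^ 8`, hence `K > p ^ 5`; the crude bounds are needed
in that regime only. -/
lemma TypicalData.exists_good (T : TypicalData B Sig t x e) (hp : 2 ≤ p) :
    ∃ good : Finset (Fin K), (goodᶜ.card : ℝ) ≤ 1 / (p : ℝ) ^ 8 * K ∧
      (∀ k ∈ good, RegularSample B (√(Real.log p / nS)) (Sig k.succ) (sourceX x k)
        (fun i => e (Sum.inr (k, i)))) ∧ ∀ k ∉ good, (p : ℝ) ^ 5 < K := by
  obtain ⟨good, hcard, hgood⟩ := T.regular
  refine ⟨good, hcard, hgood, fun k hk => ?_⟩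
  by_contra hlt
  rw [not_lt] at hlt
  have hp0 : (2 : ℝ) ≤ p := by exact_mod_cast hp
  have h1 : (1 : ℝ) ≤ goodᶜ.card := by
    exact_mod_cast Finset.card_pos.2 ⟨k, Finset.mem_compl.2 hk⟩
  have h2 : 1 / (p : ℝ) ^ 8 * K ≤ 1 / (p : ℝ) ^ 8 * (p : ℝ) ^ 5 := by gcongr
  have h3 : 1 / (p : ℝ) ^ 8 * (p : ℝ) ^ 5 < 1 := by
    rw [one_div, inv_mul_lt_iff₀ (by positivity), mul_one]
    exact pow_lt_pow_right₀ (by linarith) (by norm_num)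
  linarith

lemma TypicalData.feasible_nonempty (T : TypicalData B Sig t x e) (hp : 2 ≤ p) (hB : 1 ≤ B)
    (hS : ∀ k u, 1 / B * sqNorm u ≤ u ⬝ᵥ (Sig k *ᵥ u)) (k : Fin K) (j : Fin p) :
    (debiasFeasible (sourceX x k) (512 * B ^ 3 * √(Real.log p / nS)) j).Nonempty := by
  obtain ⟨good, -, hgood, hbad⟩ := T.exists_good hp
  by_cases hk : k ∈ good
  · obtain ⟨θ, hθ, -⟩ := (hgood k hk).feasible j
    exact ⟨θ, hθ⟩
  · obtain ⟨θ, hθ, -⟩ := exists_feasible_of_coercive (B := 2 * B)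
      (μ := 512 * B ^ 3 * √(Real.log p / nS)) (by positivity)
      (by positivity) (coercive_of_gram_close (by linarith) (hS k.succ) (by omega)
        (T.gram_close (hbad k hk) k)) j
    exact ⟨θ, hθ⟩

/-- The total bias of the source estimators that are computed from irregular samples. -/
lemma TypicalData.irregular_bias_le (T : TypicalData B Sig t x e)
    (S : Scaling M Ch Cn p nS nT s h) (hp : 2 ≤ p) (hB : 1 ≤ B)
    (hS : ∀ k u, 1 / B * sqNorm u ≤ u ⬝ᵥ (Sig k *ᵥ u)) {good : Finset (Fin K)}
    (hcard : (goodᶜ.card : ℝ) ≤ 1 / (p : ℝ) ^ 8 * K) (hbad : ∀ k ∉ good, (p : ℝ) ^ 5 < K)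
    {bt : Fin K → Fin p → ℝ}
    (hbt : ∀ k, IsDebiasedLasso (sourceX x k)
      (sourceX x k *ᵥ β k.succ + fun i => e (Sum.inr (k, i)))
      (512 * B ^ 3 * √(Real.log p / nS)) (512 * B ^ 3 * √(Real.log p / nS)) (bt k)) :
    ∑ k ∈ goodᶜ, l1 (bt k - β k.succ - sourceScore B x e k) ≤
      2 ^ 21 * B ^ 7 * K * √(Real.log p / nS) ^ 2 := by
  set r := √(Real.log p / nS) with hr
  have hr0 : 0 < r := S.r_pos
  have hB0 : 0 < B := by linarith
  rcases goodᶜ.eq_empty_or_nonempty with hem | ⟨k0, hk0⟩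
  · rw [hem, Finset.sum_empty]; positivity
  have hreg : (p : ℝ) ^ 5 < K := hbad k0 (Finset.mem_compl.1 hk0)
  have hn0 := S.nS_pos
  have hn : 0 < nS := by exact_mod_cast hn0
  have hp0 : (2 : ℝ) ≤ p := by exact_mod_cast hp
  set μ := 512 * B ^ 3 * r with hμ
  have hμ0 : 0 ≤ μ := by positivity
  set Y : Fin K → ℝ := fun k => √(sqNorm (sourceNoise x e k)) with hY
  have hY0 : ∀ k, 0 ≤ Y k := fun k => Real.sqrt_nonneg _
  have hsqp : √(p : ℝ) ≤ p := by
    rw [Real.sqrt_le_left (by linarith)]; nlinarith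
  have hB3 : B ≤ B ^ 3 := by nlinarith [mul_nonneg (sub_nonneg.2 hB) (sub_nonneg.2 hB)]
  have hk : ∀ k, l1 (bt k - β k.succ - sourceScore B x e k) ≤
      4 * B * μ * p ^ 2 * Y k + 4 * B * μ ^ 2 * p ^ 3 := fun k => by
    have h1 := l1_debiased_error_of_coercive (B := 2 * B) (c := 129 * B ^ 3) hn (by linarith) hμ0
      (by linarith) (coercive_of_gram_close hB0 (hS k.succ) (by omega) (T.gram_close hreg k))
          (hbt k)
    refine h1.trans ?_
    change (p : ℝ) * (μ * (2 * (2 * B) * √p * (Y k + μ * √p))) ≤ _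
    have := hY0 k
    calc (p : ℝ) * (μ * (2 * (2 * B) * √p * (Y k + μ * √p))) ≤
        p * (μ * (2 * (2 * B) * p * (Y k + μ * p))) := by gcongr
      _ = _ := by ring
  -- Cauchy–Schwarz against the number of irregular sources, whose factor `p ^ (-8)` outweighs the
  -- powers of `p` lost in the crude bounds.
  have hsumY : ∑ k ∈ goodᶜ, Y k ≤ 5 * B * K * r / p ^ 3 := by
    refine abs_le_of_sq_le_sq' ?_ (by positivity) |>.2
    have h1 : (∑ k ∈ goodᶜ, Y k) ^ 2 ≤ goodᶜ.card * ∑ k ∈ goodᶜ, Y k ^ 2 :=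
      sq_sum_le_card_mul_sum_sq
    have h2 : ∑ k ∈ goodᶜ, Y k ^ 2 ≤ 20 * B ^ 2 * K * p ^ 2 / nS := by
      refine le_trans ?_ (T.noise_sum hreg)
      simp only [hY, Real.sq_sqrt (sqNorm_nonneg _)]
      exact Finset.sum_le_sum_of_subset_of_nonneg (Finset.subset_univ _)
        fun k _ _ => sqNorm_nonneg _
    have h3 : (1 : ℝ) / nS ≤ r ^ 2 := by
      rw [S.r_sq]; gcongr; exact S.one_le_log
    calc (∑ k ∈ goodᶜ, Y k) ^ 2 ≤ goodᶜ.card * ∑ k ∈ goodᶜ, Y k ^ 2 := h1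
      _ ≤ (1 / (p : ℝ) ^ 8 * K) * (20 * B ^ 2 * K * p ^ 2 / nS) := by gcongr
      _ = 20 * B ^ 2 * K ^ 2 / p ^ 6 * (1 / nS) := by field_simp
      _ ≤ 25 * B ^ 2 * K ^ 2 / p ^ 6 * r ^ 2 := by gcongr; norm_num
      _ = _ := by ring
  refine (Finset.sum_le_sum fun k _ => hk k).trans ?_
  rw [Finset.sum_add_distrib, ← Finset.mul_sum, Finset.sum_const, nsmul_eq_mul]
  have hp1 : 1 / (p : ℝ) ≤ 1 := by rw [div_le_one (by linarith)]; linarith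
  have hp5 : 1 / (p : ℝ) ^ 5 ≤ 1 := by
    rw [div_le_one (by positivity)]; exact one_le_pow₀ (by linarith)
  have hB57 : B ^ 5 ≤ B ^ 7 := pow_le_pow_right₀ hB (by norm_num)
  calc _ ≤ 4 * B * μ * p ^ 2 * (5 * B * K * r / p ^ 3) +
        (1 / (p : ℝ) ^ 8 * K) * (4 * B * μ ^ 2 * p ^ 3) := by gcongr
    _ = 20 * B ^ 2 * μ * K * r * (1 / p) + 4 * B * μ ^ 2 * K * (1 / p ^ 5) := by
      field_simp
      ring
    _ ≤ 20 * B ^ 2 * μ * K * r * 1 + 4 * B * μ ^ 2 * K * 1 := by gcongr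
    _ = 10240 * (B ^ 5 * (K * r ^ 2)) + 1048576 * (B ^ 7 * (K * r ^ 2)) := by rw [hμ]; ring
    _ ≤ 10240 * (B ^ 7 * (K * r ^ 2)) + 1048576 * (B ^ 7 * (K * r ^ 2)) := by gcongr
    _ ≤ 2 ^ 21 * (B ^ 7 * (K * r ^ 2)) := by
      have : 0 ≤ B ^ 7 * (K * r ^ 2) := by positivity
      nlinarith
    _ = _ := by ring

/-- The bias of the source estimators that are computed from regular samples. -/
lemma regular_bias_le (S : Scaling M Ch Cn p nS nT s h) (hB : 1 ≤ B)
    (hM : (28672 * B ^ 2) ^ 2 ≤ M)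
    (hS : ∀ k u, 1 / B * sqNorm u ≤ u ⬝ᵥ (Sig k *ᵥ u)) (hβ : InParameterSpace s h β) {k : Fin K}
    (hreg : RegularSample B (√(Real.log p / nS)) (Sig k.succ) (sourceX x k)
      (fun i => e (Sum.inr (k, i)))) {bt : Fin p → ℝ}
    (hbt : IsDebiasedLasso (sourceX x k) (sourceX x k *ᵥ β k.succ + fun i => e (Sum.inr (k, i)))
      (512 * B ^ 3 * √(Real.log p / nS)) (512 * B ^ 3 * √(Real.log p / nS)) bt) (j : Fin p) :
    (nS : ℝ) / totalSize K nS nT * |bt j - β k.succ j - sourceScore B x e k j| ≤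
      2 ^ 23 * B ^ 7 * delta p nS nT s h k := by
  have hn0 := S.nS_pos
  have hN := S.totalSize_pos
  have hr0 := S.r_pos
  have hsplit : β k.succ = β 0 + (β k.succ - β 0) := by abel
  rw [hsplit] at hbt
  have h1 := hreg.debiased_error (by exact_mod_cast hn0) hB hr0 (hS k.succ) hβ.1 (hβ.2 k)
    (S.sparsity_mul_r_le (by positivity) hM) hbt j
  rw [← hsplit] at h1
  have hh := S.h_nonneg k
  have hB37 : 4096 * B ^ 3 ≤ 2 ^ 23 * B ^ 7 := by
    have : B ^ 3 ≤ B ^ 7 := pow_le_pow_right₀ hB (by norm_num)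
    have : 0 ≤ B ^ 3 := by positivity
    nlinarith
  have hw := S.weight_mul_r_sq
  set r := √(Real.log p / nS)
  set w := (nS : ℝ) / totalSize K nS nT
  have hw0 : 0 < w := by positivity
  calc w * |bt j - β k.succ j - sourceScore B x e k j| ≤
      w * (512 * B ^ 3 * r * (32 * B * (512 * B ^ 3 * r) * s + 8 * h k)) := by
        gcongr; exact h1
    -- `512 * 32 * 512 = 2 ^ 23` and `512 * 8 = 4096`.
    _ = 2 ^ 23 * B ^ 7 * (s * (w * r ^ 2)) + 4096 * B ^ 3 * (w * r * h k) := by ring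
    _ ≤ 2 ^ 23 * B ^ 7 * (s * (w * r ^ 2)) + 2 ^ 23 * B ^ 7 * (w * r * h k) := by gcongr
    _ = 2 ^ 23 * B ^ 7 * delta p nS nT s h k := by rw [hw, delta]; ring

end SourceErrors

end TransFusion

namespace TransFusion

/-! ## The error of the aggregated estimator -/

section Rates

variable {M Ch Cn : ℝ} {K p nS nT s : ℕ} {h : Fin K → ℝ}

/-- `v` is the bias of irregular sources, counted as contrast. Its penalty stays within the rate
because `K * r` and `K * r ^ 2`, with `r = √(log p / nS)`, are bounded in terms of `Cn`. -/
lemma Scaling.penalty_le (S : Scaling M Ch Cn p nS nT s h) (hCh : 0 < Ch) {c0 CW : ℝ}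
    (hc0 : 0 < c0) (hCW : 0 ≤ CW) {ℓ v : Fin K → ℝ} (hv : ∀ k, 0 ≤ v k)
    (hvs : ∑ k, v k ≤ CW * K * √(Real.log p / nS) ^ 2) (hℓ : ∀ k, ℓ k ≤ h k + v k) :
    2 * ∑ k, weight c0 p nS nT s h k * lambda0 c0 p nS nT s h * ℓ k ≤
      2 * c0 * (8 + Ch) * (1 + CW * (1 + 2 * Cn + Ch)) *
        (s * Real.log p / totalSize K nS nT + √(Real.log p / nS) * hbar nS nT h +
          ∑ k, delta p nS nT s h k * h k) := by
  have hN := S.totalSize_pos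
  have hn := S.nS_pos
  have hL := S.log_pos
  have hb := S.hbar_nonneg
  have hr := S.r_pos
  have hs := S.cast_one_le_s
  have hK := S.cast_one_le_K
  have hCn2 := S.card_mul_r_sq_le
  have hCn1 := S.card_mul_r_le
  have hw2 := S.weight_mul_r_sq
  have hKw := S.card_mul_weight_le
  have hδh := S.sum_delta_mul_nonneg
  have hr1 : √(Real.log p / nS) ≤ 1 := by
    have := S.sparsity_mul_r_le (m := 1) zero_le_one (by simpa using S.one_le_M)
    nlinarith
  set r := √(Real.log p / nS)
  set w := (nS : ℝ) / totalSize K nS nT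
  set hb' := hbar nS nT h
  set l := s * Real.log p / totalSize K nS nT with hl
  have hw0 : 0 < w := by positivity
  have hl0 : 0 ≤ l := by positivity
  have hCn0 : 0 ≤ Cn := (sq_nonneg _).trans hCn2
  have hLl : Real.log p / totalSize K nS nT ≤ l := by
    rw [hl, mul_div_assoc]; exact le_mul_of_one_le_left (by positivity) hs
  have hterm : ∀ k, weight c0 p nS nT s h k * lambda0 c0 p nS nT s h * ℓ k ≤
      c0 * (8 + Ch) * (r * (w * h k) + delta p nS nT s h k * h k +
        (w * r + l + w * r * (Ch * hb')) * v k) := fun k => by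
    have h1 := S.weight_mul_lambda0_le hCh hc0 k
    have h0 := S.h_nonneg k
    have hα : 0 ≤ weight c0 p nS nT s h k * lambda0 c0 p nS nT s h :=
      (mul_pos (S.weight_pos hc0 k) (S.lambda0_pos hc0)).le
    have hbase := S.base_pos k
    have hmax : w * r + delta p nS nT s h k ≤ w * r + l + w * r * (Ch * hb') := by
      unfold delta
      have : w * r * h k ≤ w * r * (Ch * hb') := by gcongr; exact (S.balance k).1
      linarith
    calc _ ≤ weight c0 p nS nT s h k * lambda0 c0 p nS nT s h * (h k + v k) :=
          mul_le_mul_of_nonneg_left (hℓ k) hα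
      _ ≤ c0 * (8 + Ch) * (w * r + delta p nS nT s h k) * (h k + v k) :=
          mul_le_mul_of_nonneg_right h1 (add_nonneg h0 (hv k))
      _ = c0 * (8 + Ch) * (r * (w * h k) + delta p nS nT s h k * h k +
            (w * r + delta p nS nT s h k) * v k) := by ring
      _ ≤ _ := by
          have := mul_le_mul_of_nonneg_right hmax (hv k)
          exact mul_le_mul_of_nonneg_left (by linarith) (by positivity)
  have hsum := Finset.sum_le_sum fun k (_ : k ∈ Finset.univ) => hterm k
  rw [← Finset.mul_sum, Finset.sum_add_distrib, Finset.sum_add_distrib, ← Finset.mul_sum,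
    ← Finset.mul_sum, ← Finset.mul_sum, show w * ∑ k, h k = hb' from rfl] at hsum
  have hv2 : (w * r + l + w * r * (Ch * hb')) * ∑ k, v k ≤
      CW * (1 + 2 * Cn + Ch) * (l + r * hb') := by
    have g1 : w * r * (K * r ^ 2) ≤ (1 + Cn) * l := by
      calc w * r * (K * r ^ 2) = (K * r) * (w * r ^ 2) := by ring
        _ ≤ (1 + Cn) * l := by rw [hw2]; gcongr
    have g2 : l * (K * r ^ 2) ≤ Cn * l := by
      have : K * r ^ 2 ≤ Cn := by
        refine le_trans ?_ hCn2
        rw [mul_pow]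
        gcongr
        exact le_self_pow₀ hK two_ne_zero
      rw [mul_comm]; gcongr
    have g3 : w * r * (Ch * hb') * (K * r ^ 2) ≤ Ch * (r * hb') := by
      have g4 : (K * w) * r ^ 2 ≤ 1 := by
        have : r ^ 2 ≤ 1 := pow_le_one₀ hr.le hr1
        have : 0 ≤ K * w := by positivity
        nlinarith
      calc w * r * (Ch * hb') * (K * r ^ 2) = ((K * w) * r ^ 2) * (Ch * (r * hb')) := by ring
        _ ≤ 1 * (Ch * (r * hb')) := by gcongr
        _ = _ := one_mul _
    have g5 : 0 ≤ r * hb' := by positivity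
    calc _ ≤ (w * r + l + w * r * (Ch * hb')) * (CW * K * r ^ 2) := by gcongr
      _ = CW * (w * r * (K * r ^ 2) + l * (K * r ^ 2) + w * r * (Ch * hb') * (K * r ^ 2)) := by
        ring
      _ ≤ CW * ((1 + Cn) * l + Cn * l + Ch * (r * hb')) := by gcongr
      _ ≤ CW * ((1 + 2 * Cn + Ch) * (l + r * hb')) := by
        gcongr
        nlinarith [mul_nonneg hCh.le hl0, mul_nonneg hCn0 g5]
      _ = _ := by ring
  have g6 : 0 ≤ CW * (1 + 2 * Cn + Ch) := by positivity
  have g7 : r * hb' + ∑ k, delta p nS nT s h k * h k +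
      (w * r + l + w * r * (Ch * hb')) * ∑ k, v k ≤
      (1 + CW * (1 + 2 * Cn + Ch)) * (l + r * hb' + ∑ k, delta p nS nT s h k * h k) := by
    nlinarith [mul_nonneg g6 hδh]
  calc _ ≤ 2 * (c0 * (8 + Ch) * ((1 + CW * (1 + 2 * Cn + Ch)) *
        (l + r * hb' + ∑ k, delta p nS nT s h k * h k))) := by
        refine mul_le_mul_of_nonneg_left (hsum.trans ?_) zero_le_two
        exact mul_le_mul_of_nonneg_left g7 (by positivity)
    _ = _ := by ring

/-- Supplies the condition `E * R ≤ CR * lam ^ 2` of `agg_error`, in which `E` is of order `√(log p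
/ N)`. -/
lemma Scaling.noise_mul_rate_le (S : Scaling M Ch Cn p nS nT s h) (hCh : 0 < Ch) {c0 : ℝ}
    (hc0 : 1 ≤ c0) :
    √(Real.log p / totalSize K nS nT) *
      (s * Real.log p / totalSize K nS nT + √(Real.log p / nS) * hbar nS nT h +
        ∑ k, delta p nS nT s h k * h k) ≤ (1 + Ch) * lambda0 c0 p nS nT s h ^ 2 := by
  have hb := S.hbar_nonneg
  have hq := S.q_pos
  have hq2 := S.q_sq
  have hqr := S.q_le_r
  have hd := S.delta0_nonneg
  have hrd := S.r_mul_hbar_le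
  have hsd := S.sum_delta_mul_le
  have hs := S.cast_one_le_s
  have hsr := S.sparsity_mul_r_le (m := 1) zero_le_one (by simpa using S.one_le_M)
  rw [one_mul] at hsr
  unfold lambda0
  set q := √(Real.log p / totalSize K nS nT)
  set r := √(Real.log p / nS)
  set δ := delta0 p nS nT s h
  have hsq : s * q ≤ 1 := le_trans (by gcongr) hsr
  have h1 : q * (s * Real.log p / totalSize K nS nT) ≤ q ^ 2 := by
    rw [mul_div_assoc, ← hq2]
    calc q * (s * q ^ 2) = (s * q) * q ^ 2 := by ring
      _ ≤ 1 * q ^ 2 := by gcongr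
      _ = _ := one_mul _
  have h2 : q * (r * hbar nS nT h) ≤ q * δ := by gcongr
  have h3 : q * ∑ k, delta p nS nT s h k * h k ≤ Ch * δ ^ 2 := by
    calc q * ∑ k, delta p nS nT s h k * h k ≤ r * (Ch * hbar nS nT h * δ) := by
          refine mul_le_mul hqr hsd S.sum_delta_mul_nonneg (hq.le.trans hqr)
      _ = Ch * ((r * hbar nS nT h) * δ) := by ring
      _ ≤ Ch * (δ * δ) := by gcongr
      _ = _ := by ring
  have h4 : (q + δ) ^ 2 ≤ (c0 * (q + δ)) ^ 2 := by
    rw [mul_pow]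
    exact le_mul_of_one_le_left (by positivity) (one_le_pow₀ hc0)
  calc _ ≤ q ^ 2 + q * δ + Ch * δ ^ 2 := by linarith
    _ ≤ (1 + Ch) * (q + δ) ^ 2 := by
      nlinarith [mul_nonneg hq.le hd, mul_nonneg hCh.le (mul_nonneg hq.le hd),
        mul_nonneg hCh.le (sq_nonneg q), sq_nonneg δ]
    _ ≤ _ := by gcongr

lemma Scaling.log_div_le_distributedRate (S : Scaling M Ch Cn p nS nT s h) (εD : ℝ) :
    Real.log p / totalSize K nS nT ≤ distributedRate p nS nT s h εD := by
  have hN := S.totalSize_pos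
  have hL := S.log_pos
  have h1 : Real.log p / totalSize K nS nT ≤ s * Real.log p / totalSize K nS nT := by
    rw [mul_div_assoc]; exact le_mul_of_one_le_left (by positivity) S.cast_one_le_s
  have h2 := S.sum_delta_mul_nonneg
  have h3 : 0 ≤ √(Real.log p / nS) * hbar nS nT h :=
    mul_nonneg (Real.sqrt_nonneg _) S.hbar_nonneg
  have h4 : 0 ≤ s * delta0 p nS nT s h ^ 2 := by positivity
  unfold distributedRate centralRate
  linarith [sq_nonneg εD]

lemma Scaling.penaltyRate_le_distributedRate (εD : ℝ) :
    s * Real.log p / totalSize K nS nT + √(Real.log p / nS) * hbar nS nT h +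
      ∑ k, delta p nS nT s h k * h k ≤ distributedRate p nS nT s h εD := by
  have h4 : 0 ≤ s * delta0 p nS nT s h ^ 2 := by positivity
  unfold distributedRate centralRate
  linarith [sq_nonneg εD]

lemma Scaling.sq_le_distributedRate (S : Scaling M Ch Cn p nS nT s h) (εD : ℝ) :
    εD ^ 2 ≤ distributedRate p nS nT s h εD := by
  have hN := S.totalSize_pos
  have hL := S.log_pos
  have h1 : 0 ≤ s * Real.log p / totalSize K nS nT := by positivity
  have h2 := S.sum_delta_mul_nonneg
  have h3 : 0 ≤ √(Real.log p / nS) * hbar nS nT h :=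
    mul_nonneg (Real.sqrt_nonneg _) S.hbar_nonneg
  have h4 : 0 ≤ s * delta0 p nS nT s h ^ 2 := by positivity
  unfold distributedRate centralRate
  linarith

lemma Scaling.sparsity_mul_lambda0_sq_le (S : Scaling M Ch Cn p nS nT s h) (c0 εD : ℝ) :
    s * lambda0 c0 p nS nT s h ^ 2 ≤ 2 * c0 ^ 2 * distributedRate p nS nT s h εD := by
  have h0 := S.sum_delta_mul_nonneg
  have h3 : 0 ≤ √(Real.log p / nS) * hbar nS nT h :=
    mul_nonneg (Real.sqrt_nonneg _) S.hbar_nonneg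
  have hq2 := S.q_sq
  unfold lambda0
  set q := √(Real.log p / totalSize K nS nT)
  have hsq2 : s * q ^ 2 = s * Real.log p / totalSize K nS nT := by rw [hq2, mul_div_assoc]
  have h1 : s * (q + delta0 p nS nT s h) ^ 2 ≤ 2 * distributedRate p nS nT s h εD := by
    have h2 : (q + delta0 p nS nT s h) ^ 2 ≤ 2 * q ^ 2 + 2 * delta0 p nS nT s h ^ 2 := by
      nlinarith [sq_nonneg (q - delta0 p nS nT s h)]
    have h4 : s * (q + delta0 p nS nT s h) ^ 2 ≤
        s * (2 * q ^ 2 + 2 * delta0 p nS nT s h ^ 2) := by gcongr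
    unfold distributedRate centralRate
    linarith [sq_nonneg εD]
  calc s * (c0 * (q + delta0 p nS nT s h)) ^ 2 =
      c0 ^ 2 * (s * (q + delta0 p nS nT s h) ^ 2) := by ring
    _ ≤ c0 ^ 2 * (2 * distributedRate p nS nT s h εD) := by gcongr
    _ = _ := by ring

/-- The weighted bias of the irregular sources is of order `K * log p / N`; its square enters the
error. -/
lemma Scaling.card_mul_q_sq_sq_le (S : Scaling M Ch Cn p nS nT s h) (εD : ℝ) :
    (K * √(Real.log p / totalSize K nS nT) ^ 2) ^ 2 ≤ Cn * distributedRate p nS nT s h εD := by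
  have h1 := S.log_div_le_distributedRate εD
  rw [← S.q_sq] at h1
  have h2 := S.q_le_r
  have h3 := S.card_mul_r_sq_le
  have h4 := S.q_pos
  set q := √(Real.log p / totalSize K nS nT)
  have h5 : (K * q) ^ 2 ≤ Cn := le_trans (by gcongr) h3
  calc (K * q ^ 2) ^ 2 = (K * q) ^ 2 * q ^ 2 := by ring
    _ ≤ Cn * distributedRate p nS nT s h εD :=
      mul_le_mul h5 h1 (sq_nonneg _) ((sq_nonneg _).trans h5)

end Rates

/-! ## Splitting the errors of the sources into noise and contrasts -/

section Splitting

variable {K p : ℕ} {good : Finset (Fin K)} {g bias contrast : Fin K → Fin p → ℝ}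

/-- The centred part of the error of the sources, with the bias of the regular ones. -/
def noisePart (good : Finset (Fin K)) (g bias : Fin K → Fin p → ℝ) (k : Fin K) : Fin p → ℝ :=
  g k + if k ∈ good then bias k else 0

/-- The contrasts, with the bias of the irregular sources. -/
def contrastPart (good : Finset (Fin K)) (contrast bias : Fin K → Fin p → ℝ) (k : Fin K) :
    Fin p → ℝ :=
  contrast k + if k ∈ good then 0 else bias k

lemma contrastPart_add_noisePart (k : Fin K) :
    contrastPart good contrast bias k + noisePart good g bias k = contrast k + g k + bias k := by
  unfold contrastPart noisePart
  split_ifs <;> abel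

lemma weight_mul_noisePart_le {ω ξ : ℝ} {α : Fin K → ℝ} (hω : 0 ≤ ω) {k : Fin K} (hk : k ∈ good)
    {j : Fin p} (hg : ω * |g k j| ≤ ξ) (hb : ω * |bias k j| ≤ α k / 2 - ξ) :
    ω * |noisePart good g bias k j| ≤ α k / 2 := by
  have h1 : |noisePart good g bias k j| ≤ |g k j| + |bias k j| := by
    simp only [noisePart, if_pos hk, Pi.add_apply]; exact abs_add_le _ _
  have h2 := mul_le_mul_of_nonneg_left h1 hω
  linarith

/-- On good sources neither the score nor its sum with the bias reaches the clipping level; on the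
others the bias is left out. So the excess of the noise part is that of the score alone. -/
lemma clip_noisePart {ω : ℝ} {α : Fin K → ℝ} (hω : 0 < ω) {k : Fin K} {j : Fin p}
    (hα : 0 ≤ α k) (hg : k ∈ good → ω * |g k j| ≤ α k)
    (hz : k ∈ good → ω * |noisePart good g bias k j| ≤ α k / 2) :
    clip (α k / ω) (noisePart good g bias k j) =
      clip (α k / ω) (g k j) + if k ∈ good then bias k j else 0 := by
  by_cases hk : k ∈ good
  · have h1 := hz hk
    rw [clip_of_abs_le (by rw [le_div_iff₀ hω, mul_comm]; linarith),
      clip_of_abs_le (by rw [le_div_iff₀ hω, mul_comm]; exact hg hk)]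
    simp only [noisePart, if_pos hk, Pi.add_apply]
  · simp only [noisePart, if_neg hk, add_zero]

lemma l1_contrastPart_le {h : Fin K → ℝ} {k : Fin K} (hc : l1 (contrast k) ≤ h k) :
    l1 (contrastPart good contrast bias k) ≤ h k + if k ∈ good then 0 else l1 (bias k) := by
  unfold contrastPart
  split_ifs
  · rw [add_zero, add_zero]; exact hc
  · exact (l1_add_le _ _).trans (add_le_add hc le_rfl)

lemma sum_irregular (good : Finset (Fin K)) (f : Fin K → ℝ) :
    ∑ k, (if k ∈ good then 0 else f k) = ∑ k ∈ goodᶜ, f k := by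
  have : (goodᶜ : Finset (Fin K)) = Finset.univ.filter fun k => ¬ k ∈ good := by ext; simp
  rw [this, Finset.sum_filter]
  exact Finset.sum_congr rfl fun k _ => by split_ifs <;> rfl

lemma sqNorm_sum_contrastPart_le {ω ε W : ℝ} (hω : 0 ≤ ω) (hε : l1 (ω • ∑ k, contrast k) ≤ ε)
    (hW : ω * ∑ k ∈ goodᶜ, l1 (bias k) ≤ W) :
    sqNorm (ω • ∑ k, contrastPart good contrast bias k) ≤ 2 * ε ^ 2 + 2 * W ^ 2 := by
  have h1 : l1 (ω • ∑ k, contrastPart good contrast bias k) ≤ ε + W := by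
    have h2 : ω • ∑ k, contrastPart good contrast bias k = ω • ∑ k, contrast k +
        ω • ∑ k, (if k ∈ good then 0 else bias k) := by
      simp only [contrastPart, Finset.sum_add_distrib, smul_add]
    rw [h2]
    refine (l1_add_le _ _).trans (add_le_add hε ?_)
    rw [l1_smul, abs_of_nonneg hω]
    refine le_trans (mul_le_mul_of_nonneg_left ?_ hω) hW
    refine (l1_sum_le _ _).trans ?_
    rw [← sum_irregular]
    refine Finset.sum_le_sum fun k _ => ?_
    split_ifs
    · exact l1_zero.le
    · exact le_rfl
  calc _ ≤ l1 (ω • ∑ k, contrastPart good contrast bias k) ^ 2 := sqNorm_le_l1_sq _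
    _ ≤ (ε + W) ^ 2 := pow_le_pow_left₀ (l1_nonneg _) h1 2
    _ ≤ _ := by nlinarith [sq_nonneg (ε - W)]

lemma abs_sum_regular_bias_le {ω C : ℝ} (hω : 0 ≤ ω) (hC : 0 ≤ C) {δ : Fin K → ℝ}
    (hδ : ∀ k, 0 ≤ δ k) {j : Fin p} (hb : ∀ k ∈ good, ω * |bias k j| ≤ C * δ k) :
    |ω * ∑ k, (if k ∈ good then bias k j else 0)| ≤ C * ∑ k, δ k := by
  rw [abs_mul, abs_of_nonneg hω, Finset.mul_sum]
  refine (mul_le_mul_of_nonneg_left (Finset.abs_sum_le_sum_abs _ _) hω).trans ?_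
  rw [Finset.mul_sum]
  refine Finset.sum_le_sum fun k _ => ?_
  split_ifs with hk
  · exact hb k hk
  · rw [abs_zero, mul_zero]
    exact mul_nonneg hC (hδ k)

end Splitting

/-! ### Error bound on typical data. -/

section Main

variable {M Ch Cn B : ℝ} {K p nS nT s : ℕ} {h : Fin K → ℝ}
  {Sig : Fin (K + 1) → Matrix (Fin p) (Fin p) ℝ} {x : Obs K nS nT → Fin p → ℝ}
  {e : Obs K nS nT → ℝ} {β : Fin (K + 1) → Fin p → ℝ}

/-- The constant in the bound for the penalty at the true contrasts. -/
def penaltyConstant (c0 CW Ch Cn : ℝ) : ℝ := 2 * c0 * (8 + Ch) * (1 + CW * (1 + 2 * Cn + Ch))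

/-- The constant in the error bound. -/
def errorConstant (B c0 CW Ch Cn : ℝ) : ℝ :=
  3 * (128 * ((8 + Ch) * (1 + Ch ^ 2)) * B ^ 2 * c0 ^ 2 +
    (8 + 64 * (384 * B * penaltyConstant c0 CW Ch Cn * (1 + Ch))) * B *
      penaltyConstant c0 CW Ch Cn + (2 + 2 * CW ^ 2 * Cn) + 4)

lemma target_coercive (T_gram : ∀ i j, |1 / totalSize K nS nT *
      ∑ o, x (Sum.inl o) i * x (Sum.inl o) j - nT / totalSize K nS nT * Sig 0 i j| ≤
      384 * B * √(Real.log p / totalSize K nS nT)) (hN : 0 < totalSize K nS nT)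
    (hS : ∀ u, 1 / B * sqNorm u ≤ u ⬝ᵥ (Sig 0 *ᵥ u)) (u : Fin p → ℝ) :
    1 / B * (nT / totalSize K nS nT * sqNorm u) -
      384 * B * √(Real.log p / totalSize K nS nT) * l1 u ^ 2 ≤
      1 / totalSize K nS nT * sqNorm (targetX x *ᵥ u) := by
  set N := totalSize K nS nT
  have hτ : (0 : ℝ) ≤ nT / N := by positivity
  have h1 := TransFusion.quadForm_ge (A := (1 / N) • ((targetX x)ᵀ * targetX x))
    (B := (nT / N : ℝ) • Sig 0) (c := 1 / B * (nT / N))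
    (η := 384 * B * √(Real.log p / N)) (fun v => by
      rw [Matrix.smul_mulVec, dotProduct_smul, smul_eq_mul]
      have := mul_le_mul_of_nonneg_left (hS v) hτ
      linarith) (fun i j => by
      have := T_gram i j
      rw [Matrix.smul_apply, Matrix.smul_apply, Matrix.mul_apply]
      exact this) u
  have h2 : u ⬝ᵥ (((1 / N) • ((targetX x)ᵀ * targetX x)) *ᵥ u) =
      1 / N * sqNorm (targetX x *ᵥ u) := by
    rw [Matrix.smul_mulVec, ← Matrix.mulVec_mulVec, dotProduct_smul, dotProduct_transpose_mulVec,
      dotProduct_self_eq, smul_eq_mul]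
  rw [h2] at h1
  linarith


set_option maxHeartbeats 1600000 in
/-- The error of the aggregated estimator in terms of the errors of the sources. -/
lemma Scaling.aggregation_error_le (S : Scaling M Ch Cn p nS nT s h) (hB : 1 ≤ B) (hCh : 0 < Ch)
    {c0 CW : ℝ} (hc0 : 126 * B ^ 2 ≤ c0) (hCW : 0 ≤ CW)
    (hM : (256 * 384 * B ^ 2 * ((8 + Ch) * (1 + Ch ^ 2))) ^ 2 ≤ M)
    (hβ : InParameterSpace s h β) {εD : ℝ} (hdiv : TaskDiversity nS nT β εD)
    {bt g : Fin K → Fin p → ℝ} {b : Fin (K + 1) → Fin p → ℝ} {good : Finset (Fin K)}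
    (hcard : 2 * ((8 + Ch) * (1 + Ch ^ 2)) * (goodᶜ.card : ℝ) ≤ K)
    (hg : ∀ k ∈ good, ∀ j, |g k j| ≤ 56 * B ^ 2 * √(Real.log p / nS))
    (hbias : ∀ k ∈ good, ∀ j, (nS : ℝ) / totalSize K nS nT * |(bt k - β k.succ - g k) j| ≤
      c0 / 4 * delta p nS nT s h k)
    (hirr : ∑ k ∈ goodᶜ, l1 (bt k - β k.succ - g k) ≤ CW * K * √(Real.log p / nS) ^ 2)
    (hclip : ∀ j, |(nS : ℝ) / totalSize K nS nT * ∑ k, clip (weight c0 p nS nT s h k *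
      lambda0 c0 p nS nT s h / ((nS : ℝ) / totalSize K nS nT)) (g k j)| ≤
        23 * B ^ 2 * √(Real.log p / totalSize K nS nT))
    (hexc : sqNorm (fun j => (nS : ℝ) / totalSize K nS nT * ∑ k, (g k j -
      clip (weight c0 p nS nT s h k * lambda0 c0 p nS nT s h /
        ((nS : ℝ) / totalSize K nS nT)) (g k j))) ≤ 4 * (Real.log p / totalSize K nS nT))
    (hcoer : ∀ u, 1 / B * (nT / totalSize K nS nT * sqNorm u) -
      384 * B * √(Real.log p / totalSize K nS nT) * l1 u ^ 2 ≤
      1 / totalSize K nS nT * sqNorm (targetX x *ᵥ u))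
    (hnoise : ∀ j, |1 / totalSize K nS nT * ((targetX x)ᵀ *ᵥ fun i => e (Sum.inl i)) j| ≤
      40 * B * √(Real.log p / totalSize K nS nT))
    (hb : IsMinOn (aggObjective (nS := nS) bt (targetX x)
      (targetX x *ᵥ β 0 + fun i => e (Sum.inl i)) (lambda0 c0 p nS nT s h)
      (weight c0 p nS nT s h)) Set.univ b) :
    sqNorm (((nS : ℝ) / totalSize K nS nT) • ∑ k : Fin K, b k.succ +
      ((nT : ℝ) / totalSize K nS nT) • b 0 - β 0) ≤
      errorConstant B c0 CW Ch Cn * distributedRate p nS nT s h εD := by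
  have hB0 : 0 < B := by linarith
  have hB12 : B ≤ B ^ 2 := le_self_pow₀ hB two_ne_zero
  have hc00 : 0 < c0 := lt_of_lt_of_le (by positivity) hc0
  have hc01 : 1 ≤ c0 := by nlinarith
  have hN := S.totalSize_pos
  have hn := S.nS_pos
  have hr0 := S.r_pos
  have hq0 := S.q_pos
  have hδ := S.delta_nonneg
  have hδ0 := S.delta0_nonneg
  have hlam := S.lambda0_pos hc00
  have hαge := S.weight_mul_lambda0_ge hc00
  have hαpos := fun k => mul_pos (S.weight_pos hc00 k) hlam
  have hpen := fun (ℓ v : Fin K → ℝ) => S.penalty_le hCh hc00 hCW (ℓ := ℓ) (v := v)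
  have hrate := S.noise_mul_rate_le hCh hc01
  have hCn0 : 0 ≤ Cn := (sq_nonneg _).trans S.card_mul_r_sq_le
  have hlamdef : lambda0 c0 p nS nT s h = c0 *
    (√(Real.log p / totalSize K nS nT) + delta0 p nS nT s h) := rfl
  have hslam := S.sparsity_mul_lambda0_sq_le c0 εD
  have hKq := S.card_mul_q_sq_sq_le εD
  have hwr := S.weight_mul_r_sq
  have hqsq := S.q_sq
  have hLD := S.log_div_le_distributedRate εD
  have hεD := S.sq_le_distributedRate εD
  have hsρ := S.sparsity_mul_r_le (by positivity) hM
  have hqr := S.q_le_r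
  have hagg := fun (d z : Fin K → Fin p → ℝ) (R CR : ℝ)
      (hbt : bt = fun k => β 0 + d k + z k) => agg_error
    (lam := lambda0 c0 p nS nT s h) (a := weight c0 p nS nT s h) (d := d) (z := z) (R := R)
    (ρ := (8 + Ch) * (1 + Ch ^ 2)) (c := 1 / B) (good := good)
    (E := 384 * B * √(Real.log p / totalSize K nS nT)) (CR := CR) hlam (S.weight_pos hc00)
    (hbt ▸ hb) (by exact_mod_cast hn) S.one_le_K hβ.1 rfl rfl
  have hρ := S.weight_ratio hCh hc00
  have hαsum := S.sum_weight_ge hc00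
  have hDle := Scaling.penaltyRate_le_distributedRate (K := K) (p := p) (nS := nS) (nT := nT)
    (s := s) (h := h) εD
  have hD0 : 0 ≤ distributedRate p nS nT s h εD := (sq_nonneg εD).trans hεD
  set ρ := (8 + Ch) * (1 + Ch ^ 2) with hρdef
  have hρ1 : 1 ≤ ρ := by nlinarith [sq_nonneg Ch, mul_nonneg hCh.le (sq_nonneg Ch)]
  set ω := (nS : ℝ) / totalSize K nS nT with hω
  have hω0 : 0 < ω := by positivity
  set q := √(Real.log p / totalSize K nS nT)
  set r := √(Real.log p / nS)
  set lam := lambda0 c0 p nS nT s h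
  set a := weight c0 p nS nT s h
  set bias : Fin K → Fin p → ℝ := fun k => bt k - β k.succ - g k with hbiasdef
  set contrast : Fin K → Fin p → ℝ := fun k => β k.succ - β 0 with hcontrast
  -- Regular bias is small entrywise and joins the noise; irregular bias is small only in total ℓ₁
  -- norm and joins the contrasts.
  have hbt : bt = fun k => β 0 + contrastPart good contrast bias k + noisePart good g bias k := by
    funext k
    rw [add_assoc, contrastPart_add_noisePart, hbiasdef, hcontrast]
    simp only
    abel
  have hgω : ∀ k ∈ good, ∀ j, ω * |g k j| ≤ c0 * (ω * r) := fun k hk j => by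
    calc ω * |g k j| ≤ ω * (56 * B ^ 2 * r) := mul_le_mul_of_nonneg_left (hg k hk j) hω0.le
      _ = 56 * B ^ 2 * (ω * r) := by ring
      _ ≤ c0 * (ω * r) := mul_le_mul_of_nonneg_right (by nlinarith) (by positivity)
  have hcr : 0 ≤ c0 * (ω * r) := by positivity
  have hcδ : ∀ k, 0 ≤ c0 * delta p nS nT s h k := fun k => mul_nonneg hc00.le (hδ k)
  have hz : ∀ k ∈ good, ∀ j, ω * |noisePart good g bias k j| ≤ a k * lam / 2 := fun k hk j =>
    weight_mul_noisePart_le (α := fun k => a k * lam) hω0.le hk (hgω k hk j) (by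
      refine (hbias k hk j).trans ?_
      have h1 := hαge k
      have h2 := hcδ k
      linarith)
  have hclipz : ∀ k j, clip (a k * lam / ω) (noisePart good g bias k j) =
      clip (a k * lam / ω) (g k j) + if k ∈ good then bias k j else 0 := fun k j =>
    clip_noisePart (α := fun k => a k * lam) hω0 (hαpos k).le (fun hk => (hgω k hk j).trans (by
      have h1 := hαge k
      have h2 := hcδ k
      linarith)) fun hk => hz k hk j
  -- `lam / 2` has two parts: `c0 / 2 * q` covers the clipped noise and the target noise, as `23 * B
  -- ^ 2 + 40 * B ≤ 63 * B ^ 2`; `c0 / 2 * delta0` covers the summed bias.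
  have hnz : ∀ j, |ω * ∑ k, clip (a k * lam / ω) (noisePart good g bias k j) +
      1 / totalSize K nS nT * ((targetX x)ᵀ *ᵥ fun i => e (Sum.inl i)) j| ≤ lam / 2 := fun j => by
    have h1 : |ω * ∑ k, if k ∈ good then bias k j else 0| ≤ c0 / 4 * delta0 p nS nT s h := by
      rw [← Scaling.sum_delta]
      exact abs_sum_regular_bias_le hω0.le (by positivity) hδ fun k hk => hbias k hk j
    have h2 := hclip j
    have h3 := hnoise j
    simp only [hclipz, Finset.sum_add_distrib, mul_add]
    refine (abs_add_three _ _ _).trans ?_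
    have h4 : lam / 2 = c0 / 2 * q + c0 / 2 * delta0 p nS nT s h := by rw [hlamdef]; ring
    have h5 : (23 * B ^ 2 + 40 * B) * q ≤ c0 / 2 * q :=
      mul_le_mul_of_nonneg_right (by linarith) hq0.le
    have h7 : 0 ≤ c0 * delta0 p nS nT s h := by positivity
    linarith
  set R := 2 * ∑ k, a k * lam * l1 (contrastPart good contrast bias k) with hR
  have hRle : R ≤ penaltyConstant c0 CW Ch Cn * (s * Real.log p / totalSize K nS nT +
      r * hbar nS nT h + ∑ k, delta p nS nT s h k * h k) := by
    refine hpen _ (fun k => if k ∈ good then 0 else l1 (bias k)) (fun k => ?_) ?_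
      fun k => l1_contrastPart_le (hβ.2 k)
    · split_ifs
      · exact le_rfl
      · exact l1_nonneg _
    · rw [sum_irregular]; exact hirr
  have hCR0 : 0 ≤ penaltyConstant c0 CW Ch Cn := by unfold penaltyConstant; positivity
  set CR1 := penaltyConstant c0 CW Ch Cn with hCR1
  have hER : 384 * B * q * R ≤ 384 * B * CR1 * (1 + Ch) * lam ^ 2 := by
    have h1 := mul_le_mul_of_nonneg_left hRle (by positivity : 0 ≤ 384 * B * q)
    have h2 := mul_le_mul_of_nonneg_left hrate (by positivity : 0 ≤ 384 * B * CR1)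
    calc _ ≤ _ := h1
      _ = _ := by ring
      _ ≤ _ := h2
      _ = _ := by ring
  have hEs : 256 * (384 * B * q * s * ρ) ≤ 1 / B := by
    rw [le_div_iff₀ hB0]
    refine le_trans ?_ hsρ
    calc 256 * (384 * B * q * s * ρ) * B = 256 * 384 * B ^ 2 * ρ * (s * q) := by ring
      _ ≤ _ := by gcongr
  have hmain := hagg _ _ R _ hbt hR (by positivity) (by rw [div_le_one hB0]; exact hB)
    (by positivity) hρ hρ1 hαsum hcard hz hnz hcoer hEs hER
  have ht2 : R ≤ CR1 * distributedRate p nS nT s h εD :=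
    hRle.trans (mul_le_mul_of_nonneg_left hDle hCR0)
  have ht3 : sqNorm (ω • ∑ k, contrastPart good contrast bias k) ≤
      (2 + 2 * CW ^ 2 * Cn) * distributedRate p nS nT s h εD := by
    refine (sqNorm_sum_contrastPart_le (ε := εD) (W := CW * (K * q ^ 2)) hω0.le hdiv ?_).trans ?_
    · calc ω * ∑ k ∈ goodᶜ, l1 (bias k) ≤ ω * (CW * K * r ^ 2) := by gcongr
        _ = CW * (K * (ω * r ^ 2)) := by ring
        _ = _ := by rw [hwr, hqsq]
    · rw [mul_pow CW]
      have := mul_le_mul_of_nonneg_left hKq (sq_nonneg CW)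
      linarith
  have ht4 : sqNorm (fun j => ω * ∑ k, (noisePart good g bias k j -
      clip (a k * lam / ω) (noisePart good g bias k j))) ≤
      4 * distributedRate p nS nT s h εD := by
    have h1 : ∀ k j, noisePart good g bias k j - clip (a k * lam / ω) (noisePart good g bias k j) =
        g k j - clip (a k * lam / ω) (g k j) := fun k j => by
      rw [hclipz]
      simp only [noisePart, Pi.add_apply]
      split_ifs
      · ring
      · rw [Pi.zero_apply]; ring
    simp only [h1]
    exact hexc.trans (mul_le_mul_of_nonneg_left hLD (by norm_num))
  refine hmain.trans ?_
  generalize distributedRate p nS nT s h εD = D at *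
  have e1 : 64 * (s * ρ * lam ^ 2) / (1 / B) ^ 2 = 64 * B ^ 2 * ρ * (s * lam ^ 2) := by
    field_simp
  have e2 : (8 + 64 * (384 * B * CR1 * (1 + Ch))) * R / (1 / B) =
      (8 + 64 * (384 * B * CR1 * (1 + Ch))) * B * R := by
    field_simp
  rw [e1, e2]
  calc _ ≤ 3 * (64 * B ^ 2 * ρ * (2 * c0 ^ 2 * D) +
        (8 + 64 * (384 * B * CR1 * (1 + Ch))) * B * (CR1 * D) +
        (2 + 2 * CW ^ 2 * Cn) * D + 4 * D) := by gcongr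
    _ = _ := by rw [errorConstant, ← hCR1, ← hρdef]; ring

/-- The error of the estimator on typical data. -/
lemma TypicalData.sqNorm_error_le {c0 CW : ℝ} (hc0 : c0 = 2 ^ 25 * B ^ 7)
    (hCW : CW = 2 ^ 21 * B ^ 7)
    (T : TypicalData B Sig (fun k => weight c0 p nS nT s h k *
      lambda0 c0 p nS nT s h / ((nS : ℝ) / totalSize K nS nT)) x e)
    (S : Scaling M Ch Cn p nS nT s h) (hB : 1 ≤ B) (hCh : 0 < Ch)
    (hM1 : (28672 * B ^ 2) ^ 2 ≤ M)
    (hM2 : (256 * 384 * B ^ 2 * ((8 + Ch) * (1 + Ch ^ 2))) ^ 2 ≤ M)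
    (hp : 2 * ((8 + Ch) * (1 + Ch ^ 2)) ≤ (p : ℝ) ^ 8)
    (hS : ∀ k u, 1 / B * sqNorm u ≤ u ⬝ᵥ (Sig k *ᵥ u)) (hβ : InParameterSpace s h β)
    {εD : ℝ} (hdiv : TaskDiversity nS nT β εD)
    {bt : Fin K → Fin p → ℝ} {b : Fin (K + 1) → Fin p → ℝ}
    (hbt : ∀ k, IsDebiasedLasso (sourceX x k)
      (sourceX x k *ᵥ β k.succ + fun i => e (Sum.inr (k, i)))
      (512 * B ^ 3 * √(Real.log p / nS)) (512 * B ^ 3 * √(Real.log p / nS)) (bt k))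
    (hb : IsMinOn (aggObjective (nS := nS) bt (targetX x)
      (targetX x *ᵥ β 0 + fun i => e (Sum.inl i)) (lambda0 c0 p nS nT s h)
      (weight c0 p nS nT s h)) Set.univ b) :
    sqNorm (((nS : ℝ) / totalSize K nS nT) • ∑ k : Fin K, b k.succ +
      ((nT : ℝ) / totalSize K nS nT) • b 0 - β 0) ≤
      errorConstant B c0 CW Ch Cn * distributedRate p nS nT s h εD := by
  have hp2 := two_le_of_one_le_log S.one_le_log
  obtain ⟨good, hcard, hgood, hbad⟩ := T.exists_good hp2
  have hB2 : 1 ≤ B ^ 2 := one_le_pow₀ hB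
  have hB27 : B ^ 2 ≤ B ^ 7 := pow_le_pow_right₀ hB (by norm_num)
  refine S.aggregation_error_le (good := good) (g := sourceScore B x e) hB hCh ?_ ?_ hM2 hβ hdiv ?_
    (fun k hk j => (hgood k hk).score_le j) (fun k hk j => ?_) ?_ T.clip_sum T.exceedance_sum
    (target_coercive T.target_gram S.totalSize_pos (hS 0)) T.target_noise hb
  · rw [hc0]; linarith
  · rw [hCW]; positivity
  · have hp0 : (2 : ℝ) ≤ p := by exact_mod_cast hp2
    calc _ ≤ (p : ℝ) ^ 8 * (1 / (p : ℝ) ^ 8 * K) := by gcongr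
      _ = K := by field_simp
  · rw [hc0]
    exact (regular_bias_le S hB hM1 hS hβ (hgood k hk) (hbt k) j).trans (le_of_eq (by ring))
  · rw [hCW]
    exact T.irregular_bias_le S hp2 hB hS hcard hbad hbt

end Main

/-! ### Existence of the estimator and the probability bound. -/

lemma TypicalData.exists_isOneStepDTransFusion {M Ch Cn B : ℝ} {K p nS nT s : ℕ} {h : Fin K → ℝ}
    {Sig : Fin (K + 1) → Matrix (Fin p) (Fin p) ℝ} {t : Fin K → ℝ} {x : Obs K nS nT → Fin p → ℝ}
    {e : Obs K nS nT → ℝ} (T : TypicalData B Sig t x e) (S : Scaling M Ch Cn p nS nT s h)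
    (hB : 1 ≤ B) (hS : ∀ k u, 1 / B * sqNorm u ≤ u ⬝ᵥ (Sig k *ᵥ u)) {c0 : ℝ} (hc0 : 0 < c0)
    (y : Obs K nS nT → ℝ) :
    ∃ w, IsOneStepDTransFusion x y (512 * B ^ 3 * √(Real.log p / nS))
      (512 * B ^ 3 * √(Real.log p / nS)) (lambda0 c0 p nS nT s h) (weight c0 p nS nT s h) w := by
  have hr := S.r_pos
  have h1 : ∀ k, ∃ bt, IsDebiasedLasso (sourceX x k) (sourceY y k)
      (512 * B ^ 3 * √(Real.log p / nS)) (512 * B ^ 3 * √(Real.log p / nS)) bt := fun k => by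
    obtain ⟨b, hb⟩ := exists_isLasso (sourceX x k) (sourceY y k)
      (by positivity : 0 < 512 * B ^ 3 * √(Real.log p / nS))
    obtain ⟨Th, hTh⟩ := exists_isDebiasMatrix (sourceX x k)
      (T.feasible_nonempty (two_le_of_one_le_log S.one_le_log) hB hS k)
    exact ⟨_, b, Th, hb, hTh, rfl⟩
  choose bt hbt using h1
  obtain ⟨b, hb⟩ := exists_isMinOn_aggObjective (nS := nS) bt (targetX x) (targetY y)
    (S.lambda0_pos hc0) (S.weight_pos hc0)
  exact ⟨_, bt, b, hbt, hb, rfl⟩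

/-- From `K ^ 2 ≤ Cn * nS`, replacing one factor `K` by `p ^ 5` and using one factor `p` against `Cn
* A`. -/
lemma Scaling.card_large {M Ch Cn : ℝ} {K p nS nT s : ℕ} {h : Fin K → ℝ}
    (S : Scaling M Ch Cn p nS nT s h) {A : ℝ} (hA : Cn * A ≤ p) (hK : (p : ℝ) ^ 5 < K) :
    K * A * (p : ℝ) ^ 4 ≤ nS := by
  have hn := S.nS_pos
  have hL := S.one_le_log
  have h1 := S.card_mul_r_sq_le
  rw [mul_pow, S.r_sq, mul_div_assoc', div_le_iff₀ hn] at h1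
  have hK0 : (0 : ℝ) < K := lt_of_lt_of_le one_pos S.cast_one_le_K
  have hp0 : (0 : ℝ) ≤ p := p.cast_nonneg
  have h2 : (K : ℝ) ^ 2 ≤ Cn * nS := by nlinarith [sq_nonneg (K : ℝ)]
  have hCn : 0 < Cn := by
    by_contra hneg
    nlinarith [sq_pos_of_pos hK0]
  have h3 : Cn * (K * A * (p : ℝ) ^ 4) ≤ Cn * nS := by
    calc Cn * (K * A * (p : ℝ) ^ 4) = K * ((Cn * A) * (p : ℝ) ^ 4) := by ring
      _ ≤ K * (p * (p : ℝ) ^ 4) := by gcongr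
      _ = K * (p : ℝ) ^ 5 := by ring
      _ ≤ K * K := by gcongr
      _ = (K : ℝ) ^ 2 := by ring
      _ ≤ _ := h2
  exact le_of_mul_le_mul_left h3 hCn

lemma one_le_mul_exp_neg_log {D : ℝ} {p : ℕ} (hD : 1 ≤ D) (hp : p ≤ D) :
    1 ≤ D * Real.exp (-Real.log p) := by
  rcases p.eq_zero_or_pos with rfl | h0
  · simpa using hD
  · have h1 : (0 : ℝ) < p := by exact_mod_cast h0
    rw [Real.exp_neg, Real.exp_log h1, ← div_eq_mul_inv, one_le_div h1]
    exact hp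

lemma one_le_log_of_three_le {p : ℕ} (hp : (3 : ℝ) ≤ p) : 1 ≤ Real.log p := by
  rw [Real.le_log_iff_exp_le (by linarith)]
  exact Real.exp_one_lt_d9.le.trans (by linarith)

/-- The estimator exists and satisfies the error bounds with high probability, for dimensions above
a threshold. -/
lemma measure_error_le {B : ℝ≥0} (hB : 1 ≤ B) {M Ch Cn : ℝ} (hCh : 0 < Ch) {c0 c1 CW : ℝ}
    (hc0 : c0 = 2 ^ 25 * (B : ℝ) ^ 7) (hc1 : c1 = 512 * (B : ℝ) ^ 3)
    (hCW : CW = 2 ^ 21 * (B : ℝ) ^ 7) {K p nS nT s : ℕ} {h : Fin K → ℝ}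
    (S : Scaling M Ch Cn p nS nT s h) (hM : 12 ≤ M) (hM1 : (28672 * (B : ℝ) ^ 2) ^ 2 ≤ M)
    (hM2 : (256 * 384 * (B : ℝ) ^ 2 * ((8 + Ch) * (1 + Ch ^ 2))) ^ 2 ≤ M)
    (hp : 2 * ((8 + Ch) * (1 + Ch ^ 2)) ≤ p) (hp2 : Cn * (256 * (B : ℝ) ^ 2) ^ 2 ≤ p)
    {β : Fin (K + 1) → Fin p → ℝ} (hβ : InParameterSpace s h β) {εD : ℝ}
    (hdiv : TaskDiversity nS nT β εD) {Ω : Type*} [MeasurableSpace Ω] {P : Measure Ω}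
    [IsProbabilityMeasure P] {x : Obs K nS nT → Ω → Fin p → ℝ} {e : Obs K nS nT → Ω → ℝ}
    {Sig : Fin (K + 1) → Matrix (Fin p) (Fin p) ℝ} (hx : SubGaussianDesigns P x Sig B B)
    (he : GaussianErrors P x e B) (hnT : 0 < nT) :
    P {ω | ¬ ((∃ w, IsOneStepDTransFusion (fun o => x o ω) (fun o => response x e β o ω)
        (c1 * √(Real.log p / nS)) (c1 * √(Real.log p / nS))
        (lambda0 c0 p nS nT s h) (weight c0 p nS nT s h) w) ∧
      ∀ w, IsOneStepDTransFusion (fun o => x o ω) (fun o => response x e β o ω)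
        (c1 * √(Real.log p / nS)) (c1 * √(Real.log p / nS))
        (lambda0 c0 p nS nT s h) (weight c0 p nS nT s h) w →
        sqNorm (w - β 0) ≤ errorConstant B c0 CW Ch Cn * distributedRate p nS nT s h εD)} ≤
      ENNReal.ofReal (22 * Real.exp (-Real.log p)) := by
  have hB1 : (1 : ℝ) ≤ B := hB
  have hc00 : 0 < c0 := by rw [hc0]; positivity
  have hp1 : (1 : ℝ) ≤ p := by
    exact_mod_cast (by have := two_le_of_one_le_log S.one_le_log; omega : 1 ≤ p)
  have hS : ∀ k u, 1 / (B : ℝ) * sqNorm u ≤ u ⬝ᵥ (Sig k *ᵥ u) := fun k u => by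
    have hnS : 0 < nS := by exact_mod_cast S.nS_pos
    refine Fin.cases ?_ (fun k => ?_) k
    · exact hx.quadForm_ge (Sum.inl ⟨0, hnT⟩) u
    · exact hx.quadForm_ge (Sum.inr (k, ⟨0, hnS⟩)) u
  refine le_trans (measure_mono fun ω hω => ?_) (measure_typicalData_compl_le (t := fun k =>
    weight c0 p nS nT s h k * lambda0 c0 p nS nT s h / ((nS : ℝ) / totalSize K nS nT))
    hx he hB S.one_le_log ?_ S.one_le_K hnT (fun hK => ?_) fun k => ?_)
  · refine fun T => hω ?_
    rw [hc1]
    refine ⟨T.exists_isOneStepDTransFusion S hB1 hS hc00 _, ?_⟩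
    rintro w ⟨bt, b, hbt, hb, rfl⟩
    exact T.sqNorm_error_le hc0 hCW S hB1 hCh hM1 hM2
      (hp.trans (le_self_pow₀ hp1 (by norm_num))) hS hβ hdiv hbt hb
  · exact le_trans (mul_le_mul_of_nonneg_right hM S.log_pos.le) S.mul_log_le
  · exact le_trans (le_of_eq (by ring)) (S.card_large hp2 hK)
  · refine le_trans (mul_le_mul_of_nonneg_right ?_ S.r_pos.le) (S.clip_level_ge hc00 k)
    have h1 : (B : ℝ) ^ 4 ≤ (B : ℝ) ^ 7 := pow_le_pow_right₀ hB1 (by norm_num)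
    have h2 : (1 : ℝ) ≤ (B : ℝ) ^ 7 := one_le_pow₀ hB1
    rw [hc0]
    linarith

lemma penaltyConstant_nonneg {c0 CW Ch Cn : ℝ} (hc0 : 0 ≤ c0) (hCW : 0 ≤ CW) (hCh : 0 ≤ Ch)
    (hCn : 0 ≤ Cn) : 0 ≤ penaltyConstant c0 CW Ch Cn := by
  unfold penaltyConstant
  positivity

lemma errorConstant_pos {B c0 CW Ch Cn : ℝ} (hB : 0 ≤ B) (hc0 : 0 ≤ c0) (hCW : 0 ≤ CW)
    (hCh : 0 ≤ Ch) (hCn : 0 ≤ Cn) : 0 < errorConstant B c0 CW Ch Cn := by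
  have := penaltyConstant_nonneg hc0 hCW hCh hCn
  unfold errorConstant
  positivity

end TransFusion

theorem theorem3 (cL : ℝ) (hcL : 0 < cL) (κ σ2 : ℝ≥0) :
    ∃ c0 > (0 : ℝ), ∃ c1 > (0 : ℝ),
    ∀ Ch > (0 : ℝ), ∀ Cn > (0 : ℝ),
    ∃ M > (0 : ℝ), ∃ C > (0 : ℝ),
    ∃ c2 > (0 : ℝ), ∃ c3 > (0 : ℝ), ∃ c4 > (0 : ℝ), ∃ c5 > (0 : ℝ),
    ∀ H > (0 : ℝ), ∃ C' > (0 : ℝ),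
    ∀ (p K nS nT s : ℕ) (h : Fin K → ℝ) (β : Fin (K + 1) → Fin p → ℝ) (εD : ℝ)
      (Ω : Type*) [MeasurableSpace Ω] (P : Measure Ω) [IsProbabilityMeasure P]
      (x : TransFusion.Obs K nS nT → Ω → Fin p → ℝ) (e : TransFusion.Obs K nS nT → Ω → ℝ)
      (Sig : Fin (K + 1) → Matrix (Fin p) (Fin p) ℝ),
      1 ≤ K → 1 ≤ s → (∀ k, 0 ≤ h k) →
      TransFusion.InParameterSpace s h β →
      TransFusion.TaskDiversity nS nT β εD →
      TransFusion.SubGaussianDesigns P x Sig cL κ →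
      TransFusion.GaussianErrors P x e σ2 →
      M * (K * (s : ℝ) ^ 2 * Real.log p) ≤ nS →
      max (TransFusion.hbar nS nT h ^ 2) ((K : ℝ) ^ 2) * s * Real.log p ≤ Cn * nS →
      (∀ k, h k ≤ Ch * TransFusion.hbar nS nT h ∧ TransFusion.hbar nS nT h ≤ Ch * h k) →
      P {ω | ¬ (
        (∃ w, TransFusion.IsOneStepDTransFusion (fun o => x o ω)
          (fun o => TransFusion.response x e β o ω)
          (c1 * √(Real.log p / nS)) (c1 * √(Real.log p / nS))
          (TransFusion.lambda0 c0 p nS nT s h) (TransFusion.weight c0 p nS nT s h) w) ∧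
        ∀ w, TransFusion.IsOneStepDTransFusion (fun o => x o ω)
          (fun o => TransFusion.response x e β o ω)
          (c1 * √(Real.log p / nS)) (c1 * √(Real.log p / nS))
          (TransFusion.lambda0 c0 p nS nT s h) (TransFusion.weight c0 p nS nT s h) w →
          TransFusion.sqNorm (w - β 0) ≤ C * TransFusion.distributedRate p nS nT s h εD ∧
          (TransFusion.hbar nS nT h ≤ H →
            TransFusion.sqNorm (w - β 0) ≤ C' * TransFusion.centralRate p nS nT s h εD))} ≤
        ENNReal.ofReal (c2 * Real.exp (-c3 * nT) + c4 * Real.exp (-c5 * Real.log p)) := by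
  -- One constant `B ≥ 1` dominates all constants of the data model.
  obtain ⟨B, hB, hcB, hκB, hσB⟩ : ∃ B : ℝ≥0, 1 ≤ B ∧ cL ≤ B ∧ κ ≤ B ∧ σ2 ≤ B :=
    ⟨max (max 1 cL.toNNReal) (max κ σ2), le_max_of_le_left (le_max_left _ _),
      (Real.le_coe_toNNReal cL).trans (by exact_mod_cast le_max_of_le_left (le_max_right _ _)),
      le_max_of_le_right (le_max_left _ _), le_max_of_le_right (le_max_right _ _)⟩
  have hB1 : (1 : ℝ) ≤ B := hB
  obtain ⟨c0, hc0⟩ : ∃ c0 : ℝ, c0 = 2 ^ 25 * (B : ℝ) ^ 7 := ⟨_, rfl⟩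
  obtain ⟨c1, hc1⟩ : ∃ c1 : ℝ, c1 = 512 * (B : ℝ) ^ 3 := ⟨_, rfl⟩
  obtain ⟨CW, hCW⟩ : ∃ CW : ℝ, CW = 2 ^ 21 * (B : ℝ) ^ 7 := ⟨_, rfl⟩
  have hc00 : 0 < c0 := by rw [hc0]; positivity
  have hc10 : 0 < c1 := by rw [hc1]; positivity
  have hCW0 : 0 < CW := by rw [hCW]; positivity
  refine ⟨c0, hc00, c1, hc10, fun Ch hCh Cn hCn => ?_⟩
  obtain ⟨M, hM, hM1, hM2⟩ : ∃ M : ℝ, 12 ≤ M ∧ (28672 * (B : ℝ) ^ 2) ^ 2 ≤ M ∧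
      (256 * 384 * (B : ℝ) ^ 2 * ((8 + Ch) * (1 + Ch ^ 2))) ^ 2 ≤ M :=
    ⟨max 12 (max _ _), le_max_left _ _, le_max_of_le_right (le_max_left _ _),
      le_max_of_le_right (le_max_right _ _)⟩
  -- `D` is both the dimension threshold below which the claim is trivial and the constant in front
  -- of `1 / p`.
  obtain ⟨D, hD, hD1, hD2⟩ : ∃ D : ℝ, 22 ≤ D ∧ 2 * ((8 + Ch) * (1 + Ch ^ 2)) ≤ D ∧
      Cn * (256 * (B : ℝ) ^ 2) ^ 2 ≤ D :=
    ⟨max 22 (max _ _), le_max_left _ _, le_max_of_le_right (le_max_left _ _),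
      le_max_of_le_right (le_max_right _ _)⟩
  have hC := TransFusion.errorConstant_pos (zero_le_one.trans hB1) hc00.le hCW0.le hCh.le hCn.le
  refine ⟨M, by linarith, TransFusion.errorConstant B c0 CW Ch Cn, hC, 1, one_pos, 1, one_pos, D,
    by linarith, 1, one_pos, fun H hH => ⟨TransFusion.errorConstant B c0 CW Ch Cn *
        (4 + 2 * H + Ch * H),
    by positivity, ?_⟩⟩
  intro p K nS nT s h β εD Ω _ P _ x e Sig hK hs hh hβ hdiv hx he hsp hsh hbal
  have hE : 0 < Real.exp (-1 * (nT : ℝ)) := Real.exp_pos _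
  have hE' : 0 < Real.exp (-1 * Real.log p) := Real.exp_pos _
  -- Without target observations the term `c2 * exp (-c3 * nT)` equals `1` and the bound is trivial.
  rcases nT.eq_zero_or_pos with h0 | hnT
  · refine prob_le_one.trans (ENNReal.one_le_ofReal.2 ?_)
    have h1 : Real.exp (-1 * (nT : ℝ)) = 1 := by rw [h0, Nat.cast_zero, mul_zero, Real.exp_zero]
    rw [h1]
    have : 0 < D * Real.exp (-1 * Real.log p) := mul_pos (by linarith) hE'
    linarith
  -- For small dimensions `D * exp (-log p) ≥ 1`, and the bound is again trivial.
  rcases le_total (p : ℝ) D with hpD | hpD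
  · refine prob_le_one.trans (ENNReal.one_le_ofReal.2 ?_)
    have := TransFusion.one_le_mul_exp_neg_log (by linarith) hpD
    rw [neg_one_mul (Real.log p)]
    linarith
  have S : TransFusion.Scaling M Ch Cn p nS nT s h :=
    ⟨hK, hs, hh, TransFusion.one_le_log_of_three_le (by linarith), by linarith, hsp, hsh, hbal⟩
  have hmain := TransFusion.measure_error_le hB hCh hc0 hc1 hCW S hM hM1 hM2 (hD1.trans hpD)
      (hD2.trans hpD)
    hβ hdiv (hx.mono hcL hcB hκB) (he.mono hσB) hnT
  refine (measure_mono ?_).trans (hmain.trans (ENNReal.ofReal_le_ofReal ?_))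
  · refine fun ω hω hgood => hω ⟨hgood.1, fun w hw => ?_⟩
    have h1 := hgood.2 w hw
    refine ⟨h1, fun hbH => h1.trans ?_⟩
    rw [mul_assoc]
    exact mul_le_mul_of_nonneg_left (S.distributedRate_le hCh hbH εD) hC.le
  · rw [neg_one_mul (Real.log p)] at hE' ⊢
    have := mul_le_mul_of_nonneg_right hD hE'.le
    linarith
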